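/- Let $f\in C^1([0,\infty))$ satisfy $f(s)>0$, $f'(s)>0$ and $F(s):=\int_s^\infty \frac{d\tau}{f(\tau)}<\infty$ for all $s>0$, and let $f\in C^2((s_0,\infty))$ for some $s_0>0$. For a nonlinearity $h$ with tail integral $H(s)=\int_s^\infty d\tau/h(\tau)$ put \[ \frac1{B_1[h]}=(-\log H)\,(1-h'H),\qquad \frac1{B_2[h]}=h'H\,(-\log H)^2\Big[\frac{h\,h''H}{h'}-1\Big]. \] Assume that $\lim_{s\to\infty}f'(s)F(s)=1$ and that $B:=\lim_{s\to\infty}B_2[f](s)$ exists and lies in $[1,\infty)$. For $0\neq x\in\mathbb R^2$ near $0$ define, if $B>1$ (with $B'=B/(B-1)$), \[ v(x)=\Big(\log\tfrac1{|x|^2}\Big)^{1/B'},\qquad g(s)=\frac{4}{BB'}\,s^{1-2B'}e^{s^{B'}}, \] and, if $B=1$, \[ v(x)=\log\log\tfrac1{|x|^2},\qquad g(s)=4\,\frac{e^{e^s}}{e^{2s}}. \] Let $G(s)=\int_s^\infty d\tau/g(\tau)$, $\tilde u(x)=F^{-1}[G(v(x))]$, and \[ R_i(x)=\Big|\frac1{B_i[f](\tilde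 u(x))}-\frac1{B_i[g](v(x))}\Big|,\qquad i=1,2. \] Assume moreover that $\lim_{x\to0}(-\log|x|)^{1/2}\,[R_1(x)+R_2(x)]=0$. Then there are $R>0$ and a positive radial function $u_\infty\in C^2(B_R\setminus\{0\})\cap C(\overline{B_R}\setminus\{0\})$, where $B_R\subset\mathbb R^2$ is the disc of radius $R$ about $0$, such that \[ -\Delta u_\infty=f(u_\infty)\ \text{ in } B_R\setminus\{0\},\qquad u_\infty=0\ \text{ on }\partial B_R, \] in the classical sense, $u_\infty(x)\to\infty$ as $x\to0$, and \[ u_\infty(x)=\tilde u(x)+O\Big(f(\tilde u(x))\,F(\tilde u(x))\sup_{0<|y|\le|x|}\big(R_1(y)+R_2(y)\big)\Big)\qquad\text{as } x\to0 . \] Furthermore $u_\infty$ and $f(u_\infty)$ belong to $L^1_{\mathrm{loc}}(B_R)$, and $-\Delta u_\infty=f(u_\infty)$ in $B_R$ in the sense of distributions. -/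

import Mathlib

open scoped Laplacian

noncomputable section

namespace SingularSol

/-- The plane `ℝ²` with its Euclidean norm. -/
abbrev Plane : Type := EuclideanSpace ℝ (Fin 2)

/-- `F(s) = ∫_s^∞ dτ / h(τ)`; applied to `f` it gives `F`, applied to `g` it gives `G`. -/
def tailInt (h : ℝ → ℝ) (s : ℝ) : ℝ := ∫ τ in Set.Ioi s, (h τ)⁻¹

/-- `1 / B₁[h](s) = (-log F(s)) (1 - h'(s) F(s))`. -/
def invB1 (h : ℝ → ℝ) (s : ℝ) : ℝ :=
  (-Real.log (tailInt h s)) * (1 - deriv h s * tailInt h s)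

/-- `1 / B₂[h](s) = h'(s) F(s) (-log F(s))² (h(s) h''(s) F(s) / h'(s) - 1)`. -/
def invB2 (h : ℝ → ℝ) (s : ℝ) : ℝ :=
  deriv h s * tailInt h s * (-Real.log (tailInt h s)) ^ 2 *
    (h s * deriv (deriv h) s * tailInt h s / deriv h s - 1)

/-- Condition (f1): beyond some `s₀ > 0`, `f` is `C²`, positive, with finite tail integral `F`
and positive derivative. -/
def CondF1 (f : ℝ → ℝ) : Prop :=
  ∃ s₀ : ℝ, 0 < s₀ ∧ ContDiffOn ℝ 2 f (Set.Ioi s₀) ∧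
    ∀ s, s₀ < s →
      0 < f s ∧ MeasureTheory.IntegrableOn (fun τ => (f τ)⁻¹) (Set.Ioi s) ∧ 0 < deriv f s

/-- Condition (f2), with `B` the limit of `B₂[f]`. -/
def CondF2 (f : ℝ → ℝ) (B : ℝ) : Prop :=
  Filter.Tendsto (fun s => deriv f s * tailInt f s) Filter.atTop (nhds 1) ∧
  Filter.Tendsto (fun s => 1 / invB2 f s) Filter.atTop (nhds B) ∧
  1 ≤ B

/-- The model nonlinearity `g`; `B.conjExponent = B / (B - 1)` is the Hölder conjugate `B'`. -/
def modelG (B : ℝ) (s : ℝ) : ℝ :=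
  if B = 1 then 4 * (Real.exp (Real.exp s) / Real.exp (2 * s))
  else 4 / (B * B.conjExponent) * s ^ (1 - 2 * B.conjExponent) * Real.exp (s ^ B.conjExponent)

/-- The explicit solution `v` of `-Δ v = g(v)`. -/
def modelV (B : ℝ) (x : Plane) : ℝ :=
  if B = 1 then Real.log (Real.log (1 / ‖x‖ ^ 2))
  else (Real.log (1 / ‖x‖ ^ 2)) ^ (1 / B.conjExponent)

/-- `ũ(x) = F⁻¹[G(v(x))]`, with `F⁻¹` the inverse of `F` on `(0, ∞)`. -/
def uTilde (f : ℝ → ℝ) (B : ℝ) (x : Plane) : ℝ :=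
  Function.invFunOn (tailInt f) (Set.Ioi 0) (tailInt (modelG B) (modelV B x))

/-- `R₁(x) = |1 / B₁[f](ũ(x)) - 1 / B₁[g](v(x))|`. -/
def R₁ (f : ℝ → ℝ) (B : ℝ) (x : Plane) : ℝ :=
  |invB1 f (uTilde f B x) - invB1 (modelG B) (modelV B x)|

/-- `R₂(x) = |1 / B₂[f](ũ(x)) - 1 / B₂[g](v(x))|`. -/
def R₂ (f : ℝ → ℝ) (B : ℝ) (x : Plane) : ℝ :=
  |invB2 f (uTilde f B x) - invB2 (modelG B) (modelV B x)|

/-- `(-log |x|)^{1/2} (R₁(x) + R₂(x)) → 0` as `x → 0`. -/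
def CondR (f : ℝ → ℝ) (B : ℝ) : Prop :=
  Filter.Tendsto (fun x : Plane => √(-Real.log ‖x‖) * (R₁ f B x + R₂ f B x))
    (nhdsWithin 0 {0}ᶜ) (nhds 0)

/-- `u = ũ + O(f(ũ) F(ũ) sup_{0 < |y| ≤ |x|} (R₁(y) + R₂(y)))` as `x → 0`. -/
def HasSingularAsymptotics (f : ℝ → ℝ) (B : ℝ) (u : Plane → ℝ) : Prop :=
  (fun x => u x - uTilde f B x) =O[nhdsWithin 0 {0}ᶜ]
    (fun x => f (uTilde f B x) * tailInt f (uTilde f B x) *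
      sSup ((fun y => R₁ f B y + R₂ f B y) '' {y : Plane | 0 < ‖y‖ ∧ ‖y‖ ≤ ‖x‖}))

/-- `u` is a positive radial classical solution of `-Δ u = f(u)` in the punctured ball
`B_R ∖ {0}`, continuous up to `∂B_R`, with `u = 0` on `∂B_R`. -/
structure IsClassicalRadialSolution (f : ℝ → ℝ) (R : ℝ) (u : Plane → ℝ) : Prop where
  contDiffOn : ContDiffOn ℝ 2 u (Metric.ball 0 R \ {0})
  continuousOn : ContinuousOn u (Metric.closedBall 0 R \ {0})
  radial : ∀ x y : Plane, x ∈ Metric.closedBall 0 R \ {0} → ‖x‖ = ‖y‖ → u x = u y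
  pos : ∀ x ∈ Metric.ball (0 : Plane) R \ {0}, 0 < u x
  equation : ∀ x ∈ Metric.ball (0 : Plane) R \ {0}, -(Δ u) x = f (u x)
  boundary : ∀ x ∈ Metric.sphere (0 : Plane) R, u x = 0

/-- `-Δ u = f(u)` in the sense of distributions in the open set `Ω`: both `u` and `f(u)` are
locally integrable in `Ω`, and the equation holds against every `φ ∈ C_c^∞(Ω)`. -/
structure IsDistributionalSolution (f : ℝ → ℝ) (Ω : Set Plane) (u : Plane → ℝ) : Prop where
  locInt : MeasureTheory.LocallyIntegrableOn u Ω
  locInt_comp : MeasureTheory.LocallyIntegrableOn (fun x => f (u x)) Ω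
  weak : ∀ φ : Plane → ℝ, ContDiff ℝ (⊤ : ℕ∞) φ → HasCompactSupport φ → tsupport φ ⊆ Ω →
    -(∫ x in Ω, u x * (Δ φ) x) = ∫ x in Ω, f (u x) * φ x

end SingularSol

end

open Filter Set MeasureTheory
open scoped Topology

namespace SingularSol

/-! With t = log(1/|x|²) and u(x) = V(t), the equation in the punctured disc becomes V'' = -e^{-t}
f(V)/4, and a singular solution is one with V → ∞. Put V = F⁻¹(e^{-y}). Since dV/dy = fF and
d(fF)/dy = (f'F - 1) fF, the equation turns into y'' + (p(y) - 1) y'² + e^{y-t}/4 = 0 with p = f'F,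
so the nonlinearity enters only through p. For the model g everything is explicit: y₀ = `modelY`
solves the equation with p(y) replaced by `modelP`, and ũ is the function belonging to y₀. In these
variables R₁ and R₂ are weighted sizes of p(y₀) - `modelP` and of its derivative, so that with ρ =
`supRem` these are O(ρ/t) and O(ρ/t²).

The deviation φ = y - y₀ satisfies φ'' = (2/(Bt)) φ' - φ/(Bt) - (p(y₀) - `modelP`) + remainder. The
homogeneous solutions oscillate with phase 2√(t/B) and grow like t^{1/4 + 1/B}. A small solution is
therefore found by integrating from infinity, as a fixed point (`exists_decaying_solution`,
`exists_perturbed_solution`). The first-order form of the equation multiplies the remainder by √t;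
the assumption √t ρ → 0 is what keeps it a contraction. The outcome |φ| ≤ Mρ is carried back to u at
the cost of a factor fF (`Admissible.abs_logInv_sub_le`, `Admissible.exists_singular_near`).

The profile V is increasing and concave, so continued backwards it lies below a tangent line and
reaches zero at a finite τ, which fixes R = e^{-τ/2} (`Admissible.exists_extension`). Finally fF → 0
forces V' → 0 (`Admissible.tendsto_amplitude`), and V' is the flux through small circles: its decay
makes f(u) integrable and excludes a Dirac mass at the origin (`IsProfile.integrableOn_comp`,
`IsProfile.weak`). -/

theorem hasDerivAt_integral_Ioi {E : Type*} [NormedAddCommGroup E] [NormedSpace ℝ E]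
    [CompleteSpace E] {k : ℝ → E} {a t : ℝ} (hk : IntegrableOn k (Ioi a)) (hat : a < t)
    (hc : ∀ s, a < s → ContinuousAt k s) :
    HasDerivAt (fun s => ∫ τ in Ioi s, k τ) (-k t) t := by
  have hsub : ∀ b, a < b → ContinuousOn k (Ioi a) := fun b _ s hs => (hc s hs).continuousWithinAt
  have hi : IntervalIntegrable k volume a t := by
    rw [intervalIntegrable_iff_integrableOn_Ioc_of_le hat.le]
    exact hk.mono_set Ioc_subset_Ioi_self
  have h1 : HasDerivAt (fun s => ∫ τ in a..s, k τ) (k t) t := by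
    refine intervalIntegral.integral_hasDerivAt_right hi ?_ (hc t hat)
    exact (hsub t hat).stronglyMeasurableAtFilter isOpen_Ioi t hat
  have h2 := h1.const_sub (∫ τ in Ioi a, k τ)
  refine h2.congr_of_eventuallyEq ?_
  filter_upwards [lt_mem_nhds hat] with s hs
  rw [← intervalIntegral.integral_Ioi_sub_Ioi hk hs.le]
  abel

/-! ### The variable y = -log F and the function p = f'F. -/

section TailIntegral

variable {f : ℝ → ℝ}

/-- The nonlinearity is increasing and `C¹` on `[0, ∞)`, positive on `(0, ∞)`, and has a
finite tail integral. -/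
structure Admissible (f : ℝ → ℝ) : Prop where
  contDiffOn : ContDiffOn ℝ 1 f (Ici 0)
  pos : ∀ s, 0 < s → 0 < f s
  integrableOn : ∀ s, 0 < s → IntegrableOn (fun τ => (f τ)⁻¹) (Ioi s)
  deriv_pos : ∀ s, 0 < s → 0 < deriv f s

theorem Admissible.contDiffAt (hf : Admissible f) {s : ℝ} (hs : 0 < s) : ContDiffAt ℝ 1 f s :=
  hf.contDiffOn.contDiffAt (Ici_mem_nhds hs)

theorem Admissible.hasDerivAt (hf : Admissible f) {s : ℝ} (hs : 0 < s) :
    HasDerivAt f (deriv f s) s :=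
  ((hf.contDiffAt hs).differentiableAt (by simp)).hasDerivAt

theorem Admissible.continuousAt (hf : Admissible f) {s : ℝ} (hs : 0 < s) : ContinuousAt f s :=
  (hf.hasDerivAt hs).continuousAt

theorem Admissible.hasDerivAt_tailInt (hf : Admissible f) {s : ℝ} (hs : 0 < s) :
    HasDerivAt (tailInt f) (-(f s)⁻¹) s :=
  hasDerivAt_integral_Ioi (k := fun τ => (f τ)⁻¹) (hf.integrableOn (s / 2) (by positivity))
    (by linarith) fun r hr =>
      (hf.continuousAt (by linarith)).inv₀ (hf.pos r (by linarith)).ne'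

theorem Admissible.strictAntiOn_tailInt (hf : Admissible f) :
    StrictAntiOn (tailInt f) (Ioi 0) := by
  refine strictAntiOn_of_deriv_neg (convex_Ioi 0)
    (fun s hs => (hf.hasDerivAt_tailInt hs).continuousAt.continuousWithinAt) fun s hs => ?_
  rw [interior_Ioi] at hs
  rw [(hf.hasDerivAt_tailInt hs).deriv]
  exact neg_lt_zero.2 (inv_pos.2 (hf.pos s hs))

theorem Admissible.tendsto_tailInt (hf : Admissible f) :
    Tendsto (tailInt f) atTop (𝓝 0) := by
  have h := intervalIntegral_tendsto_integral_Ioi (f := fun τ => (f τ)⁻¹) 1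
    (hf.integrableOn 1 one_pos) tendsto_id
  have h2 := h.const_sub (∫ τ in Ioi (1 : ℝ), (f τ)⁻¹)
  rw [sub_self] at h2
  refine h2.congr' ?_
  filter_upwards [eventually_ge_atTop 1] with s hs
  rw [id, ← intervalIntegral.integral_Ioi_sub_Ioi (hf.integrableOn 1 one_pos) hs]
  simp [tailInt]

theorem Admissible.tailInt_pos (hf : Admissible f) {s : ℝ} (hs : 0 < s) : 0 < tailInt f s := by
  have h1 : 0 ≤ tailInt f (s + 1) := by
    refine setIntegral_nonneg measurableSet_Ioi fun τ hτ => ?_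
    have : 0 < τ := by have : s + 1 < τ := hτ; linarith
    exact (inv_pos.2 (hf.pos τ this)).le
  exact h1.trans_lt (hf.strictAntiOn_tailInt (show 0 < s from hs)
    (show 0 < s + 1 by linarith) (by linarith))

/-- `y ↦ F⁻¹(e^{-y})`, with `F` the tail integral of `f`. -/
noncomputable def logInv (f : ℝ → ℝ) (y : ℝ) : ℝ :=
  Function.invFunOn (tailInt f) (Ioi 0) (Real.exp (-y))

/-- Values of `y` below this bound need not be attained by `-log F`. -/
noncomputable def logInvBound (f : ℝ → ℝ) : ℝ := -Real.log (tailInt f 1)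

/-- Since F → 0 at infinity, the intermediate value theorem on [1, b] attains every level below
F(1). The base point 1 is arbitrary; it keeps away from 0, where 1/f need not be integrable. -/
theorem Admissible.logInv_spec (hf : Admissible f) {y : ℝ} (hy : logInvBound f < y) :
    1 < logInv f y ∧ tailInt f (logInv f y) = Real.exp (-y) := by
  have hlt : Real.exp (-y) < tailInt f 1 := by
    rw [← Real.lt_log_iff_exp_lt (hf.tailInt_pos one_pos)]
    unfold logInvBound at hy; linarith
  obtain ⟨b, hb1, hb⟩ := ((eventually_gt_atTop (1 : ℝ)).and
    (hf.tendsto_tailInt.eventually (gt_mem_nhds (Real.exp_pos (-y))))).exists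
  have hc : ContinuousOn (tailInt f) (Icc 1 b) := fun s hs =>
    (hf.hasDerivAt_tailInt (by linarith [hs.1])).continuousAt.continuousWithinAt
  obtain ⟨s, hs, hse⟩ := intermediate_value_Icc' hb1.le hc ⟨hb.le, hlt.le⟩
  have hex : ∃ a ∈ Ioi (0 : ℝ), tailInt f a = Real.exp (-y) :=
    ⟨s, by have := hs.1; simp only [mem_Ioi]; linarith, hse⟩
  have hmem := Function.invFunOn_mem hex
  have heq : tailInt f (logInv f y) = Real.exp (-y) := Function.invFunOn_eq hex
  refine ⟨?_, heq⟩
  by_contra hcon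
  have := hf.strictAntiOn_tailInt.antitoneOn hmem (show (0 : ℝ) < 1 from one_pos)
    (not_lt.1 hcon)
  change tailInt f 1 ≤ tailInt f (logInv f y) at this
  linarith

theorem Admissible.logInv_pos (hf : Admissible f) {y : ℝ} (hy : logInvBound f < y) :
    0 < logInv f y :=
  one_pos.trans (hf.logInv_spec hy).1

theorem Admissible.logInv_neg_log_tailInt (hf : Admissible f) {s : ℝ} (hs : 1 < s) :
    logInvBound f < -Real.log (tailInt f s) ∧ logInv f (-Real.log (tailInt f s)) = s := by
  have hs0 : 0 < s := by linarith
  have hlt : tailInt f s < tailInt f 1 :=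
    hf.strictAntiOn_tailInt (show (0 : ℝ) < 1 from one_pos) (show 0 < s from hs0) hs
  have h1 : logInvBound f < -Real.log (tailInt f s) :=
    neg_lt_neg (Real.log_lt_log (hf.tailInt_pos hs0) hlt)
  refine ⟨h1, hf.strictAntiOn_tailInt.injOn (hf.logInv_pos h1) hs0 ?_⟩
  rw [(hf.logInv_spec h1).2, neg_neg, Real.exp_log (hf.tailInt_pos hs0)]

theorem Admissible.strictMonoOn_logInv (hf : Admissible f) :
    StrictMonoOn (logInv f) (Ioi (logInvBound f)) := by
  intro a ha b hb hab
  by_contra hcon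
  have := hf.strictAntiOn_tailInt.antitoneOn (hf.logInv_pos hb) (hf.logInv_pos ha)
    (not_lt.1 hcon)
  rw [(hf.logInv_spec ha).2, (hf.logInv_spec hb).2, Real.exp_le_exp] at this
  linarith

theorem Admissible.image_logInv (hf : Admissible f) :
    logInv f '' Ioi (logInvBound f) = Ioi 1 := by
  ext s
  constructor
  · rintro ⟨y, hy, rfl⟩
    exact (hf.logInv_spec hy).1
  · intro hs
    exact ⟨_, hf.logInv_neg_log_tailInt hs⟩

/-- The map -log F has derivative 1/(fF) > 0. Continuity of its inverse, which the inverse function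
rule needs, comes from monotonicity together with the image being an open half-line. -/
theorem Admissible.hasDerivAt_logInv (hf : Admissible f) {y : ℝ} (hy : logInvBound f < y) :
    HasDerivAt (logInv f) (f (logInv f y) * Real.exp (-y)) y := by
  have hs := hf.logInv_spec hy
  have hpos := hf.logInv_pos hy
  have hc : ContinuousAt (logInv f) y := by
    refine hf.strictMonoOn_logInv.continuousAt_of_image_mem_nhds (Ioi_mem_nhds hy) ?_
    rw [hf.image_logInv]
    exact Ioi_mem_nhds hs.1
  have hd : HasDerivAt (fun s => -Real.log (tailInt f s))
      (-(-(f (logInv f y))⁻¹ / tailInt f (logInv f y))) (logInv f y) :=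
    ((hf.hasDerivAt_tailInt hpos).log (hf.tailInt_pos hpos).ne').neg
  have hfp := hf.pos _ hpos
  have h := HasDerivAt.of_local_left_inverse hc hd ?_ ?_
  · refine h.congr_deriv ?_
    rw [hs.2]
    field_simp
  · rw [hs.2, neg_div, neg_neg]
    positivity
  · filter_upwards [Ioi_mem_nhds hy] with z hz
    rw [(hf.logInv_spec hz).2, Real.log_exp, neg_neg]

theorem Admissible.tendsto_logInv (hf : Admissible f) : Tendsto (logInv f) atTop atTop := by
  refine tendsto_atTop.2 fun b => ?_
  obtain ⟨h1, h2⟩ := hf.logInv_neg_log_tailInt (s := max b 2) (by simp)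
  filter_upwards [eventually_gt_atTop (-Real.log (tailInt f (max b 2)))] with y hy
  have := hf.strictMonoOn_logInv h1 (h1.trans hy) hy
  rw [h2] at this
  exact (le_max_left b 2).trans this.le

/-- The quantity `f' F` as a function of `y = -log F`. -/
noncomputable def growth (f : ℝ → ℝ) (y : ℝ) : ℝ := deriv f (logInv f y) * Real.exp (-y)

/-- The derivative of `growth f`. -/
noncomputable def growthDeriv (f : ℝ → ℝ) (y : ℝ) : ℝ :=
  deriv (deriv f) (logInv f y) * (f (logInv f y) * Real.exp (-y)) * Real.exp (-y) - growth f y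

theorem Admissible.growth_pos (hf : Admissible f) {y : ℝ} (hy : logInvBound f < y) :
    0 < growth f y :=
  mul_pos (hf.deriv_pos _ (hf.logInv_pos hy)) (Real.exp_pos _)

theorem hasDerivAt_deriv_of_contDiffOn {s₀ : ℝ} (hc : ContDiffOn ℝ 2 f (Ioi s₀)) {s : ℝ}
    (hs : s₀ < s) :
    HasDerivAt (deriv f) (deriv (deriv f) s) s ∧ ContinuousAt (deriv (deriv f)) s := by
  have h := hc.contDiffAt (Ioi_mem_nhds hs)
  have h2 : ContDiffOn ℝ 1 (deriv f) (Ioi s₀) :=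
    ((contDiffOn_succ_iff_deriv_of_isOpen (n := 1) isOpen_Ioi).1
      (by simpa [one_add_one_eq_two] using hc)).2.2
  have h3 : ContinuousOn (deriv (deriv f)) (Ioi s₀) :=
    h2.continuousOn_deriv_of_isOpen isOpen_Ioi le_rfl
  exact ⟨((h2.contDiffAt (Ioi_mem_nhds hs)).differentiableAt (by simp)).hasDerivAt,
    h3.continuousAt (Ioi_mem_nhds hs)⟩

theorem Admissible.hasDerivAt_growth (hf : Admissible f) {s₀ : ℝ}
    (hc : ContDiffOn ℝ 2 f (Ioi s₀)) {y : ℝ} (hy : logInvBound f < y) (hys : s₀ < logInv f y) :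
    HasDerivAt (growth f) (growthDeriv f y) y := by
  have h1 := (hasDerivAt_deriv_of_contDiffOn hc hys).1.comp y (hf.hasDerivAt_logInv hy)
  have h2 : HasDerivAt (fun y : ℝ => Real.exp (-y)) (Real.exp (-y) * -1) y :=
    (hasDerivAt_neg y).exp
  refine (h1.mul h2).congr_deriv ?_
  simp only [growthDeriv, growth, Function.comp]
  ring

theorem Admissible.continuousAt_growthDeriv (hf : Admissible f) {s₀ : ℝ}
    (hc : ContDiffOn ℝ 2 f (Ioi s₀)) {y : ℝ} (hy : logInvBound f < y) (hys : s₀ < logInv f y) :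
    ContinuousAt (growthDeriv f) y := by
  have hl := (hf.hasDerivAt_logInv hy).continuousAt
  have h1 := (hasDerivAt_deriv_of_contDiffOn hc hys).2.comp hl
  have h2 := (hf.continuousAt (hf.logInv_pos hy)).comp hl
  have h3 : ContinuousAt (fun y : ℝ => Real.exp (-y)) y := by fun_prop
  exact ((h1.mul (h2.mul h3)).mul h3).sub (hf.hasDerivAt_growth hc hy hys).continuousAt

theorem Admissible.invB1_logInv (hf : Admissible f) {y : ℝ} (hy : logInvBound f < y) :
    invB1 f (logInv f y) = y * (1 - growth f y) := by
  simp [invB1, growth, (hf.logInv_spec hy).2]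

/-- The bracket f f''F/f' - 1 is the logarithmic derivative of p = f'F with respect to y. Together
with the formula for B₁ this says that R₁ and R₂ measure p in C¹. -/
theorem Admissible.invB2_logInv (hf : Admissible f) {y : ℝ} (hy : logInvBound f < y) :
    invB2 f (logInv f y) = y ^ 2 * growthDeriv f y := by
  have := hf.deriv_pos _ (hf.logInv_pos hy)
  simp only [invB2, growth, growthDeriv, (hf.logInv_spec hy).2, Real.log_exp, neg_neg]
  field_simp

theorem Admissible.tendsto_growth (hf : Admissible f) {B : ℝ} (h2 : CondF2 f B) :
    Tendsto (growth f) atTop (𝓝 1) := by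
  refine (h2.1.comp hf.tendsto_logInv).congr' ?_
  filter_upwards [eventually_gt_atTop (logInvBound f)] with y hy
  simp [growth, (hf.logInv_spec hy).2]

theorem Admissible.tendsto_sq_mul_growthDeriv (hf : Admissible f) {B : ℝ} (h2 : CondF2 f B) :
    Tendsto (fun y => y ^ 2 * growthDeriv f y) atTop (𝓝 B⁻¹) := by
  have h := (h2.2.1.inv₀ (by linarith [h2.2.2])).comp hf.tendsto_logInv
  refine h.congr' ?_
  filter_upwards [eventually_gt_atTop (logInvBound f)] with y hy
  simp [hf.invB2_logInv hy]

end TailIntegral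

/-! ### The model nonlinearity, uniformly in B ≥ 1. -/

section Model

/-- `-log G` along the model solution, as a function of `t = log (1 / |x|²)`. -/
noncomputable def modelY (B t : ℝ) : ℝ := t - Real.log (t + 1) - Real.log (B / 4)

/-- `g' G` along the model solution, as a function of `t = log (1 / |x|²)`. -/
noncomputable def modelP (B t : ℝ) : ℝ := (1 + 1 / t) * (1 - (1 + 1 / B) / t)

/-- The derivative of `modelP B`. -/
noncomputable def modelPDeriv (B t : ℝ) : ℝ :=
  -(1 / t ^ 2) * (1 - (1 + 1 / B) / t) + (1 + 1 / t) * ((1 + 1 / B) / t ^ 2)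

theorem hasDerivAt_modelP (B : ℝ) {t : ℝ} (ht : t ≠ 0) :
    HasDerivAt (modelP B) (modelPDeriv B t) t := by
  have h : ∀ c : ℝ, HasDerivAt (fun t : ℝ => c / t) (-(c / t ^ 2)) t := fun c => by
    refine ((hasDerivAt_inv ht).const_mul c).congr_deriv ?_
    ring
  refine (((h 1).const_add 1).mul ((h (1 + 1 / B)).const_sub 1)).congr_deriv ?_
  simp only [modelPDeriv]
  ring

theorem hasDerivAt_modelY (B : ℝ) {t : ℝ} (ht : 0 < t) :
    HasDerivAt (modelY B) (t / (t + 1)) t := by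
  have h := (((hasDerivAt_id t).add_const 1).log (by simp; linarith))
  refine (((hasDerivAt_id t).sub h).sub_const (Real.log (B / 4))).congr_deriv ?_
  simp
  field_simp
  ring

theorem exp_neg_modelY {B t : ℝ} (hB : 0 < B) (ht : 0 < t) :
    Real.exp (-modelY B t) = B / 4 * (t + 1) * Real.exp (-t) := by
  have : -modelY B t = -t + Real.log (t + 1) + Real.log (B / 4) := by simp [modelY]; ring
  rw [this, Real.exp_add, Real.exp_add, Real.exp_log (by linarith), Real.exp_log (by linarith)]
  ring

/-- A nonlinearity of the form `4 e^T / (B T T')`, with `T T'' = T'² / B`. -/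
structure IsModel (B a : ℝ) (g T T' : ℝ → ℝ) : Prop where
  hasDerivAt : ∀ s, a < s → HasDerivAt T (T' s) s
  hasDerivAt' : ∀ s, a < s → HasDerivAt T' (1 / B * T' s ^ 2 / T s) s
  pos : ∀ s, a < s → 0 < T s
  pos' : ∀ s, a < s → 0 < T' s
  tendsto : Tendsto T atTop atTop
  eq : ∀ s, a < s → g s = 4 / (B * (T s * T' s)) * Real.exp (T s)

variable {B a : ℝ} {g T T' : ℝ → ℝ}

/-- Differentiating (T + 1)e^{-T} leaves -T T' e^{-T}, which is -1/g up to the factor B/4. Being an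
explicit primitive that vanishes at infinity, it is the tail integral G. -/
theorem IsModel.hasDerivAt_exp_neg_modelY (h : IsModel B a g T T') (hB : 0 < B) {s : ℝ}
    (hs : a < s) :
    HasDerivAt (fun s => Real.exp (-modelY B (T s))) (-(g s)⁻¹) s := by
  have hT := h.pos s hs
  have hT' := h.pos' s hs
  refine ((((hasDerivAt_modelY B hT).comp s (h.hasDerivAt s hs)).neg).exp).congr_deriv ?_
  change Real.exp (-modelY B (T s)) * _ = _
  rw [exp_neg_modelY hB hT, h.eq s hs, Real.exp_neg]
  field_simp

theorem IsModel.tailInt_eq (h : IsModel B a g T T') (hB : 0 < B) {s : ℝ} (hs : a < s) :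
    tailInt g s = Real.exp (-modelY B (T s)) := by
  have hd : ∀ r ∈ Ici s, HasDerivAt (fun s => -Real.exp (-modelY B (T s))) ((g r)⁻¹) r :=
    fun r hr => by
      exact (h.hasDerivAt_exp_neg_modelY hB (hs.trans_le hr)).neg.congr_deriv (neg_neg _)
  have hlim : Tendsto (fun s => -Real.exp (-modelY B (T s))) atTop (𝓝 (-0)) := by
    refine Tendsto.neg ?_
    have h1 : Tendsto (fun t : ℝ => B / 4 * (t + 1) * Real.exp (-t)) atTop (𝓝 0) := by
      have e1 := Real.tendsto_pow_mul_exp_neg_atTop_nhds_zero 1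
      have e0 := Real.tendsto_pow_mul_exp_neg_atTop_nhds_zero 0
      have := (e1.add e0).const_mul (B / 4)
      simp only [add_zero, mul_zero] at this
      refine this.congr fun t => ?_
      ring
    refine (h1.comp h.tendsto).congr' ?_
    filter_upwards [eventually_gt_atTop a] with r hr
    simp [exp_neg_modelY hB (h.pos r hr)]
  have := integral_Ioi_of_hasDerivAt_of_nonneg' hd (fun r hr => ?_) hlim
  · rw [tailInt, this]; ring
  · have hr' : a < r := hs.trans hr
    have := h.pos r hr'
    have := h.pos' r hr'
    rw [h.eq r hr']
    positivity

/-- Logarithmic differentiation gives g'/g = T' - T'/T - T''/T' = T'(1 - (1 + 1/B)/T), and gG = (T +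
1)/(T T'). The relation T T'' = T'²/B is what lets T' cancel, so that g'G depends on T alone. -/
theorem IsModel.deriv_eq (h : IsModel B a g T T') (hB : 0 < B) {s : ℝ} (hs : a < s) :
    deriv g s = modelP B (T s) * Real.exp (modelY B (T s)) := by
  have hT := h.pos s hs
  have hT' := h.pos' s hs
  have h1 : HasDerivAt (fun s => 4 / (B * (T s * T' s)) * Real.exp (T s))
      (modelP B (T s) * Real.exp (modelY B (T s))) s := by
    have hd := ((h.hasDerivAt s hs).mul (h.hasDerivAt' s hs)).const_mul B
    have := ((hd.fun_inv (mul_pos hB (mul_pos hT hT')).ne').const_mul 4).mul (h.hasDerivAt s hs).exp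
    refine this.congr_deriv ?_
    have e : Real.exp (modelY B (T s)) = (B / 4 * (T s + 1) * Real.exp (-T s))⁻¹ := by
      rw [← exp_neg_modelY hB hT, Real.exp_neg, inv_inv]
    rw [e, Real.exp_neg]
    simp only [modelP, Pi.mul_apply]
    field_simp
    ring
  refine (h1.congr_of_eventuallyEq ?_).deriv
  filter_upwards [lt_mem_nhds hs] with r hr using h.eq r hr

theorem IsModel.invB1_eq (h : IsModel B a g T T') (hB : 0 < B) {s : ℝ} (hs : a < s) :
    invB1 g s = modelY B (T s) * (1 - modelP B (T s)) := by
  rw [invB1, h.tailInt_eq hB hs, h.deriv_eq hB hs, Real.log_exp, mul_assoc, ← Real.exp_add]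
  simp

/-- The factor (T + 1)/T is dt/dy along y = `modelY B t`, converting the t-derivative of g'G into a
y-derivative. Nonvanishing of `modelP` is needed because `invB2` divides by g'. -/
theorem IsModel.invB2_eq (h : IsModel B a g T T') (hB : 0 < B) {s : ℝ} (hs : a < s)
    (hP : modelP B (T s) ≠ 0) :
    invB2 g s = modelY B (T s) ^ 2 * (modelPDeriv B (T s) * ((T s + 1) / T s)) := by
  have hT := h.pos s hs
  have hT' := h.pos' s hs
  have hy : HasDerivAt (fun s => modelY B (T s)) (T s / (T s + 1) * T' s) s :=
    (hasDerivAt_modelY B hT).comp s (h.hasDerivAt s hs)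
  have h2 : HasDerivAt (deriv g) (modelPDeriv B (T s) * T' s * Real.exp (modelY B (T s)) +
      modelP B (T s) * (Real.exp (modelY B (T s)) * (T s / (T s + 1) * T' s))) s := by
    have := ((hasDerivAt_modelP B hT.ne').comp s (h.hasDerivAt s hs)).mul hy.exp
    refine this.congr_of_eventuallyEq ?_
    filter_upwards [lt_mem_nhds hs] with r hr using h.deriv_eq hB hr
  have hg : g s = (T s + 1) / (T s * T' s) * Real.exp (modelY B (T s)) := by
    have e : Real.exp (modelY B (T s)) = (B / 4 * (T s + 1) * Real.exp (-T s))⁻¹ := by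
      rw [← exp_neg_modelY hB hT, Real.exp_neg, inv_inv]
    rw [e, h.eq s hs, Real.exp_neg]
    field_simp
  rw [invB2, h2.deriv, h.tailInt_eq hB hs, h.deriv_eq hB hs, hg, Real.log_exp, Real.exp_neg]
  field_simp
  ring

/-- The function inverting `t ↦ v`: `s ↦ eˢ` if `B = 1` and `s ↦ s ^ B'` otherwise. -/
theorem exists_isModel {B t : ℝ} (hB : 1 ≤ B) (ht : 0 < t) :
    ∃ a v : ℝ, ∃ T T' : ℝ → ℝ, a < v ∧ T v = t ∧ IsModel B a (modelG B) T T' ∧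
      ∀ x : Plane, Real.log (1 / ‖x‖ ^ 2) = t → modelV B x = v := by
  rcases eq_or_lt_of_le hB with rfl | hB
  -- The relation T T'' = T'²/B with B = 1 is solved by the exponential. It is positive on all of ℝ,
  -- so any left endpoint below log t serves.
  · refine ⟨Real.log t - 1, Real.log t, Real.exp, Real.exp, by linarith, Real.exp_log ht,
      ⟨fun s _ => Real.hasDerivAt_exp s, fun s _ => ?_, fun s _ => Real.exp_pos s,
        fun s _ => Real.exp_pos s, Real.tendsto_exp_atTop, fun s _ => ?_⟩, fun x hx => ?_⟩
    · refine (Real.hasDerivAt_exp s).congr_deriv ?_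
      have := Real.exp_pos s
      field_simp
    · simp only [modelG, if_true, two_mul, Real.exp_add]
      have := Real.exp_pos s
      field_simp
    · simp only [modelV, if_true, hx]
  · have hB0 : 0 < B := by linarith
    have hc : B.conjExponent = B / (B - 1) := rfl
    have hB1 : 0 < B - 1 := by linarith
    have hcp : 0 < B.conjExponent := by rw [hc]; positivity
    -- For a power T = s^{B'} the relation T T'' = T'²/B amounts to this identity for conjugate
    -- exponents.
    have key : B.conjExponent - 1 = B.conjExponent / B := by rw [hc]; field_simp; ring
    refine ⟨0, t ^ (1 / B.conjExponent), fun s => s ^ B.conjExponent,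
      fun s => B.conjExponent * s ^ (B.conjExponent - 1), Real.rpow_pos_of_pos ht _, ?_,
      ⟨fun s hs => Real.hasDerivAt_rpow_const (Or.inl hs.ne'), fun s hs => ?_,
        fun s hs => Real.rpow_pos_of_pos hs _, fun s hs => ?_, tendsto_rpow_atTop hcp,
        fun s hs => ?_⟩, fun x hx => ?_⟩
    · simp only
      rw [← Real.rpow_mul ht.le, one_div, inv_mul_cancel₀ hcp.ne', Real.rpow_one]
    · refine ((Real.hasDerivAt_rpow_const (Or.inl hs.ne')).const_mul _).congr_deriv ?_
      have h1 := Real.rpow_pos_of_pos hs B.conjExponent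
      have e1 : s ^ (B.conjExponent - 1) = s ^ B.conjExponent / s := Real.rpow_sub_one hs.ne' _
      rw [Real.rpow_sub_one hs.ne', e1]
      rw [key]
      field_simp
    · have := Real.rpow_pos_of_pos hs (B.conjExponent - 1)
      positivity
    · simp only [modelG, if_neg hB.ne']
      have h1 := Real.rpow_pos_of_pos hs B.conjExponent
      rw [Real.rpow_sub_one hs.ne', Real.rpow_sub hs, Real.rpow_one, mul_comm 2,
        Real.rpow_mul hs.le]
      norm_num
      field_simp
    · simp only [modelV, if_neg hB.ne', hx]

end Model

/-! ### ũ, R₁ and R₂ in the variable t = log(1/|x|²). -/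

section Radial

variable {f : ℝ → ℝ} {B : ℝ}

/-- `log (1 / |x|²)`. -/
noncomputable def logRad (x : Plane) : ℝ := Real.log (1 / ‖x‖ ^ 2)

theorem logRad_eq (x : Plane) : logRad x = -2 * Real.log ‖x‖ := by
  rw [logRad, one_div, Real.log_inv, Real.log_pow]; push_cast; ring

theorem uTilde_eq (hB : 1 ≤ B) {x : Plane} (hx : 0 < logRad x) :
    uTilde f B x = logInv f (modelY B (logRad x)) := by
  obtain ⟨a, v, T, T', hav, hTv, hm, hv⟩ := exists_isModel hB hx
  rw [uTilde, hv x rfl, hm.tailInt_eq (by linarith) hav, hTv, logInv]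

/-- By construction F(ũ) = G(v), so both terms of R₁ carry the same weight y = `modelY`, and only
the discrepancy between f'F and g'G remains. -/
theorem Admissible.R₁_eq (hf : Admissible f) (hB : 1 ≤ B) {x : Plane} (hx : 0 < logRad x)
    (hy0 : 0 < modelY B (logRad x)) (hy : logInvBound f < modelY B (logRad x)) :
    R₁ f B x = modelY B (logRad x) *
      |growth f (modelY B (logRad x)) - modelP B (logRad x)| := by
  obtain ⟨a, v, T, T', hav, hTv, hm, hv⟩ := exists_isModel hB hx
  rw [R₁, uTilde_eq hB hx, hf.invB1_logInv hy, hv x rfl, hm.invB1_eq (by linarith) hav, hTv,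
    ← mul_sub, abs_mul, abs_of_pos hy0, ← abs_neg]
  congr 2
  ring

theorem Admissible.R₂_eq (hf : Admissible f) (hB : 1 ≤ B) {x : Plane} (hx : 0 < logRad x)
    (hP : modelP B (logRad x) ≠ 0) (hy : logInvBound f < modelY B (logRad x)) :
    R₂ f B x = modelY B (logRad x) ^ 2 * ((logRad x + 1) / logRad x) *
      |growthDeriv f (modelY B (logRad x)) * (logRad x / (logRad x + 1)) -
        modelPDeriv B (logRad x)| := by
  obtain ⟨a, v, T, T', hav, hTv, hm, hv⟩ := exists_isModel hB hx
  rw [R₂, uTilde_eq hB hx, hf.invB2_logInv hy, hv x rfl,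
    hm.invB2_eq (by linarith) hav (by rwa [hTv]), hTv,
    ← abs_of_pos (show 0 < (logRad x + 1) / logRad x by positivity),
    ← abs_of_nonneg (sq_nonneg (modelY B (logRad x))), ← abs_mul, ← abs_mul,
    abs_of_pos (show 0 < (logRad x + 1) / logRad x by positivity),
    abs_of_nonneg (sq_nonneg (modelY B (logRad x)))]
  congr 1
  field_simp

end Radial

/-! ### A growing linear flow with a small perturbation. -/

section Dichotomy

/-- Weighted tail integrals: if `‖k τ‖ ≤ c τ^{-1-δ}` on `(t, ∞)`, then `‖∫_t^∞ k‖ ≤ c t^{-δ} / δ`. -/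
theorem norm_integral_Ioi_le_rpow {k : ℝ → ℂ} {δ c t : ℝ} (hδ : 0 < δ) (ht : 0 < t)
    (hk : ∀ τ, t < τ → ‖k τ‖ ≤ c * τ ^ (-1 - δ)) :
    ‖∫ τ in Ioi t, k τ‖ ≤ c * t ^ (-δ) / δ := by
  have hi : IntegrableOn (fun τ : ℝ => c * τ ^ (-1 - δ)) (Ioi t) :=
    (integrableOn_Ioi_rpow_of_lt (by linarith) ht).const_mul c
  have := norm_integral_le_of_norm_le hi
    ((ae_restrict_iff' measurableSet_Ioi).2 (Eventually.of_forall hk))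
  refine this.trans (le_of_eq ?_)
  rw [integral_const_mul, integral_Ioi_rpow_of_lt (by linarith) ht]
  have : -1 - δ + 1 = -δ := by ring
  rw [this]
  field_simp

theorem integrableOn_Ioi_of_le_rpow {k : ℝ → ℂ} {δ c t : ℝ} (hδ : 0 < δ) (ht : 0 < t)
    (hc : ContinuousOn k (Ici t)) (hk : ∀ τ, t ≤ τ → ‖k τ‖ ≤ c * τ ^ (-1 - δ)) :
    IntegrableOn k (Ioi t) :=
  Integrable.mono' ((integrableOn_Ioi_rpow_of_lt (by linarith) ht).const_mul c)
    ((hc.mono Ioi_subset_Ici_self).aestronglyMeasurable measurableSet_Ioi)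
    ((ae_restrict_iff' measurableSet_Ioi).2 (Eventually.of_forall fun τ hτ => hk τ (le_of_lt hτ)))

/-- A solution of `Z' = (iθ' + δ/t) Z + e(t, Z)` decaying at infinity, for a small perturbation
`e`. -/
theorem exists_decaying_solution {δ t₀ K : ℝ} {θ θ' ρ : ℝ → ℝ} {e : ℝ → ℂ → ℂ} (hδ : 0 < δ)
    (ht₀ : 0 < t₀) (hK : 0 ≤ K) (hθ : ∀ t, t₀ ≤ t → HasDerivAt θ (θ' t) t)
    (hρ : AntitoneOn ρ (Ici t₀)) (hρ0 : ∀ t, t₀ ≤ t → 0 ≤ ρ t)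
    (he : ∀ Z : ℝ → ℂ, Continuous Z → (∀ t, t₀ ≤ t → ‖Z t‖ ≤ K * ρ t) →
      ContinuousOn (fun t => e t (Z t)) (Ici t₀))
    (hlip : ∀ t, t₀ ≤ t → ∀ z w : ℂ, ‖z‖ ≤ K * ρ t → ‖w‖ ≤ K * ρ t →
      ‖e t z - e t w‖ ≤ δ / 2 / t * ‖z - w‖)
    (hzero : ∀ t, t₀ ≤ t → ‖e t 0‖ ≤ δ / 2 * (K * ρ t) / t) :
    ∃ Z : ℝ → ℂ, (∀ t, t₀ ≤ t → ‖Z t‖ ≤ K * ρ t) ∧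
      ∀ t, t₀ < t → HasDerivAt Z ((Complex.I * θ' t + δ / t) * Z t + e t (Z t)) t := by
  classical
  -- The fixed point is sought among functions on all of ℝ for the sake of completeness; only their
  -- values on [t₀, ∞) are constrained.
  set S : Set (BoundedContinuousFunction ℝ ℂ) := {Z | ∀ t, t₀ ≤ t → ‖Z t‖ ≤ K * ρ t} with hS
  have hSc : IsClosed S := by
    have : S = ⋂ t ∈ Ici t₀, {Z : BoundedContinuousFunction ℝ ℂ | ‖Z t‖ ≤ K * ρ t} := by
      ext Z; simp [hS]
    rw [this]
    refine isClosed_biInter fun t _ => isClosed_le ?_ continuous_const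
    exact (continuous_eval_const t).norm
  -- Fundamental solution of the unperturbed equation. Its modulus is exactly t^δ, so its inverse is
  -- small at infinity and damps the integrals below.
  let E : ℝ → ℂ := fun t => ((t ^ δ : ℝ) : ℂ) * Complex.exp (Complex.I * θ t)
  have hEnorm : ∀ t, 0 < t → ‖E t‖ = t ^ δ := fun t ht => by
    simp only [E, norm_mul, Complex.norm_real, Real.norm_eq_abs,
      abs_of_pos (Real.rpow_pos_of_pos ht δ)]
    rw [mul_comm Complex.I, Complex.norm_exp_ofReal_mul_I, mul_one]
  have hEne : ∀ t, 0 < t → E t ≠ 0 := fun t ht => by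
    rw [← norm_pos_iff, hEnorm t ht]; exact Real.rpow_pos_of_pos ht δ
  have hEd : ∀ t, t₀ ≤ t → HasDerivAt E ((Complex.I * θ' t + δ / t) * E t) t := fun t ht => by
    have ht' : 0 < t := ht₀.trans_le ht
    have h1 : HasDerivAt (fun t : ℝ => ((t ^ δ : ℝ) : ℂ)) ((δ * t ^ (δ - 1) : ℝ) : ℂ) t :=
      (Real.hasDerivAt_rpow_const (Or.inl ht'.ne')).ofReal_comp
    have h2 := (((hθ t ht).ofReal_comp).const_mul Complex.I).cexp
    refine (h1.mul h2).congr_deriv ?_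
    simp only [E]
    rw [Real.rpow_sub_one ht'.ne']
    have : (t : ℂ) ≠ 0 := by exact_mod_cast ht'.ne'
    push_cast
    field_simp
    ring
  have hEc : ContinuousOn E (Ici t₀) := fun t ht => (hEd t ht).continuousAt.continuousWithinAt
  let k : (ℝ → ℂ) → ℝ → ℂ := fun Z τ => (E τ)⁻¹ * e τ (Z τ)
  have hkc : ∀ Z ∈ S, ContinuousOn (k Z) (Ici t₀) := fun Z hZ =>
    (hEc.inv₀ fun t ht => hEne t (ht₀.trans_le ht)).mul (he Z Z.continuous hZ)
  -- Half of δ comes from the Lipschitz bound and half from e(t, 0). The sum δ cancels the 1/δ of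
  -- the tail integral, so the ball of radius Kρ(t) is mapped into itself.
  have hebd : ∀ t, t₀ ≤ t → ∀ z : ℂ, ‖z‖ ≤ K * ρ t → ‖e t z‖ ≤ δ * (K * ρ t) / t := by
    intro t ht z hz
    have ht' : 0 < t := ht₀.trans_le ht
    have h1 := hlip t ht z 0 hz (by simpa using mul_nonneg hK (hρ0 t ht))
    rw [sub_zero] at h1
    have h2 : ‖e t z‖ ≤ ‖e t z - e t 0‖ + ‖e t 0‖ := by
      simpa using norm_add_le (e t z - e t 0) (e t 0)
    calc ‖e t z‖ ≤ δ / 2 / t * (K * ρ t) + δ / 2 * (K * ρ t) / t := by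
          refine h2.trans (add_le_add (h1.trans ?_) (hzero t ht))
          gcongr
      _ = δ * (K * ρ t) / t := by ring
  have hkrp : ∀ τ c : ℝ, t₀ ≤ τ → (τ ^ δ)⁻¹ * (c / τ) = c * τ ^ (-1 - δ) := fun τ c hτ => by
    have hτ' : 0 < τ := ht₀.trans_le hτ
    rw [Real.rpow_sub hτ', Real.rpow_neg_one]
    field_simp
  have hkbd : ∀ Z ∈ S, ∀ t τ, t₀ ≤ t → t ≤ τ → ‖k Z τ‖ ≤ δ * (K * ρ t) * τ ^ (-1 - δ) := by
    intro Z hZ t τ ht hτ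
    have hτ0 := ht.trans hτ
    have hτ' : 0 < τ := ht₀.trans_le hτ0
    simp only [k, norm_mul, norm_inv, hEnorm τ hτ']
    rw [← hkrp τ _ hτ0]
    have := hebd τ hτ0 (Z τ) (hZ τ hτ0)
    have hmono := hρ ht hτ0 hτ
    have : δ * (K * ρ τ) / τ ≤ δ * (K * ρ t) / τ := by gcongr
    gcongr
    linarith
  have hkint : ∀ Z ∈ S, IntegrableOn (k Z) (Ioi t₀) := fun Z hZ =>
    integrableOn_Ioi_of_le_rpow hδ ht₀ (hkc Z hZ) fun τ hτ => hkbd Z hZ t₀ τ le_rfl hτ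
  -- Variation of constants with zero data at infinity: starting from a finite time would pick up a
  -- multiple of the growing solution.
  let Φ : (ℝ → ℂ) → ℝ → ℂ := fun Z t => -(E t * ∫ τ in Ioi t, k Z τ)
  have hΦc : ∀ Z ∈ S, ContinuousOn (Φ Z) (Ici t₀) := fun Z hZ =>
    (hEc.mul (hkint Z hZ).continuousOn_Ici_primitive_Ioi).neg
  have hcancel : ∀ t c : ℝ, 0 < t → t ^ δ * (δ * c * t ^ (-δ) / δ) = c := fun t c ht => by
    rw [Real.rpow_neg ht.le]
    have := Real.rpow_pos_of_pos ht δ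
    field_simp
  have hΦbd : ∀ Z ∈ S, ∀ t, t₀ ≤ t → ‖Φ Z t‖ ≤ K * ρ t := by
    intro Z hZ t ht
    have ht' : 0 < t := ht₀.trans_le ht
    simp only [Φ, norm_neg, norm_mul, hEnorm t ht']
    have := norm_integral_Ioi_le_rpow hδ ht' fun τ hτ => hkbd Z hZ t τ ht (le_of_lt hτ)
    rw [← hcancel t (K * ρ t) ht']
    have := Real.rpow_pos_of_pos ht' δ
    gcongr
  have hmax : ∀ t : ℝ, t₀ ≤ max t t₀ := fun t => le_max_right _ _
  -- The image is frozen to the left of t₀ to give a bounded function on ℝ. Off S the value is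
  -- irrelevant.
  let Ψ : BoundedContinuousFunction ℝ ℂ → BoundedContinuousFunction ℝ ℂ := fun Z =>
    if hZ : Z ∈ S then
      BoundedContinuousFunction.ofNormedAddCommGroup (fun t => Φ Z (max t t₀))
        ((hΦc Z hZ).comp_continuous (by fun_prop) hmax) (K * ρ t₀)
        (fun t => (hΦbd Z hZ _ (hmax t)).trans
          (mul_le_mul_of_nonneg_left (hρ self_mem_Ici (hmax t) (hmax t)) hK))
    else Z
  have hΨ : ∀ Z ∈ S, ∀ t, t₀ ≤ t → Ψ Z t = Φ Z t := by
    intro Z hZ t ht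
    simp only [Ψ, dif_pos hZ]
    simp [max_eq_left ht]
  have hΨmax : ∀ Z ∈ S, ∀ t, Ψ Z t = Φ Z (max t t₀) := by
    intro Z hZ t
    simp only [Ψ, dif_pos hZ]
    rfl
  have hmaps : MapsTo Ψ S S := fun Z hZ t ht => by
    rw [hΨ Z hZ t ht]; exact hΦbd Z hZ t ht
  have hdiff : ∀ Z ∈ S, ∀ W ∈ S, ∀ t, t₀ ≤ t → ‖Φ Z t - Φ W t‖ ≤ 1 / 2 * dist Z W := by
    intro Z hZ W hW t ht
    have ht' : 0 < t := ht₀.trans_le ht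
    have hsub : Ioi t ⊆ Ioi t₀ := Ioi_subset_Ioi ht
    have heq : Φ Z t - Φ W t = -(E t * ∫ τ in Ioi t, (k Z τ - k W τ)) := by
      simp only [Φ]
      rw [integral_sub ((hkint Z hZ).mono_set hsub) ((hkint W hW).mono_set hsub)]
      ring
    rw [heq, norm_neg, norm_mul, hEnorm t ht']
    -- The Lipschitz constant δ/(2τ) is split as δ · (1/2)/τ, so that the tail integral returns the
    -- contraction factor 1/2.
    have hb : ∀ τ, t < τ → ‖k Z τ - k W τ‖ ≤ δ * (1 / 2 * dist Z W) * τ ^ (-1 - δ) := by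
      intro τ hτ
      have hτ0 : t₀ ≤ τ := ht.trans hτ.le
      have hτ' : 0 < τ := ht₀.trans_le hτ0
      simp only [k]
      rw [← mul_sub, norm_mul, norm_inv, hEnorm τ hτ', ← hkrp τ _ hτ0]
      have h1 := hlip τ hτ0 _ _ (hZ τ hτ0) (hW τ hτ0)
      have h2 : ‖Z τ - W τ‖ ≤ dist Z W := by
        rw [← dist_eq_norm]; exact BoundedContinuousFunction.dist_coe_le_dist τ
      gcongr
      refine h1.trans ?_
      calc δ / 2 / τ * ‖Z τ - W τ‖ ≤ δ / 2 / τ * dist Z W := by gcongr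
        _ = δ * (1 / 2 * dist Z W) / τ := by ring
    have := norm_integral_Ioi_le_rpow hδ ht' hb
    rw [← hcancel t (1 / 2 * dist Z W) ht']
    have := Real.rpow_pos_of_pos ht' δ
    gcongr
  have hcontr : ContractingWith (1 / 2) (hmaps.restrict Ψ S S) := by
    refine ⟨by rw [← NNReal.coe_lt_coe]; norm_num, LipschitzWith.of_dist_le_mul fun Z W => ?_⟩
    simp only [Subtype.dist_eq, MapsTo.val_restrict_apply]
    rw [BoundedContinuousFunction.dist_le (by positivity)]
    intro t
    rw [hΨmax _ Z.2, hΨmax _ W.2, dist_eq_norm]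
    simpa using hdiff _ Z.2 _ W.2 _ (hmax t)
  have h0S : (0 : BoundedContinuousFunction ℝ ℂ) ∈ S := fun t ht => by
    simpa using mul_nonneg hK (hρ0 t ht)
  obtain ⟨Z, hZS, hfix, -, -⟩ := hcontr.exists_fixedPoint' hSc.isComplete hmaps h0S
    (edist_ne_top _ _)
  refine ⟨Z, hZS, fun t ht => ?_⟩
  have ht' : 0 < t := ht₀.trans ht
  have hΦd : HasDerivAt (Φ Z) (-((Complex.I * θ' t + δ / t) * E t * (∫ τ in Ioi t, k Z τ) +
      E t * -(k Z t))) t :=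
    ((hEd t ht.le).mul (hasDerivAt_integral_Ioi (hkint Z hZS) ht fun s hs =>
      (hkc Z hZS).continuousAt (Ici_mem_nhds hs))).neg
  have hZΦ : ∀ s, t₀ ≤ s → Z s = Φ Z s := fun s hs => by
    rw [← hΨ Z hZS s hs, hfix]
  refine (hΦd.congr_of_eventuallyEq ?_).congr_deriv ?_
  · filter_upwards [lt_mem_nhds ht] with s hs using hZΦ s hs.le
  · have h1 : Z t = -(E t * ∫ τ in Ioi t, k Z τ) := hZΦ t ht.le
    have h2 : E t * k Z t = e t (Z t) := mul_inv_cancel_left₀ (hEne t ht') _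
    linear_combination (-(Complex.I * θ' t + δ / t)) * h1 + h2

end Dichotomy

/-! ### The equation for the deviation from the model. -/

section Perturbation

/-- The second derivative of the deviation `φ = y - modelY B` for a solution `y` of
`y'' + (p(y) - 1) y'² + e^{y-t} / 4 = 0`, in terms of `φ` and `φ'`. -/
noncomputable def accel (p : ℝ → ℝ) (B t φ ψ : ℝ) : ℝ :=
  -(p (modelY B t + φ) - 1) * (t / (t + 1) + ψ) ^ 2 + (modelP B t - 1) * (t / (t + 1)) ^ 2 -
    1 / (B * (t + 1)) * (Real.exp φ - 1)

/-- The deviation of `f' F` from the model value. -/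
noncomputable def defect (p : ℝ → ℝ) (B t : ℝ) : ℝ := p (modelY B t) - modelP B t

/-- The part of `accel` left after removing its leading linear terms. -/
noncomputable def accelRem (p : ℝ → ℝ) (B t φ ψ : ℝ) : ℝ :=
  accel p B t φ ψ + 1 / B / t * φ + defect p B t - 2 * (1 / B) / t * ψ

theorem abs_exp_sub_sub_le {η x y : ℝ} (hη : η ≤ 1) (hx : |x| ≤ η) (hy : |y| ≤ η) :
    |(Real.exp x - x) - (Real.exp y - y)| ≤ 2 * η * |x - y| := by
  have hmem : ∀ z, |z| ≤ η → z ∈ Icc (-η) η := fun z hz => abs_le.1 hz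
  refine (convex_Icc (-η) η).norm_image_sub_le_of_norm_hasDerivWithin_le
    (f := fun z => Real.exp z - z) (f' := fun z => Real.exp z - 1)
    (fun z _ => ((Real.hasDerivAt_exp z).sub (hasDerivAt_id z)).hasDerivWithinAt)
    (fun z hz => ?_) (hmem y hy) (hmem x hx)
  have hz' : |z| ≤ η := abs_le.2 hz
  exact (Real.abs_exp_sub_one_le (hz'.trans hη)).trans (by linarith)

/-- At zero deviation the model terms cancel; what survives is the defect times the error of
replacing y₀'² = (t/(t+1))² by 1. -/
theorem accelRem_zero (p : ℝ → ℝ) (B t : ℝ) :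
    accelRem p B t 0 0 = defect p B t * (1 - (t / (t + 1)) ^ 2) := by
  simp [accelRem, accel, defect]
  ring

/-- Once the leading linear terms are gone, every contribution has one of two sizes. The variation
of p, the corrections of t/(t+1) to 1 and of 1/(t+1) to 1/t, and the second-order part of `modelP`
give 1/t²; the defect, the square of ψ and the nonlinear part of the exponential give η/t. -/
theorem abs_accelRem_sub_le {p : ℝ → ℝ} {B t η Q : ℝ} (hB : 1 ≤ B) (ht : 1 ≤ t) (hη0 : 0 ≤ η)
    (hη : η ≤ 1) (hQ : 0 ≤ Q)
    (hp : ∀ y z, modelY B t - 1 ≤ y → modelY B t - 1 ≤ z → |p y - p z| ≤ Q / t ^ 2 * |y - z|)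
    (hD : |defect p B t| ≤ η / t) {φ₁ φ₂ ψ₁ ψ₂ : ℝ} (hφ₁ : |φ₁| ≤ η) (hφ₂ : |φ₂| ≤ η)
    (hψ₁ : |ψ₁| ≤ η) (hψ₂ : |ψ₂| ≤ η) :
    |accelRem p B t φ₁ ψ₁ - accelRem p B t φ₂ ψ₂| ≤
      (4 * Q + 10) * (1 / t ^ 2 + η / t) * (|φ₁ - φ₂| + |ψ₁ - ψ₂|) := by
  have ht0 : 0 < t := by linarith
  have hB0 : 0 < B := by linarith
  set a := t / (t + 1) with ha
  have ha0 : 0 ≤ a := by positivity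
  have ha1 : a ≤ 1 := by rw [ha, div_le_one (by linarith)]; linarith
  have hb1 : 1 / B ≤ 1 := by rw [div_le_one hB0]; exact hB
  have hb0 : 0 < 1 / B := by positivity
  set x := |φ₁ - φ₂| with hx
  set z := |ψ₁ - ψ₂| with hz
  have hx0 : 0 ≤ x := abs_nonneg _
  have hz0 : 0 ≤ z := abs_nonneg _
  have hs : |2 * a + ψ₁ + ψ₂| ≤ 4 := by
    have h1 := abs_le.1 hψ₁
    have h2 := abs_le.1 hψ₂
    rw [abs_le]; constructor <;> linarith
  have hs2 : |ψ₁ + ψ₂| ≤ 2 * η := (abs_add_le _ _).trans (by linarith)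
  have hsq : (a + ψ₁) ^ 2 ≤ 4 := by
    have h1 := abs_le.1 hψ₁
    nlinarith
  have hp1 : |p (modelY B t + φ₁) - p (modelY B t + φ₂)| ≤ Q / t ^ 2 * x := by
    have h1 := abs_le.1 hφ₁
    have h2 := abs_le.1 hφ₂
    have := hp (modelY B t + φ₁) (modelY B t + φ₂) (by linarith) (by linarith)
    rwa [add_sub_add_left_eq_sub] at this
  have hp2 : |p (modelY B t + φ₂) - p (modelY B t)| ≤ Q / t ^ 2 := by
    have h2 := abs_le.1 hφ₂
    have := hp (modelY B t + φ₂) (modelY B t) (by linarith) (by linarith)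
    rw [add_sub_cancel_left] at this
    refine this.trans (mul_le_of_le_one_right (by positivity) (hφ₂.trans hη))
  have hinv : 1 / (t + 1) ≤ 1 / t := one_div_le_one_div_of_le ht0 (by linarith)
  have hinv2 : 1 / (t * (t + 1)) ≤ 1 / t ^ 2 :=
    one_div_le_one_div_of_le (by positivity) (by nlinarith)
  have hit : 0 < 1 / t := by positivity
  have hid : accelRem p B t φ₁ ψ₁ - accelRem p B t φ₂ ψ₂ =
      -((p (modelY B t + φ₁) - p (modelY B t + φ₂)) * (a + ψ₁) ^ 2)
      + -((p (modelY B t + φ₂) - p (modelY B t)) * (ψ₁ - ψ₂) * (2 * a + ψ₁ + ψ₂))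
      + -(defect p B t * (ψ₁ - ψ₂) * (2 * a + ψ₁ + ψ₂))
      + -(2 * (1 / B) * (1 / (t * (t + 1))) * (ψ₁ - ψ₂))
      + 1 / B * (1 / t) * ((ψ₁ - ψ₂) * (ψ₁ + ψ₂))
      + (1 + 1 / B) * (1 / t ^ 2) * ((ψ₁ - ψ₂) * (2 * a + ψ₁ + ψ₂))
      + -(1 / B * (1 / (t + 1)) * ((Real.exp φ₁ - φ₁) - (Real.exp φ₂ - φ₂)))
      + 1 / B * (1 / (t * (t + 1))) * (φ₁ - φ₂) := by
    have hP : modelP B t = 1 - 1 / B * (1 / t) - (1 + 1 / B) * (1 / t ^ 2) := by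
      simp only [modelP]; field_simp; ring
    have haa : 1 / (t * (t + 1)) = (1 - a) / t := by rw [ha]; field_simp; ring
    have hbb : 1 / (t + 1) = 1 - a := by rw [ha]; field_simp; ring
    have hcc : 1 / (B * (t + 1)) = 1 / B * (1 - a) := by rw [← hbb]; field_simp
    simp only [accelRem, accel, defect, ← ha]
    rw [hP, haa, hbb, hcc]
    have hrel : a * (1 / t) = 1 - a := by rw [ha]; field_simp; ring
    linear_combination (1 / B) * (φ₁ - φ₂) * hrel
  have t1 : |-((p (modelY B t + φ₁) - p (modelY B t + φ₂)) * (a + ψ₁) ^ 2)| ≤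
      Q / t ^ 2 * x * 4 := by
    rw [abs_neg, abs_mul, abs_of_nonneg (sq_nonneg (a + ψ₁))]
    gcongr
  have t2 : |-((p (modelY B t + φ₂) - p (modelY B t)) * (ψ₁ - ψ₂) * (2 * a + ψ₁ + ψ₂))| ≤
      Q / t ^ 2 * z * 4 := by
    rw [abs_neg, abs_mul, abs_mul]
    gcongr
  have t3 : |-(defect p B t * (ψ₁ - ψ₂) * (2 * a + ψ₁ + ψ₂))| ≤ η / t * z * 4 := by
    rw [abs_neg, abs_mul, abs_mul]
    gcongr
  have t4 : |-(2 * (1 / B) * (1 / (t * (t + 1))) * (ψ₁ - ψ₂))| ≤ 2 * 1 * (1 / t ^ 2) * z := by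
    rw [abs_neg, abs_mul, abs_of_nonneg (by positivity)]
    gcongr
  have t5 : |1 / B * (1 / t) * ((ψ₁ - ψ₂) * (ψ₁ + ψ₂))| ≤ 1 * (1 / t) * (z * (2 * η)) := by
    rw [abs_mul, abs_of_nonneg (by positivity : 0 ≤ 1 / B * (1 / t)), abs_mul]
    gcongr
  have t6 : |(1 + 1 / B) * (1 / t ^ 2) * ((ψ₁ - ψ₂) * (2 * a + ψ₁ + ψ₂))| ≤
      (1 + 1) * (1 / t ^ 2) * (z * 4) := by
    rw [abs_mul, abs_of_nonneg (by positivity : 0 ≤ (1 + 1 / B) * (1 / t ^ 2)), abs_mul]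
    gcongr
  have t7 : |-(1 / B * (1 / (t + 1)) * ((Real.exp φ₁ - φ₁) - (Real.exp φ₂ - φ₂)))| ≤
      1 * (1 / t) * (2 * η * x) := by
    rw [abs_neg, abs_mul, abs_of_nonneg (by positivity : 0 ≤ 1 / B * (1 / (t + 1)))]
    have := abs_exp_sub_sub_le hη hφ₁ hφ₂
    gcongr
  have t8 : |1 / B * (1 / (t * (t + 1))) * (φ₁ - φ₂)| ≤ 1 * (1 / t ^ 2) * x := by
    rw [abs_mul, abs_of_nonneg (by positivity)]
    gcongr
  rw [hid]
  -- The largest coefficient after collecting is that of |ψ₁ - ψ₂|/t², namely 4Q + 2 + 8, which is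
  -- the constant in the statement.
  refine (abs_add_le _ _).trans ((add_le_add ((abs_add_le _ _).trans (add_le_add
    ((abs_add_le _ _).trans (add_le_add ((abs_add_le _ _).trans (add_le_add
    ((abs_add_le _ _).trans (add_le_add ((abs_add_le _ _).trans (add_le_add
    ((abs_add_le _ _).trans (add_le_add t1 t2)) t3)) t4)) t5)) t6)) t7)) t8).trans ?_)
  set i := 1 / t with hi
  have e1 : 1 / t ^ 2 = i ^ 2 := by rw [hi]; ring
  have e2 : Q / t ^ 2 = Q * i ^ 2 := by rw [hi]; ring
  have e3 : η / t = η * i := by rw [hi]; ring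
  rw [e1, e2, e3]
  have p1 : 0 ≤ i ^ 2 * x := by positivity
  have p2 : 0 ≤ i ^ 2 * z := by positivity
  have p3 : 0 ≤ η * i * x := by positivity
  have p4 : 0 ≤ η * i * z := by positivity
  have p5 : 0 ≤ Q * (η * i * x) := by positivity
  have p6 : 0 ≤ Q * (η * i * z) := by positivity
  linarith

end Perturbation

section Perturbation

set_option maxHeartbeats 1600000 in
-- Write b = 1/B. The slow response to the forcing is φ ≈ -h with h = B t · defect, obtained by
-- balancing φ/(Bt) against the defect. With X = √b (φ + h) and W = √t φ' - kX/√t, the complex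
-- variable Z = X + iW rotates with angular speed -√b/√t and grows at rate (1/4 + b)/t, up to a
-- small perturbation. This is the setting of `exists_decaying_solution`. The bound on the
-- derivative of the defect is needed because h' enters the perturbation.
theorem exists_perturbed_solution {p q ρ : ℝ → ℝ} {B Y Q C t₀ : ℝ} (hB : 1 ≤ B) (hQ : 0 ≤ Q)
    (hC : 0 ≤ C) (ht₀ : 1 ≤ t₀) (hp : ∀ y, Y < y → HasDerivAt p (q y) y)
    (hq : ∀ y, Y < y → ContinuousAt q y) (hY : ∀ t, t₀ ≤ t → Y < modelY B t - 1)
    (hqb : ∀ t, t₀ ≤ t → ∀ y, modelY B t - 1 ≤ y → |q y| ≤ Q / t ^ 2)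
    (hρ : AntitoneOn ρ (Ici t₀)) (hρ0 : ∀ t, t₀ ≤ t → 0 ≤ ρ t)
    (hρlim : Tendsto (fun t => √t * ρ t) atTop (𝓝 0))
    (hD : ∀ t, t₀ ≤ t → |defect p B t| ≤ C * ρ t / t)
    (hD' : ∀ t, t₀ ≤ t →
      |q (modelY B t) * (t / (t + 1)) - modelPDeriv B t| ≤ C * ρ t / t ^ 2) :
    ∃ (M t₁ : ℝ) (φ ψ : ℝ → ℝ), t₀ ≤ t₁ ∧ 0 ≤ M ∧ ∀ t, t₁ < t →
      HasDerivAt φ (ψ t) t ∧ HasDerivAt ψ (accel p B t (φ t) (ψ t)) t ∧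
        |φ t| ≤ M * ρ t ∧ |ψ t| ≤ M * ρ t ∧ M * ρ t ≤ 1 := by
  have hB0 : 0 < B := by linarith
  set b := 1 / B with hb
  have hb0 : 0 < b := by positivity
  set om := √b with hom
  have hom0 : 0 < om := Real.sqrt_pos.2 hb0
  have homsq : om * om = b := Real.mul_self_sqrt hb0.le
  -- The system for (φ, √t φ') has trace (1/2 + 2b)/t. The constant k below shears the second
  -- coordinate so that both coordinates receive half of it.
  set dl := 1 / 4 + b with hdl
  have hdl0 : 0 < dl := by positivity
  set k := dl / om with hk
  have hk0 : 0 < k := by positivity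
  have hkom : k * om = dl := by rw [hk]; field_simp
  set D' : ℝ → ℝ := fun t => q (modelY B t) * (t / (t + 1)) - modelPDeriv B t with hD'def
  set h : ℝ → ℝ := fun t => B * (t * defect p B t) with hh
  set h' : ℝ → ℝ := fun t => B * (defect p B t + t * D' t) with hh'
  set M₀ := 4 * Q + 10 with hM₀
  have hM₀0 : 0 < M₀ := by positivity
  -- C₁ bounds the perturbation at Z = 0, and K is fixed by dl/2 · K = C₁. M dominates the bounds
  -- for φ, φ' and the defect simultaneously. S collects the Lipschitz constants, and ε is chosen so
  -- that Sε ≤ dl/2.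
  set C₁ := om * (2 * B * C) + (2 * C + 2 * M₀ * (B * C)) + dl * (2 * B * C) with hC₁
  have hC₁0 : 0 ≤ C₁ := by positivity
  set K := 2 * C₁ / dl with hK
  have hK0 : 0 ≤ K := by positivity
  set M := K / om + B * C + K * (1 + k) + C with hM
  have hM0 : 0 ≤ M := by positivity
  set S := dl * k + k / 2 + 2 * M₀ * (1 / om + 1 + k) with hS
  have hS0 : 0 < S := by positivity
  set ε := min 1 (dl / 2 / S) with hε
  have hε0 : 0 < ε := by positivity
  have hε1 : ε ≤ 1 := min_le_left _ _
  have hεS : S * ε ≤ dl / 2 := by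
    calc S * ε ≤ S * (dl / 2 / S) := by gcongr; exact min_le_right _ _
      _ = dl / 2 := by field_simp
  clear_value ε S M K C₁ M₀ k dl om b
  -- choice of the starting point
  have hev : ∀ᶠ t : ℝ in atTop, M * (√t * ρ t) ≤ ε ∧ 1 / √t ≤ ε := by
    have h1 : Tendsto (fun t => M * (√t * ρ t)) atTop (𝓝 0) := by
      simpa using hρlim.const_mul M
    have h2 : Tendsto (fun t : ℝ => 1 / √t) atTop (𝓝 0) := by
      simpa using! Real.tendsto_sqrt_atTop.inv_tendsto_atTop
    filter_upwards [h1.eventually (gt_mem_nhds hε0), h2.eventually (gt_mem_nhds hε0)] with t a c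
      using ⟨a.le, c.le⟩
  obtain ⟨t₂, ht₂⟩ := eventually_atTop.1 hev
  set t₁ := max t₀ t₂ with ht₁
  have ht₀₁ : t₀ ≤ t₁ := le_max_left _ _
  have hone : ∀ t, t₁ ≤ t → 1 ≤ t := fun t ht => by linarith
  have hge : ∀ t, t₁ ≤ t → t₀ ≤ t := fun t ht => ht₀₁.trans ht
  have hsq1 : ∀ t, t₁ ≤ t → 1 ≤ √t := fun t ht => by
    rw [Real.one_le_sqrt]; exact hone t ht
  have hsmall : ∀ t, t₁ ≤ t → √t * (M * ρ t) ≤ ε := fun t ht => by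
    have := (ht₂ t ((le_max_right _ _).trans ht)).1
    linarith
  have hsmall' : ∀ t, t₁ ≤ t → 1 / √t ≤ ε := fun t ht =>
    (ht₂ t ((le_max_right _ _).trans ht)).2
  have hη0 : ∀ t, t₁ ≤ t → 0 ≤ M * ρ t := fun t ht => mul_nonneg hM0 (hρ0 t (hge t ht))
  have hη1 : ∀ t, t₁ ≤ t → M * ρ t ≤ 1 := fun t ht =>
    (le_mul_of_one_le_left (hη0 t ht) (hsq1 t ht)).trans ((hsmall t ht).trans hε1)
  let phi : ℝ → ℂ → ℝ := fun t z => z.re / om - h t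
  let psi : ℝ → ℂ → ℝ := fun t z => z.im / √t + k * z.re / t
  let e : ℝ → ℂ → ℂ := fun t z => ⟨om * h' t, (dl * k + k / 2) * z.re / (t * √t) +
    √t * accelRem p B t (phi t z) (psi t z) - dl / √t * h' t⟩
  -- bounds on the coefficients
  have hDb : ∀ t, t₁ ≤ t → |defect p B t| ≤ M * ρ t / t := fun t ht => by
    have ht0 := hone t ht
    refine (hD t (hge t ht)).trans ?_
    have : C ≤ M := by rw [hM]; linarith [show 0 ≤ K / om + B * C + K * (1 + k) by positivity]
    have := hρ0 t (hge t ht)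
    gcongr
  have hhb : ∀ t, t₁ ≤ t → |h t| ≤ B * C * ρ t := fun t ht => by
    have ht0 := hone t ht
    have := hD t (hge t ht)
    simp only [hh, abs_mul, abs_of_pos hB0, abs_of_pos (show 0 < t by linarith)]
    calc B * (t * |defect p B t|) ≤ B * (t * (C * ρ t / t)) := by gcongr
      _ = B * C * ρ t := by field_simp
  have hhb' : ∀ t, t₁ ≤ t → |h' t| ≤ 2 * B * C * ρ t / t := fun t ht => by
    have ht0 := hone t ht
    have h1 := hD t (hge t ht)
    have h2 := hD' t (hge t ht)
    simp only [hh', abs_mul, abs_of_pos hB0]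
    have h3 : |defect p B t + t * D' t| ≤ C * ρ t / t + t * (C * ρ t / t ^ 2) := by
      refine (abs_add_le _ _).trans (add_le_add h1 ?_)
      rw [abs_mul, abs_of_pos (show 0 < t by linarith)]
      gcongr
    calc B * |defect p B t + t * D' t| ≤ B * (C * ρ t / t + t * (C * ρ t / t ^ 2)) := by gcongr
      _ = 2 * B * C * ρ t / t := by field_simp; ring
  have hphib : ∀ t, t₁ ≤ t → ∀ z : ℂ, ‖z‖ ≤ K * ρ t → |phi t z| ≤ M * ρ t := by
    intro t ht z hz
    have hρt := hρ0 t (hge t ht)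
    have h1 : |z.re / om| ≤ K / om * ρ t := by
      rw [abs_div, abs_of_pos hom0, div_mul_eq_mul_div]
      have := (Complex.abs_re_le_norm z).trans hz
      gcongr
    have h2 : 0 ≤ K * (1 + k) * ρ t := by positivity
    have h3 : 0 ≤ C * ρ t := by positivity
    calc |phi t z| ≤ |z.re / om| + |h t| := abs_sub _ _
      _ ≤ K / om * ρ t + B * C * ρ t := add_le_add h1 (hhb t ht)
      _ ≤ M * ρ t := by rw [hM]; linarith
  have hpsi : ∀ t, t₁ ≤ t → ∀ z : ℂ, |psi t z| ≤ (1 + k) * ‖z‖ := by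
    intro t ht z
    have ht0 := hone t ht
    have h1 : |z.im / √t| ≤ ‖z‖ := by
      rw [abs_div, abs_of_nonneg (Real.sqrt_nonneg t)]
      exact (div_le_self (abs_nonneg _) (hsq1 t ht)).trans (Complex.abs_im_le_norm z)
    have h2 : |k * z.re / t| ≤ k * ‖z‖ := by
      rw [abs_div, abs_mul, abs_of_pos hk0, abs_of_pos (show 0 < t by linarith)]
      refine (div_le_self (by positivity) ht0).trans ?_
      have := Complex.abs_re_le_norm z
      gcongr
    calc |psi t z| ≤ |z.im / √t| + |k * z.re / t| := abs_add_le _ _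
      _ ≤ (1 + k) * ‖z‖ := by linarith
  have hpsib : ∀ t, t₁ ≤ t → ∀ z : ℂ, ‖z‖ ≤ K * ρ t → |psi t z| ≤ M * ρ t := by
    intro t ht z hz
    have hρt := hρ0 t (hge t ht)
    refine (hpsi t ht z).trans ?_
    have h2 : 0 ≤ K / om * ρ t := by positivity
    have h3 : 0 ≤ C * ρ t := by positivity
    have h4 : 0 ≤ B * C * ρ t := by positivity
    calc (1 + k) * ‖z‖ ≤ (1 + k) * (K * ρ t) := by gcongr
      _ ≤ M * ρ t := by rw [hM]; linarith
  have hpl : ∀ t, t₁ ≤ t → ∀ y z, modelY B t - 1 ≤ y → modelY B t - 1 ≤ z →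
      |p y - p z| ≤ Q / t ^ 2 * |y - z| := by
    intro t ht y z hy hz
    exact (convex_Ici (modelY B t - 1)).norm_image_sub_le_of_norm_hasDerivWithin_le
      (fun w hw => (hp w ((hY t (hge t ht)).trans_le hw)).hasDerivWithinAt)
      (fun w hw => hqb t (hge t ht) w hw) hz hy
  have hrem : ∀ t, t₁ ≤ t → ∀ φ₁ φ₂ ψ₁ ψ₂ : ℝ, |φ₁| ≤ M * ρ t → |φ₂| ≤ M * ρ t →
      |ψ₁| ≤ M * ρ t → |ψ₂| ≤ M * ρ t →
      |accelRem p B t φ₁ ψ₁ - accelRem p B t φ₂ ψ₂| ≤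
        M₀ * (1 / t ^ 2 + M * ρ t / t) * (|φ₁ - φ₂| + |ψ₁ - ψ₂|) :=
    fun t ht φ₁ φ₂ ψ₁ ψ₂ h1 h2 h3 h4 => by
      rw [hM₀]
      exact abs_accelRem_sub_le hB (hone t ht) (hη0 t ht)
        (hη1 t ht) hQ (hpl t ht) (hDb t ht) h1 h2 h3 h4
  -- This is where √t ρ → 0 is used: after multiplication by √t the Lipschitz constant of the
  -- remainder must still be a small multiple of 1/t.
  have hsqrtmul : ∀ t, t₁ ≤ t → √t * (1 / t ^ 2 + M * ρ t / t) ≤ 2 * ε / t := by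
    intro t ht
    have ht0 : 0 < t := by linarith [hone t ht]
    have h1 : √t * (1 / t ^ 2) ≤ ε / t := by
      have h2 : √t * (1 / t ^ 2) = 1 / √t * (1 / t) := by
        have h3 : √t * √t = t := Real.mul_self_sqrt ht0.le
        have h4 : 0 < √t := Real.sqrt_pos.2 ht0
        rw [div_mul_div_comm, mul_one_div, div_eq_div_iff (by positivity) (by positivity)]
        linear_combination t * h3
      rw [h2, div_eq_mul_one_div ε t]
      have := hsmall' t ht
      gcongr
    have h2 : √t * (M * ρ t / t) ≤ ε / t := by
      rw [← mul_div_assoc]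
      have := hsmall t ht
      gcongr
    calc √t * (1 / t ^ 2 + M * ρ t / t) = √t * (1 / t ^ 2) + √t * (M * ρ t / t) := by ring
      _ ≤ ε / t + ε / t := add_le_add h1 h2
      _ = 2 * ε / t := by ring
  have hlip : ∀ t, t₁ ≤ t → ∀ z w : ℂ, ‖z‖ ≤ K * ρ t → ‖w‖ ≤ K * ρ t →
      ‖e t z - e t w‖ ≤ dl / 2 / t * ‖z - w‖ := by
    intro t ht z w hz hw
    have ht0 : 0 < t := by linarith [hone t ht]
    have hst := Real.sqrt_pos.2 ht0
    have hre : (e t z - e t w).re = 0 := by simp [e]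
    have him : (e t z - e t w).im = (dl * k + k / 2) * (1 / √t) / t * (z - w).re +
        √t * (accelRem p B t (phi t z) (psi t z) - accelRem p B t (phi t w) (psi t w)) := by
      simp only [e, Complex.sub_im, Complex.sub_re]
      field_simp
      ring
    have hΔφ : |phi t z - phi t w| ≤ 1 / om * ‖z - w‖ := by
      have : phi t z - phi t w = 1 / om * (z - w).re := by
        simp only [phi, Complex.sub_re]; ring
      rw [this, abs_mul, abs_of_pos (by positivity)]
      have := Complex.abs_re_le_norm (z - w)
      gcongr
    have hΔψ : |psi t z - psi t w| ≤ (1 + k) * ‖z - w‖ := by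
      have : psi t z - psi t w = psi t (z - w) := by
        simp only [psi, Complex.sub_re, Complex.sub_im]; ring
      rw [this]
      exact hpsi t ht _
    have h1 : |√t * (accelRem p B t (phi t z) (psi t z) - accelRem p B t (phi t w) (psi t w))| ≤
        M₀ * (2 * ε / t) * ((1 / om + 1 + k) * ‖z - w‖) := by
      rw [abs_mul, abs_of_pos hst]
      calc _ ≤ √t * (M₀ * (1 / t ^ 2 + M * ρ t / t) *
              (|phi t z - phi t w| + |psi t z - psi t w|)) := by
            gcongr
            exact hrem t ht _ _ _ _ (hphib t ht z hz) (hphib t ht w hw) (hpsib t ht z hz)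
              (hpsib t ht w hw)
        _ = M₀ * (√t * (1 / t ^ 2 + M * ρ t / t)) *
              (|phi t z - phi t w| + |psi t z - psi t w|) := by ring
        _ ≤ M₀ * (2 * ε / t) * ((1 / om + 1 + k) * ‖z - w‖) := by
            have := hsqrtmul t ht
            gcongr
            linarith
    have h2 : |(dl * k + k / 2) * (1 / √t) / t * (z - w).re| ≤
        (dl * k + k / 2) * ε / t * ‖z - w‖ := by
      rw [abs_mul, abs_of_nonneg (by positivity)]
      have := hsmall' t ht
      have := Complex.abs_re_le_norm (z - w)
      gcongr
    calc ‖e t z - e t w‖ ≤ |(e t z - e t w).re| + |(e t z - e t w).im| :=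
          Complex.norm_le_abs_re_add_abs_im _
      _ ≤ (dl * k + k / 2) * ε / t * ‖z - w‖ +
            M₀ * (2 * ε / t) * ((1 / om + 1 + k) * ‖z - w‖) := by
          rw [hre, him, abs_zero, zero_add]
          exact (abs_add_le _ _).trans (add_le_add h2 h1)
      _ = S * ε / t * ‖z - w‖ := by rw [hS]; ring
      _ ≤ dl / 2 / t * ‖z - w‖ := by gcongr
  have hzero : ∀ t, t₁ ≤ t → ‖e t 0‖ ≤ dl / 2 * (K * ρ t) / t := by
    intro t ht
    have ht1 := hone t ht
    have ht0 : 0 < t := by linarith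
    have hst := Real.sqrt_pos.2 ht0
    have hρt := hρ0 t (hge t ht)
    have hK' : dl / 2 * (K * ρ t) / t = C₁ * ρ t / t := by
      rw [hK]; field_simp
    rw [hK']
    have h0 : ‖(0 : ℂ)‖ ≤ K * ρ t := by simpa using mul_nonneg hK0 hρt
    have hp0 : phi t 0 = -h t := by simp [phi]
    have hs0 : psi t 0 = 0 := by simp [psi]
    have hre : |(e t 0).re| ≤ om * (2 * B * C) * ρ t / t := by
      simp only [e, abs_mul, abs_of_pos hom0]
      calc om * |h' t| ≤ om * (2 * B * C * ρ t / t) := by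
            have := hhb' t ht; gcongr
        _ = _ := by ring
    have hr0 : |accelRem p B t 0 0| ≤ 2 * C * ρ t / t ^ 2 := by
      rw [accelRem_zero, abs_mul]
      have h1 : |1 - (t / (t + 1)) ^ 2| ≤ 2 / t := by
        have h2 : 1 - (t / (t + 1)) ^ 2 = (2 * t + 1) / (t + 1) ^ 2 := by field_simp; ring
        rw [h2, abs_of_nonneg (by positivity), div_le_div_iff₀ (by positivity) ht0]
        have h3 : 2 * (t + 1) ^ 2 - (2 * t + 1) * t = 3 * t + 2 := by ring
        linarith
      calc |defect p B t| * |1 - (t / (t + 1)) ^ 2| ≤ C * ρ t / t * (2 / t) := by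
            have := hD t (hge t ht); gcongr
        _ = _ := by ring
    have hr1 : |√t * accelRem p B t (phi t 0) (psi t 0)| ≤
        (2 * C + 2 * M₀ * (B * C)) * ρ t / t := by
      have h1 := hrem t ht (phi t 0) 0 (psi t 0) 0 (hphib t ht 0 h0) (by simpa using hη0 t ht)
        (hpsib t ht 0 h0) (by simpa using hη0 t ht)
      have h2 : |phi t 0 - 0| + |psi t 0 - 0| ≤ B * C * ρ t := by
        simpa [hp0, hs0] using hhb t ht
      have h3 : |accelRem p B t (phi t 0) (psi t 0)| ≤
          M₀ * (1 / t ^ 2 + M * ρ t / t) * (B * C * ρ t) + 2 * C * ρ t / t ^ 2 := by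
        have h4 : |accelRem p B t (phi t 0) (psi t 0)| ≤
            |accelRem p B t (phi t 0) (psi t 0) - accelRem p B t 0 0| + |accelRem p B t 0 0| := by
          simpa using abs_add_le (accelRem p B t (phi t 0) (psi t 0) - accelRem p B t 0 0)
            (accelRem p B t 0 0)
        refine h4.trans (add_le_add (h1.trans ?_) hr0)
        have := hη0 t ht
        gcongr
      have h5 : √t * (1 / t ^ 2 + M * ρ t / t) ≤ 2 / t := by
        refine (hsqrtmul t ht).trans ?_
        gcongr
        linarith
      have h6 : √t / t ^ 2 ≤ 1 / t := by
        have : √t ≤ t := by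
          rw [Real.sqrt_le_left (by linarith)]
          exact le_self_pow₀ ht1 two_ne_zero
        rw [div_le_div_iff₀ (by positivity) ht0, one_mul, sq]
        gcongr
      rw [abs_mul, abs_of_pos hst]
      calc √t * |accelRem p B t (phi t 0) (psi t 0)|
          ≤ √t * (M₀ * (1 / t ^ 2 + M * ρ t / t) * (B * C * ρ t) + 2 * C * ρ t / t ^ 2) := by
            gcongr
        _ = M₀ * (√t * (1 / t ^ 2 + M * ρ t / t)) * (B * C * ρ t) +
              2 * C * ρ t * (√t / t ^ 2) := by ring
        _ ≤ M₀ * (2 / t) * (B * C * ρ t) + 2 * C * ρ t * (1 / t) := by gcongr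
        _ = _ := by ring
    have him : |(e t 0).im| ≤ (2 * C + 2 * M₀ * (B * C)) * ρ t / t +
        dl * (2 * B * C) * ρ t / t := by
      have h1 : (e t 0).im = √t * accelRem p B t (phi t 0) (psi t 0) - dl / √t * h' t := by
        simp [e]
      rw [h1]
      refine (abs_sub _ _).trans (add_le_add hr1 ?_)
      rw [abs_mul, abs_of_pos (by positivity)]
      calc dl / √t * |h' t| ≤ dl * (2 * B * C * ρ t / t) := by
            have h2 := hhb' t ht
            have h3 : dl / √t ≤ dl := div_le_self hdl0.le (hsq1 t ht)
            gcongr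
        _ = _ := by ring
    calc ‖e t 0‖ ≤ |(e t 0).re| + |(e t 0).im| := Complex.norm_le_abs_re_add_abs_im _
      _ ≤ _ := add_le_add hre him
      _ = C₁ * ρ t / t := by rw [hC₁]; ring
  -- continuity of the perturbation along continuous curves
  have hy0c : ∀ t, t₁ ≤ t → ContinuousAt (modelY B) t := fun t ht =>
    (hasDerivAt_modelY B (by linarith [hone t ht])).continuousAt
  have hYt : ∀ t, t₁ ≤ t → Y < modelY B t := fun t ht => by linarith [hY t (hge t ht)]
  have hPc : ∀ t, t₁ ≤ t → ContinuousAt (modelP B) t := fun t ht =>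
    (hasDerivAt_modelP B (by linarith [hone t ht])).continuousAt
  have hac : ∀ t, t₁ ≤ t → ContinuousAt (fun t : ℝ => t / (t + 1)) t := fun t ht =>
    continuousAt_id.div (by fun_prop) (by linarith [hone t ht])
  have hP'c : ∀ t, t₁ ≤ t → ContinuousAt (modelPDeriv B) t := fun t ht => by
    have ht0 : t ≠ 0 := by linarith [hone t ht]
    have ht2 : t ^ 2 ≠ 0 := pow_ne_zero 2 ht0
    have c1 : ContinuousAt (fun t : ℝ => 1 / t) t := continuousAt_const.div continuousAt_id ht0
    have c2 : ContinuousAt (fun t : ℝ => 1 / t ^ 2) t :=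
      continuousAt_const.div (by fun_prop) ht2
    have c3 : ContinuousAt (fun t : ℝ => (1 + 1 / B) / t) t :=
      continuousAt_const.div continuousAt_id ht0
    have c4 : ContinuousAt (fun t : ℝ => (1 + 1 / B) / t ^ 2) t :=
      continuousAt_const.div (by fun_prop) ht2
    exact (c2.neg.mul (continuousAt_const.sub c3)).add ((continuousAt_const.add c1).mul c4)
  have hDd : ∀ t, t₁ ≤ t → HasDerivAt (defect p B) (D' t) t := fun t ht =>
    ((hp _ (hYt t ht)).comp t (hasDerivAt_modelY B (by linarith [hone t ht]))).sub
      (hasDerivAt_modelP B (by linarith [hone t ht]))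
  have hD'c : ∀ t, t₁ ≤ t → ContinuousAt D' t := fun t ht =>
    ((ContinuousAt.comp (hq _ (hYt t ht)) (hy0c t ht)).mul (hac t ht)).sub (hP'c t ht)
  have hhd : ∀ t, t₁ ≤ t → HasDerivAt h (h' t) t := fun t ht => by
    refine (((hasDerivAt_id t).mul (hDd t ht)).const_mul B).congr_deriv ?_
    simp [hh']
  have hh'c : ∀ t, t₁ ≤ t → ContinuousAt h' t := fun t ht =>
    continuousAt_const.mul ((hDd t ht).continuousAt.add (continuousAt_id.mul (hD'c t ht)))
  have hec : ∀ Z : ℝ → ℂ, Continuous Z → (∀ t, t₁ ≤ t → ‖Z t‖ ≤ K * ρ t) →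
      ContinuousOn (fun t => e t (Z t)) (Ici t₁) := by
    intro Z hZc hZ t ht
    refine ContinuousAt.continuousWithinAt ?_
    have ht' : t₁ ≤ t := ht
    have ht0 : t ≠ 0 := by linarith [hone t ht]
    have hst : √t ≠ 0 := by linarith [hsq1 t ht]
    have cre : ContinuousAt (fun t => (Z t).re) t := by fun_prop
    have cim : ContinuousAt (fun t => (Z t).im) t := by fun_prop
    have csq : ContinuousAt (fun t : ℝ => √t) t := by fun_prop
    have cφ : ContinuousAt (fun t => phi t (Z t)) t :=
      (cre.div_const om).sub (hhd t ht').continuousAt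
    have cψ : ContinuousAt (fun t => psi t (Z t)) t :=
      (cim.div csq hst).add ((continuousAt_const.mul cre).div continuousAt_id ht0)
    have hYφ : Y < modelY B t + phi t (Z t) := by
      have h1 := abs_le.1 ((hphib t ht' (Z t) (hZ t ht')).trans (hη1 t ht'))
      linarith [hY t (hge t ht'), h1.1]
    have cp : ContinuousAt (fun t => p (modelY B t + phi t (Z t))) t :=
      ContinuousAt.comp (g := p) (hp _ hYφ).continuousAt ((hy0c t ht').add cφ)
    have cacc : ContinuousAt (fun t => accel p B t (phi t (Z t)) (psi t (Z t))) t := by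
      unfold accel
      refine (((cp.sub continuousAt_const).neg.mul (((hac t ht').add cψ).pow 2)).add
        (((hPc t ht').sub continuousAt_const).mul ((hac t ht').pow 2))).sub ?_
      refine ContinuousAt.mul (continuousAt_const.div (by fun_prop) ?_)
        ((Real.continuous_exp.continuousAt.comp cφ).sub continuousAt_const)
      have := hone t ht'
      positivity
    have crem : ContinuousAt (fun t => accelRem p B t (phi t (Z t)) (psi t (Z t))) t := by
      unfold accelRem
      exact (((cacc.add ((continuousAt_const.div continuousAt_id ht0).mul cφ)).add
        (hDd t ht').continuousAt).sub ((continuousAt_const.div continuousAt_id ht0).mul cψ))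
    have cim' : ContinuousAt (fun t => (dl * k + k / 2) * (Z t).re / (t * √t) +
        √t * accelRem p B t (phi t (Z t)) (psi t (Z t)) - dl / √t * h' t) t :=
      (((continuousAt_const.mul cre).div (continuousAt_id.mul csq) (mul_ne_zero ht0 hst)).add
        (csq.mul crem)).sub ((continuousAt_const.div csq hst).mul (hh'c t ht'))
    have cre' : ContinuousAt (fun t => om * h' t) t := continuousAt_const.mul (hh'c t ht')
    have heq : (fun t => e t (Z t)) = fun t => ((om * h' t : ℝ) : ℂ) +
        (((dl * k + k / 2) * (Z t).re / (t * √t) +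
        √t * accelRem p B t (phi t (Z t)) (psi t (Z t)) - dl / √t * h' t : ℝ) : ℂ) *
          Complex.I := by
      funext t
      exact Complex.mk_eq_add_mul_I _ _
    rw [heq]
    exact (Complex.continuous_ofReal.continuousAt.comp cre').add
      ((Complex.continuous_ofReal.continuousAt.comp cim').mul continuousAt_const)
  have hθ : ∀ t, t₁ ≤ t → HasDerivAt (fun t => -2 * om * √t) (-om / √t) t := fun t ht => by
    have ht0 : 0 < t := by linarith [hone t ht]
    refine ((Real.hasDerivAt_sqrt ht0.ne').const_mul (-2 * om)).congr_deriv ?_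
    have := Real.sqrt_pos.2 ht0
    field_simp
  obtain ⟨Z, hZb, hZd⟩ := exists_decaying_solution (δ := dl) (t₀ := t₁) (K := K)
    (θ' := fun t => -om / √t) (ρ := ρ) (e := e) hdl0
    (by linarith) hK0 hθ (hρ.mono (Ici_subset_Ici.2 ht₀₁)) (fun t ht => hρ0 t (hge t ht))
    hec hlip hzero
  refine ⟨M, t₁, fun t => phi t (Z t), fun t => psi t (Z t), ht₀₁, hM0, fun t ht => ?_⟩
  have ht0 : 0 < t := by linarith [hone t ht.le]
  have hst := Real.sqrt_pos.2 ht0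
  have hss : √t * √t = t := Real.mul_self_sqrt ht0.le
  have hX : HasDerivAt (fun t => (Z t).re)
      (om / √t * (Z t).im + dl / t * (Z t).re + om * h' t) t := by
    refine (Complex.reCLM.hasFDerivAt.comp_hasDerivAt t (hZd t ht)).congr_deriv ?_
    have h1 : (Complex.I * ((-om / √t : ℝ) : ℂ) + dl / t) * Z t =
        Complex.I * (((-om / √t : ℝ) : ℂ) * Z t) + ((dl / t : ℝ) : ℂ) * Z t := by
      push_cast; ring
    rw [h1]
    simp only [e, Complex.reCLM_apply, Complex.add_re, Complex.I_mul_re, Complex.im_ofReal_mul,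
      Complex.re_ofReal_mul]
    ring
  have hW : HasDerivAt (fun t => (Z t).im)
      (-(om / √t) * (Z t).re + dl / t * (Z t).im + (e t (Z t)).im) t := by
    refine (Complex.imCLM.hasFDerivAt.comp_hasDerivAt t (hZd t ht)).congr_deriv ?_
    have h1 : (Complex.I * ((-om / √t : ℝ) : ℂ) + dl / t) * Z t =
        Complex.I * (((-om / √t : ℝ) : ℂ) * Z t) + ((dl / t : ℝ) : ℂ) * Z t := by
      push_cast; ring
    rw [h1]
    simp only [Complex.imCLM_apply, Complex.add_im, Complex.I_mul_im, Complex.im_ofReal_mul,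
      Complex.re_ofReal_mul]
    ring
  refine ⟨?_, ?_, hphib t ht.le _ (hZb t ht.le), hpsib t ht.le _ (hZb t ht.le), hη1 t ht.le⟩
  · refine ((hX.div_const om).sub (hhd t ht.le)).congr_deriv ?_
    simp only [psi, hk]
    field_simp
    ring
  · have h1 := hW.div (Real.hasDerivAt_sqrt ht0.ne') hst.ne'
    have h2 := (hX.const_mul k).div (hasDerivAt_id t) ht0.ne'
    refine (h1.add h2).congr_deriv ?_
    have hacc : accel p B t (phi t (Z t)) (psi t (Z t)) =
        accelRem p B t (phi t (Z t)) (psi t (Z t)) - b / t * phi t (Z t) - defect p B t +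
          2 * b / t * psi t (Z t) := by
      simp only [accelRem, hb]; ring
    rw [hacc]
    set r := accelRem p B t (phi t (Z t)) (psi t (Z t)) with hr
    have him : (e t (Z t)).im = (dl * k + k / 2) * (Z t).re / (t * √t) + √t * r -
        dl / √t * h' t := rfl
    rw [him]
    simp only [phi, psi, hh, id]
    -- Expressing all constants through om and setting t = s² turns the remaining claim into an
    -- identity of rational functions.
    have hBom : B = 1 / (om * om) := by rw [homsq, hb]; field_simp
    have hk' : k = (1 / 4 + om * om) / om := by rw [hk, hdl, homsq]
    rw [hk', hdl, ← homsq, hBom]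
    clear_value r h'
    generalize h' t = H
    generalize defect p _ t = d
    generalize (Z t).re = X
    generalize (Z t).im = W
    clear him
    generalize √t = s at *
    subst hss
    have hs : s ≠ 0 := hst.ne'
    have ho : om ≠ 0 := hom0.ne'
    field_simp
    ring

end Perturbation

/-! ### Size of fF and its role as the derivative of F⁻¹(e^{-y}). -/

section Amplitude

variable {f : ℝ → ℝ} {B : ℝ}

theorem Admissible.hasDerivAt_comp_logInv (hf : Admissible f) {y : ℝ} (hy : logInvBound f < y) :
    HasDerivAt (fun y => f (logInv f y)) (f (logInv f y) * growth f y) y := by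
  refine ((hf.hasDerivAt (hf.logInv_pos hy)).comp y (hf.hasDerivAt_logInv hy)).congr_deriv ?_
  simp only [growth]
  ring

/-- `f F` as a function of `y = -log F` has derivative `(f' F - 1) f F`. -/
theorem Admissible.hasDerivAt_amplitude (hf : Admissible f) {y : ℝ} (hy : logInvBound f < y) :
    HasDerivAt (fun y => f (logInv f y) * Real.exp (-y))
      ((growth f y - 1) * (f (logInv f y) * Real.exp (-y))) y := by
  have h2 : HasDerivAt (fun y : ℝ => Real.exp (-y)) (Real.exp (-y) * -1) y :=
    (hasDerivAt_neg y).exp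
  refine ((hf.hasDerivAt_comp_logInv hy).mul h2).congr_deriv ?_
  ring

/-- From y² p' → 1/B one gets p' ≥ 1/(2B y²) eventually, so p + 1/(2By) is increasing; its limit is
1, hence it stays below 1. -/
theorem Admissible.eventually_growth_le (hf : Admissible f) (h1 : CondF1 f) (h2 : CondF2 f B) :
    ∀ᶠ y in atTop, growth f y ≤ 1 - B⁻¹ / 2 / y := by
  obtain ⟨s₀, -, hs₀, -⟩ := h1
  have hB : 0 < B⁻¹ := inv_pos.2 (by linarith [h2.2.2])
  obtain ⟨y₁, hy₁⟩ := eventually_atTop.1 ((eventually_gt_atTop (0 : ℝ)).and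
    ((eventually_gt_atTop (logInvBound f)).and ((hf.tendsto_logInv.eventually_gt_atTop s₀).and
      ((hf.tendsto_sq_mul_growthDeriv h2).eventually (lt_mem_nhds (half_lt_self hB))))))
  have hd : ∀ y, y₁ ≤ y → HasDerivAt (fun y => growth f y + B⁻¹ / 2 / y)
      (growthDeriv f y - B⁻¹ / 2 / y ^ 2) y := fun y hy => by
    obtain ⟨a1, a2, a3, -⟩ := hy₁ y hy
    refine ((hf.hasDerivAt_growth hs₀ a2 a3).add
      ((hasDerivAt_inv a1.ne').const_mul (B⁻¹ / 2))).congr_deriv ?_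
    ring
  have hmono : MonotoneOn (fun y => growth f y + B⁻¹ / 2 / y) (Ici y₁) := by
    refine monotoneOn_of_deriv_nonneg (convex_Ici y₁)
      (fun y hy => (hd y hy).continuousAt.continuousWithinAt)
      (fun y hy => (hd y (interior_subset hy)).differentiableAt.differentiableWithinAt)
      fun y hy => ?_
    have hy' : y₁ ≤ y := interior_subset hy
    obtain ⟨a1, -, -, a4⟩ := hy₁ y hy'
    rw [(hd y hy').deriv, sub_nonneg, div_le_iff₀ (by positivity)]
    linarith
  have hlim : Tendsto (fun y => growth f y + B⁻¹ / 2 / y) atTop (𝓝 1) := by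
    simpa using (hf.tendsto_growth h2).add (tendsto_const_nhds.div_atTop tendsto_id)
  filter_upwards [eventually_ge_atTop y₁] with y hy
  have : growth f y + B⁻¹ / 2 / y ≤ 1 := by
    refine ge_of_tendsto hlim ?_
    filter_upwards [eventually_ge_atTop y] with z hz
    exact hmono hy (hy.trans hz) hz
  linarith

/-- The logarithmic derivative of fF is p - 1 ≤ -c/y with c = 1/(2B), so y^c fF is eventually
decreasing. Knowing p → 1 alone would not suffice. -/
theorem Admissible.tendsto_amplitude (hf : Admissible f) (h1 : CondF1 f) (h2 : CondF2 f B) :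
    Tendsto (fun y => f (logInv f y) * Real.exp (-y)) atTop (𝓝 0) := by
  have hB : 0 < B⁻¹ := inv_pos.2 (by linarith [h2.2.2])
  set c := B⁻¹ / 2 with hc
  have hc0 : 0 < c := by positivity
  obtain ⟨y₁, hy₁⟩ := eventually_atTop.1 ((eventually_gt_atTop (0 : ℝ)).and
    ((eventually_gt_atTop (logInvBound f)).and (hf.eventually_growth_le h1 h2)))
  have hd : ∀ y, y₁ ≤ y → HasDerivAt (fun y => f (logInv f y) * Real.exp (-y) * y ^ c)
      ((growth f y - 1 + c / y) * (f (logInv f y) * Real.exp (-y) * y ^ c)) y := fun y hy => by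
    obtain ⟨a1, a2, -⟩ := hy₁ y hy
    refine ((hf.hasDerivAt_amplitude a2).mul
      (Real.hasDerivAt_rpow_const (p := c) (Or.inl a1.ne'))).congr_deriv ?_
    rw [Real.rpow_sub_one a1.ne']
    ring
  have hanti : AntitoneOn (fun y => f (logInv f y) * Real.exp (-y) * y ^ c) (Ici y₁) := by
    refine antitoneOn_of_deriv_nonpos (convex_Ici y₁)
      (fun y hy => (hd y hy).continuousAt.continuousWithinAt)
      (fun y hy => (hd y (interior_subset hy)).differentiableAt.differentiableWithinAt)
      fun y hy => ?_
    have hy' : y₁ ≤ y := interior_subset hy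
    obtain ⟨a1, a2, a3⟩ := hy₁ y hy'
    rw [(hd y hy').deriv]
    have := hf.pos _ (hf.logInv_pos a2)
    have := Real.rpow_pos_of_pos a1 c
    exact mul_nonpos_of_nonpos_of_nonneg (by linarith) (by positivity)
  have hlim : Tendsto (fun y : ℝ => f (logInv f y₁) * Real.exp (-y₁) * y₁ ^ c * y ^ (-c)) atTop
      (𝓝 0) := by
    simpa using (tendsto_rpow_neg_atTop hc0).const_mul _
  refine tendsto_of_tendsto_of_tendsto_of_le_of_le' tendsto_const_nhds hlim ?_ ?_
  · filter_upwards [eventually_ge_atTop y₁] with y hy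
    obtain ⟨a1, a2, -⟩ := hy₁ y hy
    have := hf.pos _ (hf.logInv_pos a2)
    positivity
  · filter_upwards [eventually_ge_atTop y₁] with y hy
    obtain ⟨a1, -, -⟩ := hy₁ y hy
    have h := hanti self_mem_Ici hy hy
    simp only at h
    rw [Real.rpow_neg a1.le, ← div_eq_mul_inv, le_div_iff₀ (Real.rpow_pos_of_pos a1 c)]
    exact h

/-- `F⁻¹(e^{-y})` varies by at most a multiple of `f F` under bounded changes of `y`. -/
theorem Admissible.abs_logInv_sub_le (hf : Admissible f) {a y : ℝ} (ha : logInvBound f < a)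
    (hg : ∀ z, a ≤ z → growth f z ≤ 2) (hy : a + 1 ≤ y) {φ : ℝ} (hφ : |φ| ≤ 1) :
    |logInv f (y + φ) - logInv f y| ≤
      Real.exp 3 * (f (logInv f y) * Real.exp (-y)) * |φ| := by
  -- The bound p ≤ 2 lets f grow by at most e² over a unit step in y, while e^{-y} changes by at
  -- most e; this is the origin of the factor e³.
  have hanti : AntitoneOn (fun z => f (logInv f z) * Real.exp (-2 * z)) (Ici a) := by
    have hd : ∀ z, a ≤ z → HasDerivAt (fun z => f (logInv f z) * Real.exp (-2 * z))
        ((growth f z - 2) * (f (logInv f z) * Real.exp (-2 * z))) z := fun z hz => by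
      have e : HasDerivAt (fun z : ℝ => Real.exp (-2 * z)) (Real.exp (-2 * z) * (-2 * 1)) z :=
        ((hasDerivAt_id z).const_mul (-2)).exp
      refine ((hf.hasDerivAt_comp_logInv (ha.trans_le hz)).mul e).congr_deriv ?_
      ring
    refine antitoneOn_of_deriv_nonpos (convex_Ici a)
      (fun z hz => (hd z hz).continuousAt.continuousWithinAt)
      (fun z hz => (hd z (interior_subset hz)).differentiableAt.differentiableWithinAt)
      fun z hz => ?_
    have hz' : a ≤ z := interior_subset hz
    rw [(hd z hz').deriv]
    have := hf.pos _ (hf.logInv_pos (ha.trans_le hz'))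
    exact mul_nonpos_of_nonpos_of_nonneg (by linarith [hg z hz']) (by positivity)
  have hmono : MonotoneOn (fun z => f (logInv f z)) (Ici a) := by
    refine monotoneOn_of_deriv_nonneg (convex_Ici a)
      (fun z hz => (hf.hasDerivAt_comp_logInv
        (ha.trans_le hz)).continuousAt.continuousWithinAt)
      (fun z hz => (hf.hasDerivAt_comp_logInv
        (ha.trans_le (interior_subset hz))).differentiableAt.differentiableWithinAt)
      fun z hz => ?_
    have hz' : a ≤ z := interior_subset hz
    rw [(hf.hasDerivAt_comp_logInv (ha.trans_le hz')).deriv]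
    have := hf.pos _ (hf.logInv_pos (ha.trans_le hz'))
    have := hf.growth_pos (ha.trans_le hz')
    positivity
  have hya : a ≤ y := by linarith
  have hφ' := abs_le.1 hφ
  have hmem : ∀ z ∈ Icc (y - 1) (y + 1), a ≤ z := fun z hz => by linarith [hz.1]
  have hb : ∀ z ∈ Icc (y - 1) (y + 1), ‖f (logInv f z) * Real.exp (-z)‖ ≤
      Real.exp 3 * (f (logInv f y) * Real.exp (-y)) := by
    intro z hz
    have hza := hmem z hz
    have hp := hf.pos _ (hf.logInv_pos (ha.trans_le hza))
    have hpy := hf.pos _ (hf.logInv_pos (ha.trans_le hya))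
    rw [Real.norm_of_nonneg (by positivity)]
    have h1 : f (logInv f z) ≤ Real.exp 2 * f (logInv f y) := by
      rcases le_total z y with h | h
      · refine (hmono hza hya h).trans (le_mul_of_one_le_left hpy.le ?_)
        exact Real.one_le_exp (by norm_num)
      · have h3 := hanti hya hza h
        simp only at h3
        have h4 : f (logInv f z) ≤ f (logInv f y) * Real.exp (-2 * y) * Real.exp (2 * z) := by
          rw [← div_le_iff₀ (Real.exp_pos _), div_eq_mul_inv, ← Real.exp_neg]
          simpa using h3
        refine h4.trans ?_
        rw [mul_assoc, ← Real.exp_add, mul_comm]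
        gcongr
        linarith [hz.2]
    have h2 : Real.exp (-z) ≤ Real.exp 1 * Real.exp (-y) := by
      rw [← Real.exp_add]
      exact Real.exp_le_exp.2 (by linarith [hz.1])
    calc f (logInv f z) * Real.exp (-z)
        ≤ (Real.exp 2 * f (logInv f y)) * (Real.exp 1 * Real.exp (-y)) := by gcongr
      _ = Real.exp 2 * Real.exp 1 * (f (logInv f y) * Real.exp (-y)) := by ring
      _ = Real.exp 3 * (f (logInv f y) * Real.exp (-y)) := by
          rw [← Real.exp_add]; norm_num
  have := (convex_Icc (y - 1) (y + 1)).norm_image_sub_le_of_norm_hasDerivWithin_le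
    (f := logInv f) (fun z hz => (hf.hasDerivAt_logInv
      (ha.trans_le (hmem z hz))).hasDerivWithinAt) hb
    (show y ∈ Icc (y - 1) (y + 1) by constructor <;> linarith)
    (show y + φ ∈ Icc (y - 1) (y + 1) by constructor <;> linarith)
  simpa using this

end Amplitude

/-! ### The supremum of R₁ + R₂ as a function of t. -/

section Remainder

variable {f : ℝ → ℝ} {B : ℝ}

/-- The supremum of `R₁ + R₂` over the punctured disc of radius `e^{-t/2}`. -/
noncomputable def supRem (f : ℝ → ℝ) (B t : ℝ) : ℝ :=
  sSup ((fun y => R₁ f B y + R₂ f B y) '' {y : Plane | 0 < ‖y‖ ∧ ‖y‖ ≤ Real.exp (-t / 2)})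

theorem exists_norm_eq {r : ℝ} (hr : 0 ≤ r) : ∃ x : Plane, ‖x‖ = r :=
  ⟨EuclideanSpace.single 0 r, by simp [abs_of_nonneg hr]⟩

theorem R_nonneg (x : Plane) : 0 ≤ R₁ f B x + R₂ f B x :=
  add_nonneg (abs_nonneg _) (abs_nonneg _)

theorem supRem_nonneg (t : ℝ) : 0 ≤ supRem f B t := by
  refine Real.sSup_nonneg ?_
  rintro _ ⟨x, -, rfl⟩
  exact R_nonneg x

theorem logRad_of_norm_eq {x : Plane} {t : ℝ} (hx : ‖x‖ = Real.exp (-t / 2)) :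
    logRad x = t := by
  rw [logRad_eq, hx, Real.log_exp]; ring

theorem norm_eq_exp_logRad {x : Plane} (hx : 0 < ‖x‖) : ‖x‖ = Real.exp (-logRad x / 2) := by
  rw [logRad_eq]
  have : -(-2 * Real.log ‖x‖) / 2 = Real.log ‖x‖ := by ring
  rw [this, Real.exp_log hx]

theorem CondR.exists_bound (hR : CondR f B) {ε : ℝ} (hε : 0 < ε) :
    ∃ T : ℝ, 0 < T ∧ ∀ x : Plane, 0 < ‖x‖ → T ≤ logRad x →
      R₁ f B x + R₂ f B x ≤ ε / √(logRad x) := by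
  have h := hR.eventually (gt_mem_nhds (show 0 < ε / 2 by positivity))
  rw [eventually_nhdsWithin_iff, Metric.eventually_nhds_iff] at h
  obtain ⟨r, hr, h⟩ := h
  refine ⟨max 1 (-2 * Real.log r + 1), by positivity, fun x hx hT => ?_⟩
  have h1 : 1 ≤ logRad x := (le_max_left _ _).trans hT
  have h2 : -2 * Real.log r + 1 ≤ logRad x := (le_max_right _ _).trans hT
  have h3 : ‖x‖ < r := by
    rw [logRad_eq] at h2
    exact (Real.log_lt_log_iff hx hr).1 (by linarith)
  have h4 := h (y := x) (by simpa using h3) (by simpa using norm_pos_iff.1 hx)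
  have h5 : -Real.log ‖x‖ = logRad x / 2 := by rw [logRad_eq]; ring
  rw [h5] at h4
  -- The hypothesis is stated with -log|x| = t/2; this comparison is paid for by having started from
  -- ε/2.
  have h6 : √(logRad x) / 2 ≤ √(logRad x / 2) := by
    rw [Real.sqrt_div (by linarith)]
    have : √2 ≤ 2 := by rw [Real.sqrt_le_left (by norm_num)]; norm_num
    gcongr
  rw [le_div_iff₀ (Real.sqrt_pos.2 (by linarith))]
  have := R_nonneg (f := f) (B := B) x
  nlinarith

theorem le_logRad {x : Plane} {t : ℝ} (hx : 0 < ‖x‖) (hxt : ‖x‖ ≤ Real.exp (-t / 2)) :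
    t ≤ logRad x := by
  have := Real.log_le_log hx hxt
  rw [Real.log_exp] at this
  rw [logRad_eq]
  linarith

theorem supRem_set_nonempty (t : ℝ) :
    ((fun y => R₁ f B y + R₂ f B y) ''
      {y : Plane | 0 < ‖y‖ ∧ ‖y‖ ≤ Real.exp (-t / 2)}).Nonempty := by
  obtain ⟨x, hx⟩ := exists_norm_eq (Real.exp_pos (-t / 2)).le
  exact ⟨_, x, ⟨by rw [hx]; exact Real.exp_pos _, hx.le⟩, rfl⟩

/-- The real `sSup` of an unbounded set is 0, so boundedness must be known before `supRem` bounds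
anything. It is available only near the origin, which is why the monotonicity below is restricted to
a half-line. -/
theorem CondR.exists_bddAbove (hR : CondR f B) : ∃ T : ℝ, ∀ t, T ≤ t →
    BddAbove ((fun y => R₁ f B y + R₂ f B y) ''
      {y : Plane | 0 < ‖y‖ ∧ ‖y‖ ≤ Real.exp (-t / 2)}) := by
  obtain ⟨T, hT, h⟩ := hR.exists_bound one_pos
  refine ⟨T, fun t ht => ⟨1 / √T, ?_⟩⟩
  rintro _ ⟨x, ⟨hx, hxt⟩, rfl⟩
  have h1 : T ≤ logRad x := ht.trans (le_logRad hx hxt)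
  refine (h x hx h1).trans ?_
  have := Real.sqrt_pos.2 hT
  gcongr

theorem CondR.tendsto_supRem (hR : CondR f B) :
    Tendsto (fun t => √t * supRem f B t) atTop (𝓝 0) := by
  rw [Metric.tendsto_atTop]
  intro ε hε
  obtain ⟨T, hT, h⟩ := hR.exists_bound (half_pos hε)
  refine ⟨T, fun t ht => ?_⟩
  have ht0 : 0 < t := hT.trans_le ht
  have hst := Real.sqrt_pos.2 ht0
  have hle : supRem f B t ≤ ε / 2 / √t := by
    refine csSup_le (supRem_set_nonempty t) ?_
    rintro _ ⟨x, ⟨hx, hxt⟩, rfl⟩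
    have h1 := le_logRad hx hxt
    refine (h x hx (ht.trans h1)).trans ?_
    gcongr
  rw [Real.dist_eq, sub_zero, abs_of_nonneg (mul_nonneg hst.le (supRem_nonneg t))]
  calc √t * supRem f B t ≤ √t * (ε / 2 / √t) := by gcongr
    _ = ε / 2 := by field_simp
    _ < ε := half_lt_self hε

theorem CondR.exists_antitoneOn (hR : CondR f B) : ∃ T : ℝ,
    AntitoneOn (supRem f B) (Ici T) ∧
      ∀ x : Plane, 0 < ‖x‖ → T ≤ logRad x → R₁ f B x + R₂ f B x ≤ supRem f B (logRad x) := by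
  obtain ⟨T, hT⟩ := hR.exists_bddAbove
  refine ⟨T, fun s hs t ht hst => ?_, fun x hx hxT => ?_⟩
  · refine csSup_le_csSup (hT s hs) (supRem_set_nonempty t) (image_mono fun x hx => ?_)
    refine ⟨hx.1, hx.2.trans (Real.exp_le_exp.2 (by linarith))⟩
  · exact le_csSup (hT _ hxT) ⟨x, ⟨hx, (norm_eq_exp_logRad hx).le⟩, rfl⟩

end Remainder

/-! ### The singular solution near the origin. -/

section NearOrigin

variable {f : ℝ → ℝ} {B : ℝ}

theorem tendsto_modelY (B : ℝ) : Tendsto (fun t => modelY B t - 1 - t / 2) atTop atTop := by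
  have h1 : Tendsto (fun t : ℝ => Real.log (t + 1) / (t + 1)) atTop (𝓝 0) := by
    have h := (Real.isLittleO_log_id_atTop.tendsto_div_nhds_zero).comp
      (tendsto_atTop_add_const_right atTop (1 : ℝ) tendsto_id)
    exact h
  have h2 : ∀ᶠ t : ℝ in atTop, t / 4 - 1 / 4 - 1 - Real.log (B / 4) ≤
      modelY B t - 1 - t / 2 := by
    filter_upwards [h1.eventually (gt_mem_nhds (show (0 : ℝ) < 1 / 4 by norm_num)),
      eventually_gt_atTop 0] with t ht ht0
    rw [div_lt_iff₀ (by linarith)] at ht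
    simp only [modelY]
    linarith
  refine tendsto_atTop_mono' atTop h2 ?_
  refine tendsto_atTop_add_const_right _ _ (tendsto_atTop_add_const_right _ _
    (tendsto_atTop_add_const_right _ _ (tendsto_id.atTop_div_const (by norm_num))))

theorem modelP_ne_zero (hB : 1 ≤ B) {t : ℝ} (ht : 2 < t) : modelP B t ≠ 0 := by
  have hb : 1 / B ≤ 1 := by rw [div_le_one (by linarith)]; exact hB
  have h1 : (1 + 1 / B) / t < 1 := by rw [div_lt_one (by linarith)]; linarith
  have h2 : 0 < 1 + 1 / t := by positivity
  exact (mul_pos h2 (by linarith)).ne'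

/-- `u = F⁻¹(e^{-y})` turns the equation for the deviation into `u'' = -e^{-t} f(u) / 4`. -/
theorem Admissible.hasDerivAt_logInv_of_accel (hf : Admissible f) (hB : 1 ≤ B) {φ ψ : ℝ → ℝ}
    {t : ℝ} (ht : 0 < t) (hφ : HasDerivAt φ (ψ t) t)
    (hψ : HasDerivAt ψ (accel (growth f) B t (φ t) (ψ t)) t)
    (hy : logInvBound f < modelY B t + φ t) :
    HasDerivAt (fun t => logInv f (modelY B t + φ t))
        (f (logInv f (modelY B t + φ t)) * Real.exp (-(modelY B t + φ t)) *
          (t / (t + 1) + ψ t)) t ∧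
      HasDerivAt (fun t => f (logInv f (modelY B t + φ t)) * Real.exp (-(modelY B t + φ t)) *
          (t / (t + 1) + ψ t))
        (-(Real.exp (-t) / 4 * f (logInv f (modelY B t + φ t)))) t := by
  have hyd : HasDerivAt (fun t => modelY B t + φ t) (t / (t + 1) + ψ t) t :=
    (hasDerivAt_modelY B ht).add hφ
  have hcomp := (hf.hasDerivAt_logInv hy).comp t hyd
  refine ⟨hcomp, ?_⟩
  have ha : HasDerivAt (fun t : ℝ => t / (t + 1)) (1 / (t + 1) ^ 2) t := by
    refine ((hasDerivAt_id t).div ((hasDerivAt_id t).add_const 1) (by simp; linarith)).congr_deriv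
      ?_
    simp
  have h1 := (hf.hasDerivAt_amplitude hy).comp t hyd
  refine (h1.mul (ha.add hψ)).congr_deriv ?_
  -- The forcing e^{y-t}/4 equals e^φ/(B(t+1)) because e^{-y₀} = (B/4)(t+1)e^{-t}.
  have hE : Real.exp (-t) / 4 = Real.exp (-(modelY B t + φ t)) *
      (1 / (B * (t + 1)) * Real.exp (φ t)) := by
    rw [neg_add, Real.exp_add, exp_neg_modelY (by linarith) ht, Real.exp_neg (φ t)]
    have := Real.exp_pos (φ t)
    have : 0 < B := by linarith
    field_simp
  -- This says that y₀ = `modelY` solves the equation exactly when p(y) is replaced by `modelP`: the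
  -- three terms are y₀'', (p - 1) y₀'² and e^{y₀-t}/4.
  have hid : 1 / (t + 1) ^ 2 + (modelP B t - 1) * (t / (t + 1)) ^ 2 + 1 / (B * (t + 1)) = 0 := by
    have : 0 < B := by linarith
    simp only [modelP]
    field_simp
    ring
  rw [hE]
  simp only [accel, Function.comp, Pi.add_apply]
  linear_combination f (logInv f (modelY B t + φ t)) * Real.exp (-(modelY B t + φ t)) * hid

theorem Admissible.exists_singular_near (hf : Admissible f) (h1 : CondF1 f) (h2 : CondF2 f B)
    (hR : CondR f B) :
    ∃ (C t₁ : ℝ) (U U' : ℝ → ℝ), 0 < t₁ ∧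
      (∀ t, t₁ < t → HasDerivAt U (U' t) t ∧
        HasDerivAt U' (-(Real.exp (-t) / 4 * f (U t))) t ∧ 0 < U t) ∧
      Tendsto U atTop atTop ∧ Tendsto U' atTop (𝓝 0) ∧
      ∀ x : Plane, 0 < ‖x‖ → t₁ < logRad x → |U (logRad x) - uTilde f B x| ≤
        C * (f (uTilde f B x) * tailInt f (uTilde f B x) * supRem f B (logRad x)) := by
  have hB : 1 ≤ B := h2.2.2
  have hB0 : 0 < B := by linarith
  obtain ⟨s₀, -, hs₀, -⟩ := id h1
  have hBinv : B⁻¹ < 2 := (inv_le_one_of_one_le₀ hB).trans_lt one_lt_two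
  have hBinv' : -2 < B⁻¹ := by have := inv_pos.2 hB0; linarith
  have hlim := hf.tendsto_sq_mul_growthDeriv h2
  obtain ⟨Y, hY⟩ := eventually_atTop.1 ((eventually_gt_atTop (0 : ℝ)).and
    ((eventually_gt_atTop (logInvBound f)).and ((hf.tendsto_logInv.eventually_gt_atTop s₀).and
      ((hlim.eventually (gt_mem_nhds hBinv)).and ((hlim.eventually (lt_mem_nhds hBinv')).and
        ((hf.tendsto_growth h2).eventually (gt_mem_nhds one_lt_two)))))))
  obtain ⟨T, hTanti, hTle⟩ := hR.exists_antitoneOn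
  obtain ⟨t₂, ht₂⟩ := eventually_atTop.1 ((tendsto_modelY B).eventually_gt_atTop (max Y 0))
  set t₀ := max (max T t₂) 3 with ht₀
  have h3 : ∀ t, t₀ ≤ t → 3 ≤ t := fun t ht => (le_max_right _ _).trans ht
  have hTt : ∀ t, t₀ ≤ t → T ≤ t := fun t ht =>
    (le_max_left _ _).trans ((le_max_left _ _).trans ht)
  have hmY : ∀ t, t₀ ≤ t → Y + t / 2 < modelY B t - 1 ∧ t / 2 < modelY B t - 1 := fun t ht => by
    have h := ht₂ t ((le_max_right _ _).trans ((le_max_left _ _).trans ht))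
    exact ⟨by linarith [le_max_left Y 0], by linarith [le_max_right Y 0]⟩
  have hYm : ∀ t, t₀ ≤ t → Y < modelY B t - 1 := fun t ht => by
    linarith [(hmY t ht).1, h3 t ht]
  have hqb : ∀ y, Y ≤ y → |growthDeriv f y| ≤ 2 / y ^ 2 := fun y hy => by
    obtain ⟨a1, -, -, a4, a5, -⟩ := hY y hy
    rw [le_div_iff₀ (by positivity), ← abs_of_pos (show 0 < y ^ 2 by positivity), ← abs_mul,
      abs_le]
    constructor <;> nlinarith
  -- The weights in R₁ and R₂ are y and y², and y ≥ t/2. The square produces the factor 4; for the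
  -- defect 2 would do, but one constant serves both.
  have key : ∀ t, t₀ ≤ t → |defect (growth f) B t| ≤ 4 * supRem f B t / t ∧
      |growthDeriv f (modelY B t) * (t / (t + 1)) - modelPDeriv B t| ≤
        4 * supRem f B t / t ^ 2 := by
    intro t ht
    have ht3 := h3 t ht
    have ht0 : 0 < t := by linarith
    obtain ⟨x, hx⟩ := exists_norm_eq (Real.exp_pos (-t / 2)).le
    have hxt : logRad x = t := logRad_of_norm_eq hx
    have hx0 : 0 < ‖x‖ := by rw [hx]; exact Real.exp_pos _
    have hsup := hTle x hx0 (by rw [hxt]; exact hTt t ht)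
    have hy2 : t / 2 ≤ modelY B t := by linarith [(hmY t ht).2]
    have hy0 : 0 < modelY B t := by linarith
    have hyb : logInvBound f < modelY B t := (hY _ (by linarith [hYm t ht])).2.1
    have e1 := hf.R₁_eq hB (x := x) (by rw [hxt]; exact ht0) (by rw [hxt]; exact hy0)
      (by rw [hxt]; exact hyb)
    have e2 := hf.R₂_eq hB (x := x) (by rw [hxt]; exact ht0)
      (by rw [hxt]; exact modelP_ne_zero hB (by linarith)) (by rw [hxt]; exact hyb)
    have n1 : 0 ≤ R₁ f B x := abs_nonneg _
    have n2 : 0 ≤ R₂ f B x := abs_nonneg _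
    rw [hxt] at e1 e2 hsup
    constructor
    · rw [le_div_iff₀ ht0]
      have : t / 2 * |defect (growth f) B t| ≤ R₁ f B x := by
        rw [e1, defect]; gcongr
      have := abs_nonneg (defect (growth f) B t)
      linarith
    · rw [le_div_iff₀ (by positivity)]
      have : (t / 2) ^ 2 * 1 *
          |growthDeriv f (modelY B t) * (t / (t + 1)) - modelPDeriv B t| ≤ R₂ f B x := by
        rw [e2]
        gcongr
        rw [le_div_iff₀ ht0]; linarith
      linarith
  -- Q = 8 arises from |p'(y)| ≤ 2/y², valid since 1/B < 2, together with y ≥ t/2.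
  obtain ⟨M, t₁, φ, ψ, ht₀₁, hM, hsol⟩ := exists_perturbed_solution (p := growth f)
    (q := growthDeriv f) (ρ := supRem f B) (B := B) (Y := Y) (Q := 8) (C := 4) (t₀ := t₀) hB
    (by norm_num) (by norm_num) (by linarith [h3 t₀ le_rfl])
    (fun y hy => hf.hasDerivAt_growth hs₀ (hY y hy.le).2.1 (hY y hy.le).2.2.1)
    (fun y hy => hf.continuousAt_growthDeriv hs₀ (hY y hy.le).2.1 (hY y hy.le).2.2.1)
    hYm
    (fun t ht y hy => by
      have ht3 := h3 t ht
      have hyt : t / 2 ≤ y := by linarith [(hmY t ht).2]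
      refine (hqb y (by linarith [hYm t ht])).trans ?_
      calc 2 / y ^ 2 ≤ 2 / (t / 2) ^ 2 := by gcongr
        _ = 8 / t ^ 2 := by field_simp; norm_num)
    (hTanti.mono (Ici_subset_Ici.2 (hTt t₀ le_rfl)))
    (fun t _ => supRem_nonneg t) hR.tendsto_supRem (fun t ht => (key t ht).1)
    (fun t ht => (key t ht).2)
  have hge : ∀ t, t₁ < t → t₀ ≤ t := fun t ht => ht₀₁.trans ht.le
  have hφ1 : ∀ t, t₁ < t → |φ t| ≤ 1 := fun t ht => by
    obtain ⟨-, -, a3, -, a5⟩ := hsol t ht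
    exact a3.trans a5
  have hyφ : ∀ t, t₁ < t → Y + t / 2 < modelY B t + φ t := fun t ht => by
    linarith [(hmY t (hge t ht)).1, (abs_le.1 (hφ1 t ht)).1]
  have hyb : ∀ t, t₁ < t → logInvBound f < modelY B t + φ t := fun t ht =>
    (hY _ (by linarith [hyφ t ht, h3 t (hge t ht)])).2.1
  have hytop : Tendsto (fun t => modelY B t + φ t) atTop atTop := by
    refine tendsto_atTop_mono' atTop (f₁ := fun t => Y + t / 2) ?_
      (tendsto_atTop_add_const_left _ _ (tendsto_id.atTop_div_const (by norm_num)))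
    filter_upwards [eventually_gt_atTop t₁] with t ht using (hyφ t ht).le
  refine ⟨Real.exp 3 * M, t₁, fun t => logInv f (modelY B t + φ t),
    fun t => f (logInv f (modelY B t + φ t)) * Real.exp (-(modelY B t + φ t)) *
      (t / (t + 1) + ψ t), ?_, ?_, hf.tendsto_logInv.comp hytop, ?_, ?_⟩
  · linarith [h3 t₀ le_rfl]
  · intro t ht
    have ht0 : 0 < t := by linarith [h3 t (hge t ht)]
    obtain ⟨a1, a2, -⟩ := hsol t ht
    obtain ⟨c1, c2⟩ := hf.hasDerivAt_logInv_of_accel hB ht0 a1 a2 (hyb t ht)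
    exact ⟨c1, c2, hf.logInv_pos (hyb t ht)⟩
  · have hA := (hf.tendsto_amplitude h1 h2).comp hytop
    refine hA.zero_mul_isBoundedUnder_le ?_
    refine isBoundedUnder_of_eventually_le (a := 2) ?_
    filter_upwards [eventually_gt_atTop t₁] with t ht
    have ht3 := h3 t (hge t ht)
    obtain ⟨-, -, -, a4, a5⟩ := hsol t ht
    have h4 : |t / (t + 1)| ≤ 1 := by
      rw [abs_of_nonneg (by positivity), div_le_one (by linarith)]; linarith
    calc ‖t / (t + 1) + ψ t‖ ≤ |t / (t + 1)| + |ψ t| := abs_add_le _ _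
      _ ≤ 2 := by linarith
  · intro x hx hxt
    have ht3 := h3 _ (hge _ hxt)
    obtain ⟨-, -, a3, -, -⟩ := hsol _ hxt
    have hyx := hYm _ (hge _ hxt)
    have hyb' : logInvBound f < modelY B (logRad x) := (hY _ (by linarith)).2.1
    rw [uTilde_eq hB (by linarith), (hf.logInv_spec hyb').2]
    refine (hf.abs_logInv_sub_le (a := Y) (hY Y le_rfl).2.1
      (fun z hz => (hY z hz).2.2.2.2.2.le) (by linarith) (hφ1 _ hxt)).trans ?_
    have := hf.pos _ (hf.logInv_pos hyb')
    calc _ ≤ Real.exp 3 * (f (logInv f (modelY B (logRad x))) *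
          Real.exp (-modelY B (logRad x))) * (M * supRem f B (logRad x)) := by gcongr
      _ = _ := by ring

end NearOrigin

/-! ### Backward continuation to the first zero. -/

section Continuation

theorem abs_clamp_sub_le (l u x y : ℝ) : |max l (min x u) - max l (min y u)| ≤ |x - y| := by
  have h1 := abs_max_sub_max_le_abs (min x u) (min y u) l
  have h2 := abs_min_sub_min_le_max x u y u
  rw [max_comm l, max_comm l]
  refine h1.trans (h2.trans ?_)
  simp

/-- Solve `x'' = -e^{-t} f(x) / 4` backwards from `t₂`, with `f` frozen outside `[0, u]`. -/
theorem exists_backward_solution {f : ℝ → ℝ} {u w t₂ a m : ℝ} {K : NNReal} (hu : 0 ≤ u)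
    (hf : LipschitzOnWith K f (Icc 0 u)) (hf0 : ∀ s ∈ Icc 0 u, 0 ≤ f s)
    (hfm : ∀ s ∈ Icc 0 u, f s ≤ m) (hw : 0 < w) (ha : a ≤ t₂) :
    ∃ x y : ℝ → ℝ, x t₂ = u ∧ y t₂ = w ∧ ∀ t ∈ Icc a t₂,
      HasDerivWithinAt x (y t) (Icc a t₂) t ∧
      HasDerivWithinAt y (-(Real.exp (-t) / 4 * f (max 0 (min (x t) u)))) (Icc a t₂) t ∧
      w ≤ y t := by
  have hclamp : ∀ x : ℝ, max 0 (min x u) ∈ Icc 0 u := fun x =>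
    ⟨le_max_left _ _, max_le hu (min_le_right _ _)⟩
  have hm : 0 ≤ m := (hf0 0 ⟨le_rfl, hu⟩).trans (hfm 0 ⟨le_rfl, hu⟩)
  set c := Real.exp (-a) / 4 with hc
  have hc0 : 0 < c := by positivity
  have hct : ∀ t ∈ Icc a t₂, Real.exp (-t) / 4 ≤ c := fun t ht => by
    rw [hc]; gcongr; exact ht.1
  -- Going backwards the velocity increases at rate at most cm, so W is an a priori upper bound on
  -- the whole interval.
  set W := w + c * m * (t₂ - a) with hW
  have hcm : 0 ≤ c * m := by positivity
  have hW0 : 0 ≤ W := by have := mul_nonneg hcm (sub_nonneg.2 ha); linarith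
  -- Clamping the velocity as well makes the field bounded and globally Lipschitz, so that
  -- Picard–Lindelöf covers [a, t₂] in one step. The bounds in `hrange` show afterwards that this
  -- second clamp is never active.
  let v : ℝ → ℝ × ℝ → ℝ × ℝ := fun t z =>
    (max 0 (min z.2 W), -(Real.exp (-t) / 4 * f (max 0 (min z.1 u))))
  let L : NNReal := ⟨W + c * m, by positivity⟩
  let A : NNReal := ⟨(W + c * m) * (t₂ - a), mul_nonneg (by positivity) (sub_nonneg.2 ha)⟩
  let K' : NNReal := ⟨1 + c * K, by positivity⟩
  have hPL : IsPicardLindelof v (tmin := a) (tmax := t₂) ⟨t₂, right_mem_Icc.2 ha⟩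
      ((u, w) : ℝ × ℝ) A 0 L K' := by
    refine ⟨fun t ht => ?_, fun z _ => ?_, fun t ht z _ => ?_, ?_⟩
    · refine LipschitzWith.lipschitzOnWith (LipschitzWith.of_dist_le_mul fun z z' => ?_)
      have h1 : |z.1 - z'.1| ≤ dist z z' := by
        rw [← Real.dist_eq, Prod.dist_eq]; exact le_max_left _ _
      have h2 : |z.2 - z'.2| ≤ dist z z' := by
        rw [← Real.dist_eq, Prod.dist_eq]; exact le_max_right _ _
      have hd := dist_nonneg (x := z) (y := z')
      have hK : (K' : ℝ) = 1 + c * K := rfl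
      rw [Prod.dist_eq, hK]
      refine max_le ?_ ?_
      · simp only [v, Real.dist_eq]
        have h3 := abs_clamp_sub_le 0 W z.2 z'.2
        have : 0 ≤ c * K * dist z z' := by positivity
        linarith
      · simp only [v, Real.dist_eq]
        have h3 := hf.dist_le_mul _ (hclamp z.1) _ (hclamp z'.1)
        rw [Real.dist_eq, Real.dist_eq] at h3
        have h4 := abs_clamp_sub_le 0 u z.1 z'.1
        have h5 : -(Real.exp (-t) / 4 * f (max 0 (min z.1 u))) -
            -(Real.exp (-t) / 4 * f (max 0 (min z'.1 u))) =
            -(Real.exp (-t) / 4 * (f (max 0 (min z.1 u)) - f (max 0 (min z'.1 u)))) := by ring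
        rw [h5, abs_neg, abs_mul, abs_of_pos (by positivity)]
        calc _ ≤ c * (K * dist z z') := by
              have := hct t ht
              gcongr
              refine h3.trans ?_
              gcongr
              exact h4.trans h1
          _ ≤ (1 + c * K) * dist z z' := by linarith
    · exact Continuous.continuousOn (by fun_prop)
    · have hL : (L : ℝ) = W + c * m := rfl
      rw [hL, Prod.norm_def]
      refine max_le ?_ ?_
      · simp only [v]
        rw [Real.norm_of_nonneg (le_max_left _ _)]
        have : max 0 (min z.2 W) ≤ W := max_le hW0 (min_le_right _ _)
        linarith
      · simp only [v]
        have h1 := hf0 _ (hclamp z.1)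
        have h2 := hfm _ (hclamp z.1)
        rw [norm_neg, Real.norm_of_nonneg (by positivity)]
        have := hct t ht
        calc _ ≤ c * m := by gcongr
          _ ≤ _ := by linarith
    · have h1 : (A : ℝ) = (W + c * m) * (t₂ - a) := rfl
      have h2 : (L : ℝ) = W + c * m := rfl
      rw [h1, h2]
      simp [sub_nonneg.2 ha]
  obtain ⟨α, hα0, hα⟩ := hPL.exists_eq_forall_mem_Icc_hasDerivWithinAt₀
  have hα0' : α t₂ = (u, w) := hα0
  have hx : ∀ t ∈ Icc a t₂, HasDerivWithinAt (fun t => (α t).1)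
      (max 0 (min (α t).2 W)) (Icc a t₂) t := fun t ht =>
    (ContinuousLinearMap.fst ℝ ℝ ℝ).hasFDerivAt.comp_hasDerivWithinAt t (hα t ht)
  have hy : ∀ t ∈ Icc a t₂, HasDerivWithinAt (fun t => (α t).2)
      (-(Real.exp (-t) / 4 * f (max 0 (min (α t).1 u)))) (Icc a t₂) t := fun t ht =>
    (ContinuousLinearMap.snd ℝ ℝ ℝ).hasFDerivAt.comp_hasDerivWithinAt t (hα t ht)
  have hrange : ∀ t ∈ Icc a t₂, w ≤ (α t).2 ∧ (α t).2 ≤ W := by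
    intro t ht
    have hanti : AntitoneOn (fun t => (α t).2) (Icc a t₂) := by
      refine antitoneOn_of_hasDerivWithinAt_nonpos (convex_Icc a t₂)
        (f' := fun t => -(Real.exp (-t) / 4 * f (max 0 (min (α t).1 u))))
        (fun t ht => (hy t ht).continuousWithinAt)
        (fun t ht => (hy t (interior_subset ht)).mono interior_subset) fun t ht => ?_
      have := hf0 _ (hclamp (α t).1)
      have : 0 ≤ Real.exp (-t) / 4 * f (max 0 (min (α t).1 u)) := by positivity
      linarith
    have hmono : MonotoneOn (fun t => (α t).2 + c * m * t) (Icc a t₂) := by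
      have hd : ∀ t ∈ Icc a t₂, HasDerivWithinAt (fun t => (α t).2 + c * m * t)
          (-(Real.exp (-t) / 4 * f (max 0 (min (α t).1 u))) + c * m * 1) (Icc a t₂) t :=
        fun t ht => (hy t ht).add ((hasDerivWithinAt_id t _).const_mul (c * m))
      refine monotoneOn_of_hasDerivWithinAt_nonneg (convex_Icc a t₂)
        (f' := fun t => -(Real.exp (-t) / 4 * f (max 0 (min (α t).1 u))) + c * m * 1)
        (fun t ht => (hd t ht).continuousWithinAt)
        (fun t ht => (hd t (interior_subset ht)).mono interior_subset) fun t ht => ?_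
      have h1 := hf0 _ (hclamp (α t).1)
      have h2 := hfm _ (hclamp (α t).1)
      have h3 := hct t (interior_subset ht)
      have : Real.exp (-t) / 4 * f (max 0 (min (α t).1 u)) ≤ c * m := by gcongr
      linarith
    have e1 := hanti ht (right_mem_Icc.2 ha) ht.2
    have e2 := hmono ht (right_mem_Icc.2 ha) ht.2
    simp only [hα0'] at e1 e2
    refine ⟨e1, ?_⟩
    have : c * m * (t₂ - t) ≤ c * m * (t₂ - a) := by gcongr; exact ht.1
    linarith
  refine ⟨fun t => (α t).1, fun t => (α t).2, by simp [hα0'], by simp [hα0'], fun t ht =>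
    ⟨?_, hy t ht, (hrange t ht).1⟩⟩
  have h := hx t ht
  rwa [min_eq_left (hrange t ht).2, max_eq_right (hw.le.trans (hrange t ht).1)] at h

theorem hasDerivAt_ite_le {x y : ℝ → ℝ} {d c : ℝ} (hx : HasDerivWithinAt x d (Iic c) c)
    (hy : HasDerivAt y d c) (hxy : x c = y c) :
    HasDerivAt (fun t => if t ≤ c then x t else y t) d c := by
  have h1 : HasDerivWithinAt (fun t => if t ≤ c then x t else y t) d (Iic c) c :=
    hx.congr (fun t ht => if_pos ht) (if_pos le_rfl)
  have h2 : HasDerivWithinAt (fun t => if t ≤ c then x t else y t) d (Ici c) c := by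
    refine hy.hasDerivWithinAt.congr (fun t ht => ?_) (by simp [hxy])
    rcases eq_or_lt_of_le (show c ≤ t from ht) with rfl | h
    · simp [hxy]
    · simp [not_le.2 h]
  have := h1.union h2
  rwa [Iic_union_Ici, hasDerivWithinAt_univ] at this

/-- A solution of `U'' = -e^{-t} f(U) / 4` which is positive and tends to infinity is increasing. -/
theorem Admissible.deriv_pos_of_tendsto {f : ℝ → ℝ} (hf : Admissible f) {t₁ : ℝ} {U U' : ℝ → ℝ}
    (hU : ∀ t, t₁ < t → HasDerivAt U (U' t) t ∧
      HasDerivAt U' (-(Real.exp (-t) / 4 * f (U t))) t ∧ 0 < U t)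
    (hlim : Tendsto U atTop atTop) {t : ℝ} (ht : t₁ < t) : 0 < U' t := by
  by_contra hcon
  -- U is concave because f > 0. A nonpositive slope at one point would persist and prevent U → ∞.
  have hanti : AntitoneOn U' (Ioi t₁) := by
    refine antitoneOn_of_deriv_nonpos (convex_Ioi t₁)
      (fun s hs => (hU s hs).2.1.continuousAt.continuousWithinAt)
      (fun s hs => (hU s (interior_subset hs)).2.1.differentiableAt.differentiableWithinAt)
      fun s hs => ?_
    obtain ⟨-, h2, h3⟩ := hU s (interior_subset hs)
    have := hf.pos _ h3
    rw [h2.deriv]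
    have : 0 < Real.exp (-s) / 4 * f (U s) := by positivity
    linarith
  have hUanti : AntitoneOn U (Ici t) := by
    refine antitoneOn_of_deriv_nonpos (convex_Ici t)
      (fun s hs => (hU s (ht.trans_le hs)).1.continuousAt.continuousWithinAt)
      (fun s hs => (hU s (ht.trans_le
        (interior_subset hs))).1.differentiableAt.differentiableWithinAt)
      fun s hs => ?_
    have hs' : t ≤ s := interior_subset hs
    rw [(hU s (ht.trans_le hs')).1.deriv]
    exact (hanti ht (ht.trans_le hs') hs').trans (not_lt.1 hcon)
  obtain ⟨s, hs, hst⟩ := ((hlim.eventually_gt_atTop (U t)).and (eventually_ge_atTop t)).exists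
  have := hUanti self_mem_Ici hst hst
  linarith

theorem Admissible.monotoneOn {f : ℝ → ℝ} (hf : Admissible f) : MonotoneOn f (Ici 0) := by
  refine monotoneOn_of_deriv_nonneg (convex_Ici 0) hf.contDiffOn.continuousOn ?_ ?_
  · intro s hs
    rw [interior_Ici] at hs
    exact (hf.hasDerivAt hs).differentiableAt.differentiableWithinAt
  · intro s hs
    rw [interior_Ici] at hs
    exact (hf.deriv_pos s hs).le

theorem Admissible.zero_nonneg {f : ℝ → ℝ} (hf : Admissible f) : 0 ≤ f 0 := by
  have h : Tendsto f (𝓝[>] 0) (𝓝 (f 0)) :=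
    (hf.contDiffOn.continuousOn 0 self_mem_Ici).mono_left (nhdsWithin_mono 0 Ioi_subset_Ici_self)
  refine ge_of_tendsto h ?_
  filter_upwards [self_mem_nhdsWithin] with s hs using (hf.pos s hs).le

/-- A singular solution near `t = ∞` extends backwards until it vanishes. -/
theorem Admissible.exists_extension {f : ℝ → ℝ} (hf : Admissible f) {t₁ : ℝ} {U U' : ℝ → ℝ}
    (hU : ∀ t, t₁ < t → HasDerivAt U (U' t) t ∧
      HasDerivAt U' (-(Real.exp (-t) / 4 * f (U t))) t ∧ 0 < U t)
    (hlim : Tendsto U atTop atTop) :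
    ∃ (τ t₂ : ℝ) (V V' : ℝ → ℝ), τ < t₂ ∧ (∀ t, t₂ < t → V t = U t ∧ V' t = U' t) ∧
      (∀ t, τ < t → HasDerivAt V (V' t) t ∧
        HasDerivAt V' (-(Real.exp (-t) / 4 * f (V t))) t ∧ 0 < V t) ∧
      ContinuousOn V (Ici τ) ∧ V τ = 0 := by
  set t₂ := t₁ + 1 with ht₂
  have ht₁₂ : t₁ < t₂ := by linarith
  have hu : 0 < U t₂ := (hU t₂ ht₁₂).2.2
  have hw : 0 < U' t₂ := hf.deriv_pos_of_tendsto hU hlim ht₁₂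
  -- By concavity the tangent at t₂ lies above the solution, and its zero is t₂ - U/U'. The extra 1
  -- makes x(a) strictly negative, hence a < τ.
  set a := t₂ - U t₂ / U' t₂ - 1 with ha
  have hat : a < t₂ := by have : 0 < U t₂ / U' t₂ := by positivity
                          linarith
  obtain ⟨K, hK⟩ := (hf.contDiffOn.mono (fun s hs => hs.1 : Icc 0 (U t₂) ⊆ Ici 0)).exists_lipschitzOnWith
    one_ne_zero (convex_Icc 0 (U t₂)) isCompact_Icc
  obtain ⟨x, y, hx0, hy0, hxy⟩ := exists_backward_solution (m := f (U t₂)) hu.le hK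
    (fun s hs => hf.zero_nonneg.trans (hf.monotoneOn self_mem_Ici hs.1 hs.1))
    (fun s hs => hf.monotoneOn hs.1 hu.le hs.2) hw hat.le
  have hxc : ContinuousOn x (Icc a t₂) := fun t ht => (hxy t ht).1.continuousWithinAt
  have hxmono : StrictMonoOn x (Icc a t₂) := by
    refine strictMonoOn_of_hasDerivWithinAt_pos (convex_Icc a t₂) hxc (f' := y)
      (fun t ht => (hxy t (interior_subset ht)).1.mono interior_subset)
      fun t ht => hw.trans_le (hxy t (interior_subset ht)).2.2
  have hxa : x a < 0 := by
    have hmono : MonotoneOn (fun t => x t - U' t₂ * t) (Icc a t₂) := by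
      have hd : ∀ t ∈ Icc a t₂, HasDerivWithinAt (fun t => x t - U' t₂ * t)
          (y t - U' t₂ * 1) (Icc a t₂) t :=
        fun t ht => (hxy t ht).1.sub ((hasDerivWithinAt_id t _).const_mul (U' t₂))
      refine monotoneOn_of_hasDerivWithinAt_nonneg (convex_Icc a t₂)
        (f' := fun t => y t - U' t₂ * 1)
        (fun t ht => (hd t ht).continuousWithinAt)
        (fun t ht => (hd t (interior_subset ht)).mono interior_subset) fun t ht => ?_
      have := (hxy t (interior_subset ht)).2.2
      linarith
    have h := hmono (left_mem_Icc.2 hat.le) (right_mem_Icc.2 hat.le) hat.le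
    simp only [hx0] at h
    have h2 : U' t₂ * (t₂ - a) = U t₂ + U' t₂ := by rw [ha]; field_simp; ring
    linarith
  obtain ⟨τ, hτ, hxτ⟩ := intermediate_value_Icc hat.le hxc
    (show (0 : ℝ) ∈ Icc (x a) (x t₂) from ⟨hxa.le, by rw [hx0]; exact hu.le⟩)
  have haτ : a < τ := by
    rcases eq_or_lt_of_le hτ.1 with h | h
    · rw [h, hxτ] at hxa; exact absurd hxa (lt_irrefl _)
    · exact h
  have hτt : τ < t₂ := by
    rcases eq_or_lt_of_le hτ.2 with h | h
    · rw [h, hx0] at hxτ; linarith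
    · exact h
  have hxr : ∀ t, τ < t → t ≤ t₂ → 0 < x t ∧ x t ≤ U t₂ := fun t h1 h2 => by
    have hmem : t ∈ Icc a t₂ := ⟨haτ.le.trans h1.le, h2⟩
    refine ⟨hxτ ▸ hxmono hτ hmem h1, ?_⟩
    rw [← hx0]
    exact hxmono.monotoneOn hmem (right_mem_Icc.2 hat.le) h2
  -- Between τ and t₂ the solution stays in (0, U t₂], so the clamp on x is inactive and the true
  -- equation holds.
  have hxy' : ∀ t, τ < t → t ≤ t₂ → HasDerivWithinAt x (y t) (Icc a t₂) t ∧
      HasDerivWithinAt y (-(Real.exp (-t) / 4 * f (x t))) (Icc a t₂) t := fun t h1 h2 => by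
    obtain ⟨b1, b2⟩ := hxr t h1 h2
    obtain ⟨c1, c2, -⟩ := hxy t ⟨haτ.le.trans h1.le, h2⟩
    rw [min_eq_left b2, max_eq_right b1.le] at c2
    exact ⟨c1, c2⟩
  have hIic : Icc a t₂ ∈ 𝓝[Iic t₂] t₂ := by
    rw [← Ici_inter_Iic, inter_comm]
    exact inter_mem_nhdsWithin _ (Ici_mem_nhds hat)
  refine ⟨τ, t₂, fun t => if t ≤ t₂ then x t else U t, fun t => if t ≤ t₂ then y t else U' t,
    hτt, fun t ht => by simp [not_le.2 ht], fun t ht => ?_, ?_, by simp [hτ.2, hxτ]⟩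
  · rcases lt_trichotomy t t₂ with h | rfl | h
    · obtain ⟨c1, c2⟩ := hxy' t ht h.le
      have hn : Icc a t₂ ∈ 𝓝 t := Icc_mem_nhds (haτ.trans ht) h
      have he : ∀ᶠ s in 𝓝 t, s ≤ t₂ := (gt_mem_nhds h).mono fun s hs => le_of_lt hs
      simp only [if_pos h.le]
      refine ⟨(c1.hasDerivAt hn).congr_of_eventuallyEq ?_,
        (c2.hasDerivAt hn).congr_of_eventuallyEq ?_, (hxr t ht h.le).1⟩
      · filter_upwards [he] with s hs using if_pos hs
      · filter_upwards [he] with s hs using if_pos hs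
    · obtain ⟨c1, c2⟩ := hxy' t₂ ht le_rfl
      obtain ⟨d1, d2, d3⟩ := hU t₂ ht₁₂
      simp only [le_refl, if_true, hx0, hy0]
      refine ⟨hasDerivAt_ite_le ?_ d1 hx0, hasDerivAt_ite_le ?_ d2 hy0, d3⟩
      · rw [← hy0]; exact c1.mono_of_mem_nhdsWithin hIic
      · rw [hx0] at c2; exact c2.mono_of_mem_nhdsWithin hIic
    · obtain ⟨d1, d2, d3⟩ := hU t (ht₁₂.trans h)
      simp only [if_neg (not_le.2 h)]
      refine ⟨d1.congr_of_eventuallyEq ?_, d2.congr_of_eventuallyEq ?_, d3⟩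
      · filter_upwards [lt_mem_nhds h] with s hs using if_neg (not_le.2 hs)
      · filter_upwards [lt_mem_nhds h] with s hs using if_neg (not_le.2 hs)
  · have h1 : ContinuousOn (fun t => if t ≤ t₂ then x t else U t) (Icc a t₂) :=
      hxc.congr fun t ht => if_pos ht.2
    intro t ht
    rcases lt_or_ge t t₂ with h | h
    · have hn : Icc a t₂ ∈ 𝓝 t := Icc_mem_nhds (haτ.trans_le ht) h
      exact (h1.continuousAt hn).continuousWithinAt
    · rcases eq_or_lt_of_le h with rfl | h
      · obtain ⟨c1, -⟩ := hxy' t₂ hτt le_rfl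
        obtain ⟨d1, -⟩ := hU t₂ ht₁₂
        refine (hasDerivAt_ite_le (d := U' t₂) ?_ d1 hx0).continuousAt.continuousWithinAt
        rw [← hy0]; exact c1.mono_of_mem_nhdsWithin hIic
      · obtain ⟨d1, -⟩ := hU t (ht₁₂.trans h)
        refine (d1.continuousAt.congr ?_).continuousWithinAt
        filter_upwards [lt_mem_nhds h] with s hs using (if_neg (not_le.2 hs)).symm

end Continuation

/-! ### The Laplacian of functions of |x|², which is smooth at the origin. -/

section RadialLaplacian

theorem laplacian_eq_sum_fderiv {ι : Type*} [Fintype ι] (b : OrthonormalBasis ι ℝ Plane)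
    {g : Plane → ℝ} {x : Plane} (hg : ContDiffAt ℝ 2 g x) :
    (Δ g) x = ∑ i, fderiv ℝ (fun y => fderiv ℝ g y (b i)) x (b i) := by
  rw [InnerProductSpace.laplacian_eq_iteratedFDeriv_orthonormalBasis g b]
  refine Finset.sum_congr rfl fun i _ => ?_
  rw [iteratedFDeriv_two_apply]
  have hd : DifferentiableAt ℝ (fderiv ℝ g) x :=
    (hg.fderiv_right (m := 1) (by norm_num)).differentiableAt (by simp)
  rw [fderiv_clm_apply hd (differentiableAt_const _)]
  simp

/-- The Laplacian in the plane of a function of `|x|²`. -/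
theorem laplacian_comp_normSq {w : ℝ → ℝ} {x : Plane} (hw : ContDiffAt ℝ 2 w (‖x‖ ^ 2)) :
    (Δ fun y : Plane => w (‖y‖ ^ 2)) x =
      4 * ‖x‖ ^ 2 * deriv (deriv w) (‖x‖ ^ 2) + 4 * deriv w (‖x‖ ^ 2) := by
  have hN : ∀ y : Plane, HasFDerivAt (fun y : Plane => ‖y‖ ^ 2) (2 • innerSL ℝ y) y := fun y =>
    (hasStrictFDerivAt_norm_sq y).hasFDerivAt
  have hg : ContDiffAt ℝ 2 (fun y : Plane => w (‖y‖ ^ 2)) x :=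
    hw.comp x (contDiff_norm_sq ℝ).contDiffAt
  have hev : ∀ᶠ y : Plane in 𝓝 x, ContDiffAt ℝ 2 w (‖y‖ ^ 2) :=
    (hN x).continuousAt.eventually (hw.eventually (by simp))
  have hw2 : HasDerivAt (deriv w) (deriv (deriv w) (‖x‖ ^ 2)) (‖x‖ ^ 2) := by
    have h1 : ContDiffAt ℝ 1 (deriv w) (‖x‖ ^ 2) := by
      have := hw.fderiv_right (m := 1) (by norm_num)
      exact this.clm_apply contDiffAt_const
    exact (h1.differentiableAt (by simp)).hasDerivAt
  have hfd : ∀ e : Plane, (fun y : Plane => fderiv ℝ (fun y : Plane => w (‖y‖ ^ 2)) y e)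
      =ᶠ[𝓝 x] fun y => deriv w (‖y‖ ^ 2) * (2 * inner ℝ y e) := fun e => by
    filter_upwards [hev] with y hy
    have h1 : HasDerivAt w (deriv w (‖y‖ ^ 2)) (‖y‖ ^ 2) :=
      (hy.differentiableAt (by simp)).hasDerivAt
    have h2 : HasFDerivAt (fun y : Plane => w (‖y‖ ^ 2)) _ y := h1.comp_hasFDerivAt y (hN y)
    rw [h2.fderiv]
    simp
  have hsecond : ∀ e : Plane, fderiv ℝ (fun y : Plane =>
      fderiv ℝ (fun y : Plane => w (‖y‖ ^ 2)) y e) x e =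
      4 * deriv (deriv w) (‖x‖ ^ 2) * inner ℝ x e ^ 2 +
        2 * deriv w (‖x‖ ^ 2) * inner ℝ e e := fun e => by
    rw [(hfd e).fderiv_eq]
    have h1 := hw2.comp_hasFDerivAt x (hN x)
    have h2 : HasFDerivAt (fun y : Plane => 2 * inner ℝ y e) ((2 : ℝ) • innerSL ℝ e) x := by
      have h3 : HasFDerivAt (fun y : Plane => inner ℝ e y) (innerSL ℝ e) x :=
        (innerSL ℝ e).hasFDerivAt
      have h4 := h3.const_mul 2
      simp_rw [real_inner_comm e] at h4 ⊢
      exact h4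
    have h3 : HasFDerivAt (fun y : Plane => deriv w (‖y‖ ^ 2) * (2 * inner ℝ y e)) _ x :=
      h1.mul h2
    rw [h3.fderiv]
    simp [real_inner_comm e x]
    ring
  set b := EuclideanSpace.basisFun (Fin 2) ℝ with hb
  rw [laplacian_eq_sum_fderiv b hg]
  simp_rw [hsecond]
  rw [Finset.sum_add_distrib, ← Finset.mul_sum, ← Finset.mul_sum]
  have e1 : ∑ i, inner ℝ x (b i) ^ 2 = ‖x‖ ^ 2 := by
    rw [← b.sum_sq_norm_inner_left x]
    simp
  have e2 : ∑ i, inner ℝ (b i) (b i) = (2 : ℝ) := by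
    simp
  rw [e1, e2]
  ring

end RadialLaplacian

/-! ### Green's identity against a test function. -/

section IntegrationByParts

/-- The product vanishes near every point outside the support of ψ, so it is continuous on the whole
plane however h behaves off Ω. -/
theorem integrable_mul_of_tsupport_subset {h ψ : Plane → ℝ} {Ω : Set Plane} (hΩ : IsOpen Ω)
    (hh : ContinuousOn h Ω) (hψ : Continuous ψ) (hc : HasCompactSupport ψ)
    (hs : tsupport ψ ⊆ Ω) : Integrable fun x => h x * ψ x := by
  have hcont : Continuous fun x => h x * ψ x := by
    refine continuous_iff_continuousAt.2 fun x => ?_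
    by_cases hx : x ∈ tsupport ψ
    · exact (hh.continuousAt (hΩ.mem_nhds (hs hx))).mul hψ.continuousAt
    · have : (fun x => h x * ψ x) =ᶠ[𝓝 x] fun _ => 0 := by
        filter_upwards [(isClosed_tsupport ψ).isOpen_compl.mem_nhds hx] with y hy
        rw [image_eq_zero_of_notMem_tsupport hy, mul_zero]
      exact continuousAt_const.congr this.symm
  exact hcont.integrable_of_hasCompactSupport hc.mul_left

theorem tsupport_fderiv_const_apply_subset (φ : Plane → ℝ) (e : Plane) :
    tsupport (fun x => fderiv ℝ φ x e) ⊆ tsupport φ :=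
  (closure_mono fun x hx => by
    rw [Function.mem_support] at hx ⊢
    intro h0
    exact hx (by rw [h0]; simp)).trans (tsupport_fderiv_subset ℝ (f := φ))

/-- Green's second identity on an open set, for a compactly supported test function. -/
theorem integral_mul_laplacian {g φ : Plane → ℝ} {Ω : Set Plane} (hΩ : IsOpen Ω)
    (hg : ContDiffOn ℝ 2 g Ω) (hφ : ContDiff ℝ (⊤ : ℕ∞) φ) (hc : HasCompactSupport φ)
    (hs : tsupport φ ⊆ Ω) :
    Integrable (fun x => (Δ g) x * φ x) ∧
      ∫ x, g x * (Δ φ) x = ∫ x, (Δ g) x * φ x := by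
  set b := EuclideanSpace.basisFun (Fin 2) ℝ with hb
  have hφ2 : ContDiff ℝ 2 φ := contDiff_infty.1 hφ 2
  have hgat : ∀ x ∈ Ω, ContDiffAt ℝ 2 g x := fun x hx => hg.contDiffAt (hΩ.mem_nhds hx)
  have hφe : ∀ e : Plane, ContDiff ℝ 1 (fun x => fderiv ℝ φ x e) := fun e =>
    (hφ2.fderiv_right (m := 1) (by norm_num)).clm_apply contDiff_const
  have hφee : ∀ e : Plane, Continuous (fun x => fderiv ℝ (fun y => fderiv ℝ φ y e) x e) :=
    fun e => ((hφe e).fderiv_right (m := 0) (by norm_num)).continuous.clm_apply continuous_const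
  have hge : ∀ e : Plane, ∀ x ∈ Ω, ContDiffAt ℝ 1 (fun x => fderiv ℝ g x e) x := fun e x hx =>
    ((hgat x hx).fderiv_right (m := 1) (by norm_num)).clm_apply contDiffAt_const
  have hgee : ∀ e : Plane, ContinuousOn (fun x => fderiv ℝ (fun y => fderiv ℝ g y e) x e) Ω :=
    fun e x hx => (((hge e x hx).fderiv_right (m := 0)
      (by norm_num)).continuousAt.clm_apply continuousAt_const).continuousWithinAt
  have hs1 : ∀ e : Plane, tsupport (fun x => fderiv ℝ φ x e) ⊆ tsupport φ :=
    tsupport_fderiv_const_apply_subset φ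
  have hs2 : ∀ e : Plane,
      tsupport (fun x => fderiv ℝ (fun y => fderiv ℝ φ y e) x e) ⊆ tsupport φ := fun e =>
    (tsupport_fderiv_const_apply_subset _ e).trans (hs1 e)
  have hc1 : ∀ e : Plane, HasCompactSupport (fun x => fderiv ℝ φ x e) := fun e =>
    hc.mono' (subset_tsupport _ |>.trans (hs1 e))
  have hc2 : ∀ e : Plane, HasCompactSupport (fun x => fderiv ℝ (fun y => fderiv ℝ φ y e) x e) :=
    fun e => hc.mono' (subset_tsupport _ |>.trans (hs2 e))
  have i0 : ∀ e : Plane, Integrable fun x =>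
      g x * fderiv ℝ (fun y => fderiv ℝ φ y e) x e := fun e =>
    integrable_mul_of_tsupport_subset hΩ hg.continuousOn (hφee e) (hc2 e) ((hs2 e).trans hs)
  have i1 : ∀ e : Plane, Integrable fun x => g x * fderiv ℝ φ x e := fun e =>
    integrable_mul_of_tsupport_subset hΩ hg.continuousOn (hφe e).continuous (hc1 e)
      ((hs1 e).trans hs)
  have hgec : ∀ e : Plane, ContinuousOn (fun x => fderiv ℝ g x e) Ω := fun e x hx =>
    (hge e x hx).continuousAt.continuousWithinAt
  have i2 : ∀ e : Plane, Integrable fun x => fderiv ℝ g x e * fderiv ℝ φ x e := fun e =>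
    integrable_mul_of_tsupport_subset hΩ (hgec e) (hφe e).continuous (hc1 e) ((hs1 e).trans hs)
  have i3 : ∀ e : Plane, Integrable fun x => fderiv ℝ g x e * φ x := fun e =>
    integrable_mul_of_tsupport_subset hΩ (hgec e) hφ.continuous hc hs
  have i4 : ∀ e : Plane, Integrable fun x =>
      fderiv ℝ (fun y => fderiv ℝ g y e) x e * φ x := fun e =>
    integrable_mul_of_tsupport_subset hΩ (hgee e) hφ.continuous hc hs
  have hparts : ∀ e : Plane, ∫ x, g x * fderiv ℝ (fun y => fderiv ℝ φ y e) x e =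
      ∫ x, fderiv ℝ (fun y => fderiv ℝ g y e) x e * φ x := fun e => by
    rw [integral_mul_fderiv_eq_neg_fderiv_mul_of_integrable (i2 e) (i0 e) (i1 e)
      (fun x hx => (hgat x (hs (hs1 e hx))).differentiableAt (by simp))
      (fun x _ => (hφe e).contDiffAt.differentiableAt (by simp)),
      integral_mul_fderiv_eq_neg_fderiv_mul_of_integrable (i4 e) (i2 e) (i3 e)
      (fun x hx => (hge e x (hs hx)).differentiableAt (by simp))
      (fun x _ => hφ2.contDiffAt.differentiableAt (by simp)), neg_neg]
  have hΔφ : ∀ x, g x * (Δ φ) x =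
      ∑ i, g x * fderiv ℝ (fun y => fderiv ℝ φ y (b i)) x (b i) := fun x => by
    rw [laplacian_eq_sum_fderiv b hφ2.contDiffAt, Finset.mul_sum]
  have hΔg : ∀ x, (Δ g) x * φ x =
      ∑ i, fderiv ℝ (fun y => fderiv ℝ g y (b i)) x (b i) * φ x := fun x => by
    by_cases hx : x ∈ tsupport φ
    · rw [laplacian_eq_sum_fderiv b (hgat x (hs hx)), Finset.sum_mul]
    · simp [image_eq_zero_of_notMem_tsupport hx]
  simp_rw [hΔφ, hΔg]
  refine ⟨integrable_finsetSum _ fun i _ => i4 (b i), ?_⟩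
  rw [integral_finsetSum _ fun i _ => i0 (b i), integral_finsetSum _ fun i _ => i4 (b i)]
  exact Finset.sum_congr rfl fun i _ => hparts (b i)

end IntegrationByParts

/-! ### The Laplacian in the variable t. -/

section LogRadial

theorem contDiffOn_two_of_hasDerivAt {V V' V'' : ℝ → ℝ} {s : Set ℝ} (hs : IsOpen s)
    (h1 : ∀ t ∈ s, HasDerivAt V (V' t) t) (h2 : ∀ t ∈ s, HasDerivAt V' (V'' t) t)
    (h3 : ContinuousOn V'' s) : ContDiffOn ℝ 2 V s := by
  have e1 : ContDiffOn ℝ 1 V' s := by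
    refine (contDiffOn_succ_iff_deriv_of_isOpen (n := 0) hs).2
      ⟨fun t ht => (h2 t ht).differentiableAt.differentiableWithinAt, by simp, ?_⟩
    exact contDiffOn_zero.2 (h3.congr fun t ht => (h2 t ht).deriv)
  have e2 : ContDiffOn ℝ (1 + 1) V s :=
    (contDiffOn_succ_iff_deriv_of_isOpen (n := 1) hs).2
      ⟨fun t ht => (h1 t ht).differentiableAt.differentiableWithinAt, by simp,
        e1.congr fun t ht => (h1 t ht).deriv⟩
  simpa [one_add_one_eq_two] using e2

variable {V V' V'' : ℝ → ℝ} {τ : ℝ}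

theorem contDiffAt_comp_neg_log (h1 : ∀ t ∈ Ioi τ, HasDerivAt V (V' t) t)
    (h2 : ∀ t ∈ Ioi τ, HasDerivAt V' (V'' t) t) (h3 : ContinuousOn V'' (Ioi τ)) {q : ℝ}
    (hq : 0 < q) (hqτ : τ < -Real.log q) : ContDiffAt ℝ 2 (fun q => V (-Real.log q)) q :=
  ContDiffAt.comp q ((contDiffOn_two_of_hasDerivAt isOpen_Ioi h1 h2 h3).contDiffAt
    (Ioi_mem_nhds hqτ)) (contDiffAt_id.log hq.ne').neg

/-- The Laplacian in the plane of a function of `-log |x|²`. -/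
theorem laplacian_comp_neg_log (h1 : ∀ t ∈ Ioi τ, HasDerivAt V (V' t) t)
    (h2 : ∀ t ∈ Ioi τ, HasDerivAt V' (V'' t) t) (h3 : ContinuousOn V'' (Ioi τ)) {x : Plane}
    (hx : x ≠ 0) (hxτ : τ < -Real.log (‖x‖ ^ 2)) :
    (Δ fun y : Plane => V (-Real.log (‖y‖ ^ 2))) x =
      4 / ‖x‖ ^ 2 * V'' (-Real.log (‖x‖ ^ 2)) := by
  have hq : 0 < ‖x‖ ^ 2 := by positivity
  have hlog : ∀ q : ℝ, 0 < q → HasDerivAt (fun q => -Real.log q) (-q⁻¹) q := fun q hq =>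
    (Real.hasDerivAt_log hq.ne').neg
  have hd1 : ∀ q : ℝ, 0 < q → τ < -Real.log q →
      HasDerivAt (fun q => V (-Real.log q)) (V' (-Real.log q) * -q⁻¹) q := fun q hq hτ =>
    (h1 _ hτ).comp q (hlog q hq)
  have hev : ∀ᶠ q in 𝓝 (‖x‖ ^ 2), 0 < q ∧ τ < -Real.log q :=
    (lt_mem_nhds hq).and ((hlog _ hq).continuousAt.eventually (lt_mem_nhds hxτ))
  have hd2 : HasDerivAt (deriv fun q => V (-Real.log q))
      (V'' (-Real.log (‖x‖ ^ 2)) * -(‖x‖ ^ 2)⁻¹ * -(‖x‖ ^ 2)⁻¹ +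
        V' (-Real.log (‖x‖ ^ 2)) * -(-((‖x‖ ^ 2) ^ 2)⁻¹)) (‖x‖ ^ 2) := by
    have h4 : HasDerivAt (fun q => V' (-Real.log q))
        (V'' (-Real.log (‖x‖ ^ 2)) * -(‖x‖ ^ 2)⁻¹) (‖x‖ ^ 2) :=
      (h2 _ hxτ).comp (‖x‖ ^ 2) (hlog _ hq)
    refine (h4.mul (hasDerivAt_inv hq.ne').neg).congr_of_eventuallyEq ?_
    filter_upwards [hev] with q hq' using (hd1 q hq'.1 hq'.2).deriv
  rw [laplacian_comp_normSq (contDiffAt_comp_neg_log h1 h2 h3 hq hxτ), hd2.deriv,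
    (hd1 _ hq hxτ).deriv]
  field_simp
  ring

end LogRadial

/-! ### From a profile V(t) to a classical solution, and integrability. -/

section Profile

/-- A positive singular solution in the variable `t = log (1 / |x|²)`. -/
structure IsProfile (f : ℝ → ℝ) (τ : ℝ) (V V' : ℝ → ℝ) : Prop where
  hasDerivAt : ∀ t, τ < t → HasDerivAt V (V' t) t
  hasDerivAt' : ∀ t, τ < t → HasDerivAt V' (-(Real.exp (-t) / 4 * f (V t))) t
  pos : ∀ t, τ < t → 0 < V t
  tendsto : Tendsto V atTop atTop
  tendsto' : Tendsto V' atTop (𝓝 0)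

variable {f V V' : ℝ → ℝ} {τ : ℝ}

theorem IsProfile.deriv_pos (h : IsProfile f τ V V') (hf : Admissible f) {t : ℝ} (ht : τ < t) :
    0 < V' t :=
  hf.deriv_pos_of_tendsto (fun t ht => ⟨h.hasDerivAt t ht, h.hasDerivAt' t ht, h.pos t ht⟩)
    h.tendsto ht

theorem IsProfile.monotoneOn (h : IsProfile f τ V V') (hf : Admissible f) :
    MonotoneOn V (Ioi τ) := by
  refine monotoneOn_of_deriv_nonneg (convex_Ioi τ)
    (fun s hs => (h.hasDerivAt s hs).continuousAt.continuousWithinAt)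
    (fun s hs => (h.hasDerivAt s (interior_subset hs)).differentiableAt.differentiableWithinAt)
    fun s hs => ?_
  rw [(h.hasDerivAt s (interior_subset hs)).deriv]
  exact (h.deriv_pos hf (interior_subset hs)).le

theorem IsProfile.antitoneOn (h : IsProfile f τ V V') (hf : Admissible f) :
    AntitoneOn V' (Ioi τ) := by
  refine antitoneOn_of_deriv_nonpos (convex_Ioi τ)
    (fun s hs => (h.hasDerivAt' s hs).continuousAt.continuousWithinAt)
    (fun s hs => (h.hasDerivAt' s (interior_subset hs)).differentiableAt.differentiableWithinAt)
    fun s hs => ?_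
  have := hf.pos _ (h.pos s (interior_subset hs))
  rw [(h.hasDerivAt' s (interior_subset hs)).deriv]
  have : 0 < Real.exp (-s) / 4 * f (V s) := by positivity
  linarith

theorem IsProfile.continuousOn_comp (h : IsProfile f τ V V') (hf : Admissible f) :
    ContinuousOn (fun t => f (V t)) (Ioi τ) := fun t ht =>
  (ContinuousAt.comp (g := f) (hf.continuousAt (h.pos t ht))
    (h.hasDerivAt t ht).continuousAt).continuousWithinAt

theorem IsProfile.continuousOn_second (h : IsProfile f τ V V') (hf : Admissible f) :
    ContinuousOn (fun t => -(Real.exp (-t) / 4 * f (V t))) (Ioi τ) :=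
  (ContinuousOn.mul (by fun_prop) (h.continuousOn_comp hf)).neg

theorem mem_ball_iff_lt_neg_log {x : Plane} (hx : x ≠ 0) :
    x ∈ Metric.ball (0 : Plane) (Real.exp (-τ / 2)) ↔ τ < -Real.log (‖x‖ ^ 2) := by
  have hx0 : 0 < ‖x‖ := norm_pos_iff.2 hx
  rw [mem_ball_zero_iff, ← Real.log_lt_iff_lt_exp hx0, Real.log_pow]
  push_cast
  constructor <;> intro h <;> linarith

theorem mem_closedBall_iff_le_neg_log {x : Plane} (hx : x ≠ 0) :
    x ∈ Metric.closedBall (0 : Plane) (Real.exp (-τ / 2)) ↔ τ ≤ -Real.log (‖x‖ ^ 2) := by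
  have hx0 : 0 < ‖x‖ := norm_pos_iff.2 hx
  rw [mem_closedBall_zero_iff, ← Real.log_le_iff_le_exp hx0, Real.log_pow]
  push_cast
  constructor <;> intro h <;> linarith

/-- Since log|x| is harmonic in the plane, no first-order term appears: the Laplacian is 4V''/|x|²,
and e^{-t} = |x|² cancels the denominator. The circle of radius e^{-τ/2} is the level t = τ. -/
theorem IsProfile.isClassicalRadialSolution (h : IsProfile f τ V V') (hf : Admissible f)
    (hc : ContinuousOn V (Ici τ)) (h0 : V τ = 0) :
    IsClassicalRadialSolution f (Real.exp (-τ / 2)) fun x => V (-Real.log (‖x‖ ^ 2)) where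
  contDiffOn := by
    rintro x ⟨hx, hx0⟩
    have hx0' : x ≠ 0 := hx0
    have hw := contDiffAt_comp_neg_log h.hasDerivAt h.hasDerivAt' (h.continuousOn_second hf)
      (q := ‖x‖ ^ 2) (by positivity) ((mem_ball_iff_lt_neg_log hx0').1 hx)
    exact (hw.comp x (contDiff_norm_sq ℝ).contDiffAt).contDiffWithinAt
  continuousOn := by
    refine hc.comp (fun x hx => ?_) fun x hx => (mem_closedBall_iff_le_neg_log hx.2).1 hx.1
    have hx0 : x ≠ 0 := hx.2
    have : ‖x‖ ^ 2 ≠ 0 := by positivity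
    have h1 : ContinuousAt (fun x : Plane => Real.log (‖x‖ ^ 2)) x :=
      ContinuousAt.log (by fun_prop) this
    exact h1.neg.continuousWithinAt
  radial x y _ hxy := by simp only [hxy]
  pos x hx := h.pos _ ((mem_ball_iff_lt_neg_log hx.2).1 hx.1)
  equation x hx := by
    have hx0 : x ≠ 0 := hx.2
    rw [laplacian_comp_neg_log h.hasDerivAt h.hasDerivAt' (h.continuousOn_second hf) hx0
      ((mem_ball_iff_lt_neg_log hx0).1 hx.1), neg_neg, Real.exp_log (by positivity)]
    field_simp
  boundary x hx := by
    rw [mem_sphere_zero_iff_norm] at hx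
    simp only [hx, Real.log_pow, Real.log_exp]
    push_cast
    rw [show -(2 * (-τ / 2)) = τ by ring, h0]

/-- A profile grows at most linearly. -/
theorem IsProfile.exists_le_add_abs (h : IsProfile f τ V V') (hf : Admissible f) :
    ∃ C : ℝ, 0 ≤ C ∧ ∀ t, τ < t → V t ≤ C + |t| := by
  obtain ⟨a, ha⟩ := eventually_atTop.1 ((h.tendsto'.eventually (gt_mem_nhds one_pos)).and
    (eventually_gt_atTop τ))
  have haτ := (ha a le_rfl).2
  have hmono : MonotoneOn (fun t => t - V t) (Ici a) := by
    have hd : ∀ t, a ≤ t → HasDerivAt (fun t => t - V t) (1 - V' t) t := fun t ht =>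
      (hasDerivAt_id t).sub (h.hasDerivAt t (ha t ht).2)
    refine monotoneOn_of_deriv_nonneg (convex_Ici a)
      (fun s hs => (hd s hs).continuousAt.continuousWithinAt)
      (fun s hs => (hd s (interior_subset hs)).differentiableAt.differentiableWithinAt)
      fun s hs => ?_
    rw [(hd s (interior_subset hs)).deriv]
    linarith [(ha s (interior_subset hs)).1]
  have hVa := h.pos a haτ
  refine ⟨V a + |a|, by positivity, fun t ht => ?_⟩
  rcases le_total t a with hta | hta
  · have := h.monotoneOn hf ht haτ hta
    linarith [abs_nonneg t, abs_nonneg a]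
  · have h1 := hmono self_mem_Ici hta hta
    simp only at h1
    linarith [le_abs_self t, neg_abs_le a]

theorem continuousOn_neg_log_sq : ContinuousOn (fun y : ℝ => -Real.log (y ^ 2)) (Ioi 0) :=
  fun y hy => by
    have h1 : ContinuousAt (fun y : ℝ => Real.log (y ^ 2)) y :=
      ContinuousAt.log (by fun_prop) (pow_ne_zero 2 (ne_of_gt hy))
    exact h1.neg.continuousWithinAt

theorem lt_neg_log_sq {r y : ℝ} (hr : r ≤ Real.exp (-τ / 2)) (hy : 0 < y) (hyr : y < r) :
    τ < -Real.log (y ^ 2) := by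
  have := (Real.log_lt_iff_lt_exp hy).2 (hyr.trans_le hr)
  rw [Real.log_pow]
  push_cast
  linarith

/-- In polar coordinates the at most linear growth of V in t leaves the majorant Cy + 2|y log y|,
which is continuous up to y = 0. -/
theorem IsProfile.integrableOn (h : IsProfile f τ V V') (hf : Admissible f) {r : ℝ}
    (hr : r ≤ Real.exp (-τ / 2)) :
    IntegrableOn (fun x : Plane => V (-Real.log (‖x‖ ^ 2))) (Metric.ball 0 r) := by
  refine (integrableOn_fun_norm_addHaar volume (f := fun y => V (-Real.log (y ^ 2)))).2 ?_
  obtain ⟨C, hC, hV⟩ := h.exists_le_add_abs hf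
  have hVc : ContinuousOn (fun y : ℝ => V (-Real.log (y ^ 2))) (Ioo 0 r) :=
    ContinuousOn.comp (t := Ioi τ)
      (fun t ht => (h.hasDerivAt t ht).continuousAt.continuousWithinAt)
      (continuousOn_neg_log_sq.mono Ioo_subset_Ioi_self)
      fun y hy => lt_neg_log_sq hr hy.1 hy.2
  have hdom : Continuous fun y : ℝ => |y| * C + 2 * |y * Real.log y| := by
    have := Real.continuous_mul_log
    fun_prop
  refine Integrable.mono' (hdom.integrableOn_Icc.mono_set Ioo_subset_Icc_self) ?_ ?_
  · refine ContinuousOn.aestronglyMeasurable ?_ measurableSet_Ioo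
    exact (continuousOn_id.pow _).smul hVc
  · refine (ae_restrict_iff' measurableSet_Ioo).2 (Eventually.of_forall fun y hy => ?_)
    have hyτ := lt_neg_log_sq hr hy.1 hy.2
    have hp := h.pos _ hyτ
    have hle := hV _ hyτ
    have hy0 : 0 < y := hy.1
    simp only [finrank_euclideanSpace, Fintype.card_fin, smul_eq_mul]
    rw [norm_mul, Real.norm_of_nonneg hp.le, Real.norm_of_nonneg (by positivity),
      abs_of_pos hy0]
    calc y ^ (2 - 1) * V (-Real.log (y ^ 2)) ≤ y ^ (2 - 1) * (C + |-Real.log (y ^ 2)|) := by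
          gcongr
      _ = y * C + 2 * |y * Real.log y| := by
          rw [abs_neg, Real.log_pow, abs_mul, abs_mul, abs_of_pos hy0]
          push_cast
          rw [abs_of_pos (by norm_num : (0 : ℝ) < 2)]
          ring

/-- The polar density y f(V(-log y²)) is the derivative of the flux 2V'(-log y²). The flux extends
continuously by 0 at y = 0 because V' → 0, and a nonnegative derivative of a continuous function is
integrable. No growth bound on f is used. The strict inequality for r keeps the flux differentiable
at y = r. -/
theorem IsProfile.integrableOn_comp (h : IsProfile f τ V V') (hf : Admissible f) {r : ℝ}
    (hr : r < Real.exp (-τ / 2)) :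
    IntegrableOn (fun x : Plane => f (V (-Real.log (‖x‖ ^ 2)))) (Metric.ball 0 r) := by
  refine (integrableOn_fun_norm_addHaar volume (f := fun y => f (V (-Real.log (y ^ 2))))).2 ?_
  let G : ℝ → ℝ := fun y => if y ≤ 0 then 0 else 2 * V' (-Real.log (y ^ 2))
  have hτ : ∀ y, 0 < y → y ≤ r → τ < -Real.log (y ^ 2) := fun y hy hyr =>
    lt_neg_log_sq le_rfl hy (hyr.trans_lt hr)
  have hGd : ∀ y, 0 < y → y ≤ r → HasDerivAt G (y * f (V (-Real.log (y ^ 2)))) y := by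
    intro y hy hyr
    have h1 : HasDerivAt (fun y : ℝ => -Real.log (y ^ 2)) (-((2 : ℕ) * y ^ (2 - 1) / y ^ 2)) y :=
      ((hasDerivAt_pow 2 y).log (by positivity)).neg
    have h2 := ((h.hasDerivAt' _ (hτ y hy hyr)).comp y h1).const_mul 2
    refine (h2.congr_deriv ?_).congr_of_eventuallyEq ?_
    · rw [neg_neg, Real.exp_log (by positivity)]
      push_cast
      field_simp
      norm_num
    · filter_upwards [lt_mem_nhds hy] with z hz
      simp [G, not_le.2 hz]
  have hGc : ContinuousOn G (Icc 0 r) := by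
    intro y hy
    rcases eq_or_lt_of_le hy.1 with rfl | hy0
    · have hG0 : G 0 = 0 := by simp [G]
      refine ContinuousAt.continuousWithinAt ?_
      rw [continuousAt_iff_continuous_left_right]
      constructor
      · refine continuousWithinAt_const.congr (fun z hz => ?_) hG0
        simp only [G, if_pos (show z ≤ 0 from hz)]
      · rw [← continuousWithinAt_Ioi_iff_Ici]
        unfold ContinuousWithinAt
        rw [hG0]
        have hlog : Tendsto (fun y : ℝ => -Real.log (y ^ 2)) (𝓝[>] 0) atTop := by
          have h1 : Tendsto (fun y : ℝ => -2 * Real.log y) (𝓝[>] 0) atTop :=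
            Real.tendsto_log_nhdsGT_zero.const_mul_atBot_of_neg (by norm_num)
          refine h1.congr fun y => ?_
          rw [Real.log_pow]; push_cast; ring
        have h2 := ((h.tendsto'.comp hlog).const_mul 2)
        rw [mul_zero] at h2
        refine h2.congr' ?_
        filter_upwards [self_mem_nhdsWithin] with z hz
        simp [G, not_le.2 (show (0 : ℝ) < z from hz)]
    · exact (hGd y hy0 hy.2).continuousAt.continuousWithinAt
  have hderivInt := intervalIntegral.integrableOn_deriv_of_nonneg hGc
    (fun y hy => hGd y hy.1 hy.2.le) (fun y hy => by
      have := hf.pos _ (h.pos _ (hτ y hy.1 hy.2.le))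
      have := hy.1
      positivity)
  refine (hderivInt.mono_set Ioo_subset_Ioc_self).congr_fun (fun y _ => ?_) measurableSet_Ioo
  simp [finrank_euclideanSpace]

end Profile

/-! ### Smooth truncation of the singularity. -/

section Truncation

variable {f V V' : ℝ → ℝ} {τ k : ℝ}

/-- A `C²` truncation of `V`: equal to `V` up to `k` and constant beyond `k + 1`. -/
noncomputable def truncProfile (V V' : ℝ → ℝ) (k t : ℝ) : ℝ :=
  V k + ∫ s in k..t, V' s * Real.smoothTransition (k + 1 - s)

theorem IsProfile.continuousOn_truncDeriv (h : IsProfile f τ V V') (k : ℝ) :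
    ContinuousOn (fun s => V' s * Real.smoothTransition (k + 1 - s)) (Ioi τ) := fun s hs =>
  ((h.hasDerivAt' s hs).continuousAt.mul (by fun_prop)).continuousWithinAt

theorem uIcc_subset_Ioi {a b : ℝ} (ha : τ < a) (hb : τ < b) : uIcc a b ⊆ Ioi τ := fun _ hs =>
  (lt_min ha hb).trans_le hs.1

theorem IsProfile.hasDerivAt_truncProfile (h : IsProfile f τ V V') (hk : τ < k) {t : ℝ}
    (ht : τ < t) :
    HasDerivAt (truncProfile V V' k) (V' t * Real.smoothTransition (k + 1 - t)) t := by
  have hc := h.continuousOn_truncDeriv k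
  refine (intervalIntegral.integral_hasDerivAt_right
    (hc.mono (uIcc_subset_Ioi hk ht)).intervalIntegrable
    (hc.stronglyMeasurableAtFilter isOpen_Ioi t ht)
    (hc.continuousAt (Ioi_mem_nhds ht))).const_add (V k)

theorem hasDerivAt_smoothTransition (x : ℝ) :
    HasDerivAt Real.smoothTransition (deriv Real.smoothTransition x) x :=
  ((Real.smoothTransition.contDiff (n := 1)).contDiffAt.differentiableAt (by simp)).hasDerivAt

theorem continuous_deriv_smoothTransition : Continuous (deriv Real.smoothTransition) :=
  (Real.smoothTransition.contDiff (n := 1)).continuous_deriv (by simp)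

theorem deriv_smoothTransition_eq_zero {x : ℝ} (hx : x < 0 ∨ 1 < x) :
    deriv Real.smoothTransition x = 0 := by
  rcases hx with hx | hx
  · have : Real.smoothTransition =ᶠ[𝓝 x] fun _ => 0 := by
      filter_upwards [gt_mem_nhds hx] with y hy using Real.smoothTransition.zero_of_nonpos hy.le
    rw [this.deriv_eq, deriv_const]
  · have : Real.smoothTransition =ᶠ[𝓝 x] fun _ => 1 := by
      filter_upwards [lt_mem_nhds hx] with y hy using Real.smoothTransition.one_of_one_le hy.le
    rw [this.deriv_eq, deriv_const]

theorem exists_bound_deriv_smoothTransition :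
    ∃ C : ℝ, 0 ≤ C ∧ ∀ x, |deriv Real.smoothTransition x| ≤ C := by
  obtain ⟨C, hC⟩ := isCompact_Icc.exists_bound_of_continuousOn (s := Icc (0 : ℝ) 1)
    continuous_deriv_smoothTransition.continuousOn
  have hC0 : 0 ≤ C := (norm_nonneg _).trans (hC 0 (by simp))
  refine ⟨C, hC0, fun x => ?_⟩
  by_cases hx : x ∈ Icc (0 : ℝ) 1
  · exact hC x hx
  · rw [deriv_smoothTransition_eq_zero, abs_zero]
    · exact hC0
    · by_contra hcon
      push Not at hcon
      exact hx hcon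

theorem IsProfile.hasDerivAt_truncDeriv (h : IsProfile f τ V V') {t : ℝ} (ht : τ < t) :
    HasDerivAt (fun s => V' s * Real.smoothTransition (k + 1 - s))
      (-(Real.exp (-t) / 4 * f (V t)) * Real.smoothTransition (k + 1 - t) -
        V' t * deriv Real.smoothTransition (k + 1 - t)) t := by
  have h1 : HasDerivAt (fun s => Real.smoothTransition (k + 1 - s))
      (deriv Real.smoothTransition (k + 1 - t) * -1) t :=
    (hasDerivAt_smoothTransition (k + 1 - t)).comp t ((hasDerivAt_id t).const_sub (k + 1))
  refine ((h.hasDerivAt' t ht).mul h1).congr_deriv ?_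
  ring

theorem IsProfile.continuousOn_truncSecond (h : IsProfile f τ V V') (hf : Admissible f) :
    ContinuousOn (fun t => -(Real.exp (-t) / 4 * f (V t)) * Real.smoothTransition (k + 1 - t) -
        V' t * deriv Real.smoothTransition (k + 1 - t)) (Ioi τ) := by
  have h1 : ContinuousOn V' (Ioi τ) := fun s hs =>
    (h.hasDerivAt' s hs).continuousAt.continuousWithinAt
  have h2 := continuous_deriv_smoothTransition
  refine ((h.continuousOn_second hf).mul ?_).sub (h1.mul ?_)
  · exact Continuous.continuousOn (by fun_prop)
  · exact Continuous.continuousOn (by fun_prop)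

theorem IsProfile.integral_deriv (h : IsProfile f τ V V') (hk : τ < k) {t : ℝ} (ht : τ < t) :
    ∫ s in k..t, V' s = V t - V k := by
  have hsub := uIcc_subset_Ioi hk ht
  refine intervalIntegral.integral_eq_sub_of_hasDerivAt (fun s hs => h.hasDerivAt s (hsub hs)) ?_
  exact ContinuousOn.intervalIntegrable fun s hs =>
    (h.hasDerivAt' s (hsub hs)).continuousAt.continuousWithinAt

theorem IsProfile.truncProfile_eq (h : IsProfile f τ V V') (hk : τ < k) {t : ℝ} (ht : τ < t)
    (htk : t ≤ k) : truncProfile V V' k t = V t := by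
  have h1 : ∫ s in k..t, V' s * Real.smoothTransition (k + 1 - s) = ∫ s in k..t, V' s := by
    refine intervalIntegral.integral_congr fun s hs => ?_
    rw [uIcc_of_ge htk] at hs
    rw [Real.smoothTransition.one_of_one_le (by linarith [hs.2]), mul_one]
  rw [truncProfile, h1, h.integral_deriv hk ht]
  ring

theorem IsProfile.truncProfile_const (h : IsProfile f τ V V') (hk : τ < k) {t : ℝ}
    (ht : k + 1 ≤ t) : truncProfile V V' k t = truncProfile V V' k (k + 1) := by
  have hc := h.continuousOn_truncDeriv k
  have h1 : ∫ s in (k + 1)..t, V' s * Real.smoothTransition (k + 1 - s) = 0 := by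
    rw [intervalIntegral.integral_congr (g := fun _ => (0 : ℝ)) fun s hs => ?_]
    · simp
    · rw [uIcc_of_le ht] at hs
      simp only
      rw [Real.smoothTransition.zero_of_nonpos (by linarith [hs.1]), mul_zero]
  rw [truncProfile, truncProfile, ← intervalIntegral.integral_add_adjacent_intervals
    (hc.mono (uIcc_subset_Ioi hk (by linarith : τ < k + 1))).intervalIntegrable
    (hc.mono (uIcc_subset_Ioi (by linarith : τ < k + 1)
      (by linarith : τ < t))).intervalIntegrable, h1, add_zero]

theorem IsProfile.truncProfile_mem (h : IsProfile f τ V V') (hf : Admissible f) (hk : τ < k)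
    {t : ℝ} (ht : τ < t) : 0 ≤ truncProfile V V' k t ∧ truncProfile V V' k t ≤ V t := by
  rcases le_total t k with htk | htk
  · rw [h.truncProfile_eq hk ht htk]
    exact ⟨(h.pos t ht).le, le_rfl⟩
  · have hVk := h.pos k hk
    have hsub := uIcc_subset_Ioi hk ht
    have h1 : 0 ≤ ∫ s in k..t, V' s * Real.smoothTransition (k + 1 - s) :=
      intervalIntegral.integral_nonneg htk fun s hs =>
        mul_nonneg (h.deriv_pos hf (hk.trans_le hs.1)).le (Real.smoothTransition.nonneg _)
    have h2 : ∫ s in k..t, V' s * Real.smoothTransition (k + 1 - s) ≤ ∫ s in k..t, V' s := by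
      refine intervalIntegral.integral_mono_on htk
        ((h.continuousOn_truncDeriv k).mono hsub).intervalIntegrable
        (ContinuousOn.intervalIntegrable fun s hs =>
          (h.hasDerivAt' s (hsub hs)).continuousAt.continuousWithinAt) fun s hs => ?_
      exact mul_le_of_le_one_right (h.deriv_pos hf (hk.trans_le hs.1)).le
        (Real.smoothTransition.le_one _)
    rw [h.integral_deriv hk ht] at h2
    rw [truncProfile]
    exact ⟨by linarith, by linarith⟩

/-- The truncated profile as a function on the disc, constant near the origin. -/
noncomputable def truncRadial (V V' : ℝ → ℝ) (k : ℝ) (x : Plane) : ℝ :=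
  if x = 0 then truncProfile V V' k (k + 1) else truncProfile V V' k (-Real.log (‖x‖ ^ 2))

theorem truncRadial_eventuallyEq {x : Plane} (hx : x ≠ 0) :
    truncRadial V V' k =ᶠ[𝓝 x] fun y => truncProfile V V' k (-Real.log (‖y‖ ^ 2)) := by
  filter_upwards [isOpen_ne.mem_nhds hx] with y hy
  exact if_neg hy

/-- Near the origin t exceeds k + 1 and the truncation is constant, so regularity holds across the
singularity. The value at x = 0 is assigned separately because `Real.log 0 = 0` would send the
origin to t = 0. -/
theorem IsProfile.contDiffOn_truncRadial (h : IsProfile f τ V V') (hf : Admissible f)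
    (hk : τ < k) :
    ContDiffOn ℝ 2 (truncRadial V V' k) (Metric.ball 0 (Real.exp (-τ / 2))) := by
  intro x hx
  refine ContDiffAt.contDiffWithinAt ?_
  by_cases hx0 : x = 0
  · subst hx0
    have hev : truncRadial V V' k =ᶠ[𝓝 (0 : Plane)] fun _ => truncProfile V V' k (k + 1) := by
      filter_upwards [Metric.ball_mem_nhds (0 : Plane) (Real.exp_pos (-(k + 1) / 2))] with y hy
      by_cases hy0 : y = 0
      · simp [truncRadial, hy0]
      · rw [truncRadial, if_neg hy0]
        exact h.truncProfile_const hk ((mem_ball_iff_lt_neg_log hy0).1 hy).le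
    exact contDiffAt_const.congr_of_eventuallyEq hev
  · have hw := contDiffAt_comp_neg_log (fun t ht => h.hasDerivAt_truncProfile hk ht)
      (fun t ht => h.hasDerivAt_truncDeriv (k := k) ht) (h.continuousOn_truncSecond hf)
      (q := ‖x‖ ^ 2) (by positivity) ((mem_ball_iff_lt_neg_log hx0).1 hx)
    exact (hw.comp x (contDiff_norm_sq ℝ).contDiffAt).congr_of_eventuallyEq
      (truncRadial_eventuallyEq hx0)

/-- Differentiating V' times the cutoff yields V'' times the cutoff, which is the equation, and one
term in which the derivative falls on the cutoff; only the latter is an error. -/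
theorem IsProfile.laplacian_truncRadial (h : IsProfile f τ V V') (hf : Admissible f)
    (hk : τ < k) {x : Plane} (hx0 : x ≠ 0)
    (hx : x ∈ Metric.ball (0 : Plane) (Real.exp (-τ / 2))) :
    (Δ (truncRadial V V' k)) x +
      f (V (-Real.log (‖x‖ ^ 2))) * Real.smoothTransition (k + 1 - -Real.log (‖x‖ ^ 2)) =
      -(4 / ‖x‖ ^ 2 * (V' (-Real.log (‖x‖ ^ 2)) *
        deriv Real.smoothTransition (k + 1 - -Real.log (‖x‖ ^ 2)))) := by
  rw [(InnerProductSpace.laplacian_congr_nhds (truncRadial_eventuallyEq hx0)).eq_of_nhds,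
    laplacian_comp_neg_log (fun t ht => h.hasDerivAt_truncProfile hk ht)
      (fun t ht => h.hasDerivAt_truncDeriv (k := k) ht) (h.continuousOn_truncSecond hf) hx0
      ((mem_ball_iff_lt_neg_log hx0).1 hx), neg_neg (Real.log (‖x‖ ^ 2)),
      Real.exp_log (by positivity)]
  field_simp
  ring

/-- The error made by truncation is concentrated in a small annulus. -/
theorem IsProfile.abs_laplacian_truncRadial_le (h : IsProfile f τ V V') (hf : Admissible f)
    (hk : τ < k) {C : ℝ} (hC0 : 0 ≤ C) (hC : ∀ x, |deriv Real.smoothTransition x| ≤ C)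
    {x : Plane} (hx0 : x ≠ 0) (hx : x ∈ Metric.ball (0 : Plane) (Real.exp (-τ / 2))) :
    |(Δ (truncRadial V V' k)) x +
      f (V (-Real.log (‖x‖ ^ 2))) * Real.smoothTransition (k + 1 - -Real.log (‖x‖ ^ 2))| ≤
      (Metric.closedBall (0 : Plane) (Real.exp (-k / 2))).indicator
        (fun _ => 4 * Real.exp (k + 1) * V' k * C) x := by
  have hxτ := (mem_ball_iff_lt_neg_log hx0).1 hx
  have hVk := h.deriv_pos hf hk
  rw [h.laplacian_truncRadial hf hk hx0 hx, abs_neg]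
  set t := -Real.log (‖x‖ ^ 2) with ht
  have hq : ‖x‖ ^ 2 = Real.exp (-t) := by rw [ht, neg_neg, Real.exp_log (by positivity)]
  by_cases hin : k ≤ t ∧ t ≤ k + 1
  · have hmem : x ∈ Metric.closedBall (0 : Plane) (Real.exp (-k / 2)) :=
      (mem_closedBall_iff_le_neg_log hx0).2 hin.1
    rw [indicator_of_mem hmem, abs_mul, abs_mul, abs_of_pos (by positivity : 0 < 4 / ‖x‖ ^ 2),
      abs_of_pos (h.deriv_pos hf hxτ)]
    have h1 : 4 / ‖x‖ ^ 2 ≤ 4 * Real.exp (k + 1) := by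
      rw [hq, div_eq_mul_inv, ← Real.exp_neg, neg_neg]
      gcongr
      exact hin.2
    have h2 : V' t ≤ V' k := h.antitoneOn hf hk hxτ hin.1
    have h3 := hC (k + 1 - t)
    have h4 := h.deriv_pos hf hxτ
    calc 4 / ‖x‖ ^ 2 * (V' t * |deriv Real.smoothTransition (k + 1 - t)|)
        ≤ 4 * Real.exp (k + 1) * (V' k * C) := by gcongr
      _ = _ := by ring
  · have hz : deriv Real.smoothTransition (k + 1 - t) = 0 := by
      refine deriv_smoothTransition_eq_zero ?_
      by_contra hcon
      push Not at hcon
      exact hin ⟨by linarith [hcon.2], by linarith [hcon.1]⟩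
    rw [hz, mul_zero, mul_zero, abs_zero]
    exact indicator_nonneg (fun _ _ => by positivity) x

end Truncation

/-! ### The equation across the origin. -/

section Distribution

variable {f V V' : ℝ → ℝ} {τ : ℝ}

/-- Green's identity holds for each truncation, and the main terms converge by domination by u and
f(u). The truncation error is at most a multiple of e^{k+1} V'(k) on a disc of area proportional to
e^{-k}. It is thus O(V'(k)) and vanishes, so no point mass is left at the origin. -/
theorem IsProfile.weak (h : IsProfile f τ V V') (hf : Admissible f) {φ : Plane → ℝ}
    (hφ : ContDiff ℝ (⊤ : ℕ∞) φ) (hc : HasCompactSupport φ)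
    (hs : tsupport φ ⊆ Metric.ball (0 : Plane) (Real.exp (-τ / 2))) :
    -(∫ x, V (-Real.log (‖x‖ ^ 2)) * (Δ φ) x) = ∫ x, f (V (-Real.log (‖x‖ ^ 2))) * φ x := by
  obtain ⟨r, hr, hsr⟩ := exists_pos_lt_subset_ball (Real.exp_pos (-τ / 2))
    (isClosed_tsupport φ) hs
  have hφ2 : ContDiff ℝ 2 φ := contDiff_infty.1 hφ 2
  have hΔc : Continuous (Δ φ) := by
    have : (Δ φ) = fun x => ∑ i, fderiv ℝ (fun y => fderiv ℝ φ y
        (EuclideanSpace.basisFun (Fin 2) ℝ i)) x (EuclideanSpace.basisFun (Fin 2) ℝ i) := by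
      funext x
      exact laplacian_eq_sum_fderiv _ hφ2.contDiffAt
    rw [this]
    refine continuous_finsetSum _ fun i _ => ?_
    exact ((((hφ2.fderiv_right (m := 1) (by norm_num)).clm_apply contDiff_const).fderiv_right
      (m := 0) (by norm_num)).continuous.clm_apply continuous_const)
  have hΔ0 : ∀ x, x ∉ tsupport φ → (Δ φ) x = 0 := fun x hx => by
    have : φ =ᶠ[𝓝 x] fun _ => (0 : ℝ) := by
      filter_upwards [(isClosed_tsupport φ).isOpen_compl.mem_nhds hx] with y hy
      exact image_eq_zero_of_notMem_tsupport hy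
    rw [(InnerProductSpace.laplacian_congr_nhds this).eq_of_nhds,
      InnerProductSpace.laplacian_const]
    rfl
  have hΔcs : HasCompactSupport (Δ φ) := hc.mono' fun x hx => by
    by_contra hcon
    exact hx (hΔ0 x hcon)
  obtain ⟨M, hM⟩ := hφ.continuous.bounded_above_of_compact_support hc
  obtain ⟨N, hN⟩ := hΔc.bounded_above_of_compact_support hΔcs
  have hM0 : 0 ≤ M := (norm_nonneg _).trans (hM 0)
  -- integrability against bounded functions supported in the smaller ball
  have hiu : Integrable ((Metric.ball (0 : Plane) r).indicator
      fun x => V (-Real.log (‖x‖ ^ 2))) :=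
    (h.integrableOn hf hr.2.le).integrable_indicator measurableSet_ball
  have hif : Integrable ((Metric.ball (0 : Plane) r).indicator
      fun x => f (V (-Real.log (‖x‖ ^ 2)))) :=
    (h.integrableOn_comp hf hr.2).integrable_indicator measurableSet_ball
  have hne : ∀ᵐ x : Plane, x ≠ 0 := by
    rw [ae_iff]; simp
  have hτr : ∀ x : Plane, x ≠ 0 → x ∈ Metric.ball (0 : Plane) r →
      τ < -Real.log (‖x‖ ^ 2) := fun x hx0 hx =>
    (mem_ball_iff_lt_neg_log hx0).1 (Metric.ball_subset_ball hr.2.le hx)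
  have hBopen : IsOpen (Metric.ball (0 : Plane) (Real.exp (-τ / 2))) := Metric.isOpen_ball
  have htrunc : ∀ k, τ < k → Integrable (fun x => (Δ (truncRadial V V' k)) x * φ x) ∧
      ∫ x, truncRadial V V' k x * (Δ φ) x = ∫ x, (Δ (truncRadial V V' k)) x * φ x := fun k hk =>
    integral_mul_laplacian hBopen (h.contDiffOn_truncRadial hf hk) hφ hc hs
  -- the left-hand sides converge
  have hlim1 : Tendsto (fun k : ℝ => ∫ x, truncRadial V V' k x * (Δ φ) x) atTop
      (𝓝 (∫ x, V (-Real.log (‖x‖ ^ 2)) * (Δ φ) x)) := by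
    refine tendsto_integral_filter_of_dominated_convergence
      (fun x => (Metric.ball (0 : Plane) r).indicator
        (fun x => V (-Real.log (‖x‖ ^ 2))) x * N) ?_ ?_ (hiu.mul_const N) ?_
    · filter_upwards [eventually_gt_atTop τ] with k hk
      refine (integrable_mul_of_tsupport_subset hBopen
        (h.contDiffOn_truncRadial hf hk).continuousOn hΔc hΔcs
        ((closure_minimal (fun x hx => ?_) (isClosed_tsupport φ)).trans
          hs)).aestronglyMeasurable
      by_contra hcon
      exact hx (hΔ0 x hcon)
    · filter_upwards [eventually_gt_atTop τ] with k hk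
      filter_upwards [hne] with x hx0
      by_cases hx : x ∈ tsupport φ
      · have hxr := hsr hx
        obtain ⟨b1, b2⟩ := h.truncProfile_mem hf hk (hτr x hx0 hxr)
        rw [norm_mul, indicator_of_mem hxr, truncRadial, if_neg hx0, Real.norm_of_nonneg b1]
        have := hN x
        have := norm_nonneg ((Δ φ) x)
        exact mul_le_mul b2 (hN x) (norm_nonneg _) (b1.trans b2)
      · rw [hΔ0 x hx, mul_zero, norm_zero]
        have hN0 : 0 ≤ N := (norm_nonneg _).trans (hN 0)
        by_cases hxr : x ∈ Metric.ball (0 : Plane) r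
        · rw [indicator_of_mem hxr]
          exact mul_nonneg (h.pos _ (hτr x hx0 hxr)).le hN0
        · rw [indicator_of_notMem hxr, zero_mul]
    · filter_upwards [hne] with x hx0
      by_cases hx : x ∈ tsupport φ
      · have hxτ := hτr x hx0 (hsr hx)
        refine tendsto_const_nhds.congr' ?_
        filter_upwards [eventually_ge_atTop (-Real.log (‖x‖ ^ 2))] with k hk
        rw [truncRadial, if_neg hx0, h.truncProfile_eq (hxτ.trans_le hk) hxτ hk]
      · simp [hΔ0 x hx]
  have hmeasf : ∀ k : ℝ, Integrable (fun x => f (V (-Real.log (‖x‖ ^ 2))) *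
      Real.smoothTransition (k + 1 - -Real.log (‖x‖ ^ 2)) * φ x) ∧
      ∀ᵐ x, ‖f (V (-Real.log (‖x‖ ^ 2))) *
        Real.smoothTransition (k + 1 - -Real.log (‖x‖ ^ 2)) * φ x‖ ≤
        (Metric.ball (0 : Plane) r).indicator (fun x => f (V (-Real.log (‖x‖ ^ 2)))) x * M := by
    intro k
    have hb : ∀ᵐ x, ‖f (V (-Real.log (‖x‖ ^ 2))) *
        Real.smoothTransition (k + 1 - -Real.log (‖x‖ ^ 2)) * φ x‖ ≤
        (Metric.ball (0 : Plane) r).indicator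
          (fun x => f (V (-Real.log (‖x‖ ^ 2)))) x * M := by
      filter_upwards [hne] with x hx0
      by_cases hx : x ∈ Metric.ball (0 : Plane) r
      · have hp := hf.pos _ (h.pos _ (hτr x hx0 hx))
        rw [indicator_of_mem hx, norm_mul, norm_mul, Real.norm_of_nonneg hp.le,
          Real.norm_of_nonneg (Real.smoothTransition.nonneg _)]
        have h1 := mul_le_of_le_one_right hp.le
          (Real.smoothTransition.le_one (k + 1 - -Real.log (‖x‖ ^ 2)))
        exact mul_le_mul h1 (hM x) (norm_nonneg _) hp.le
      · rw [indicator_of_notMem hx, image_eq_zero_of_notMem_tsupport (fun hx' => hx (hsr hx'))]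
        simp
    refine ⟨(hif.mul_const M).mono' ?_ hb, hb⟩
    have heq : (fun x => f (V (-Real.log (‖x‖ ^ 2))) *
        Real.smoothTransition (k + 1 - -Real.log (‖x‖ ^ 2)) * φ x) = fun x =>
        (Metric.ball (0 : Plane) r).indicator (fun x => f (V (-Real.log (‖x‖ ^ 2)))) x *
        Real.smoothTransition (k + 1 - -Real.log (‖x‖ ^ 2)) * φ x := by
      funext x
      by_cases hx : x ∈ Metric.ball (0 : Plane) r
      · rw [indicator_of_mem hx]
      · rw [image_eq_zero_of_notMem_tsupport (fun hx' => hx (hsr hx'))]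
        simp
    rw [heq]
    refine (hif.aestronglyMeasurable.mul ?_).mul hφ.continuous.aestronglyMeasurable
    refine Measurable.aestronglyMeasurable ?_
    exact Real.smoothTransition.continuous.measurable.comp
      (measurable_const.sub (Real.measurable_log.comp (measurable_norm.pow_const 2)).neg)
  -- the main part of the right-hand sides converges
  have hlim2 : Tendsto (fun k : ℝ => ∫ x, f (V (-Real.log (‖x‖ ^ 2))) *
      Real.smoothTransition (k + 1 - -Real.log (‖x‖ ^ 2)) * φ x) atTop
      (𝓝 (∫ x, f (V (-Real.log (‖x‖ ^ 2))) * φ x)) := by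
    refine tendsto_integral_filter_of_dominated_convergence
      (fun x => (Metric.ball (0 : Plane) r).indicator
        (fun x => f (V (-Real.log (‖x‖ ^ 2)))) x * M)
      (Eventually.of_forall fun k => (hmeasf k).1.aestronglyMeasurable)
      (Eventually.of_forall fun k => (hmeasf k).2) (hif.mul_const M) ?_
    refine Eventually.of_forall fun x => tendsto_const_nhds.congr' ?_
    filter_upwards [eventually_ge_atTop (-Real.log (‖x‖ ^ 2))] with k hk
    rw [Real.smoothTransition.one_of_one_le (by linarith), mul_one]
  -- the error vanishes
  obtain ⟨C, hC0, hC⟩ := exists_bound_deriv_smoothTransition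
  set A := (volume.real (Metric.closedBall (0 : Plane) 1)) with hA
  have herr : ∀ k, τ < k → ‖(∫ x, (Δ (truncRadial V V' k)) x * φ x) +
      ∫ x, f (V (-Real.log (‖x‖ ^ 2))) *
        Real.smoothTransition (k + 1 - -Real.log (‖x‖ ^ 2)) * φ x‖ ≤
      4 * Real.exp 1 * C * M * A * V' k := by
    intro k hk
    rw [← integral_add (htrunc k hk).1 (hmeasf k).1]
    have hVk := h.deriv_pos hf hk
    have hcb : MeasurableSet (Metric.closedBall (0 : Plane) (Real.exp (-k / 2))) :=
      measurableSet_closedBall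
    have hci : IntegrableOn (fun _ : Plane => 4 * Real.exp (k + 1) * V' k * C)
        (Metric.closedBall (0 : Plane) (Real.exp (-k / 2))) :=
      integrableOn_const measure_closedBall_lt_top.ne enorm_ne_top
    refine (norm_integral_le_of_norm_le ((hci.integrable_indicator hcb).mul_const M) ?_).trans ?_
    · filter_upwards [hne] with x hx0
      by_cases hx : x ∈ tsupport φ
      · rw [← add_mul, norm_mul]
        have h1 := h.abs_laplacian_truncRadial_le hf hk hC0 hC hx0 (hs hx)
        exact mul_le_mul h1 (hM x) (norm_nonneg _) ((abs_nonneg _).trans h1)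
      · rw [image_eq_zero_of_notMem_tsupport hx]
        simp only [mul_zero, add_zero, norm_zero]
        exact mul_nonneg (indicator_nonneg (fun _ _ => by positivity) x) hM0
    · rw [integral_mul_const, integral_indicator hcb, setIntegral_const, smul_eq_mul]
      -- Scaling in dimension two squares the radius, giving exactly the e^{-k} that compensates
      -- e^{k+1}.
      have hvol : volume.real (Metric.closedBall (0 : Plane) (Real.exp (-k / 2))) =
          Real.exp (-k) * A := by
        have h1 := Measure.addHaar_closedBall_mul_of_pos volume (0 : Plane)
          (Real.exp_pos (-k / 2)) 1
        rw [mul_one] at h1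
        rw [Measure.real, h1, ENNReal.toReal_mul, ENNReal.toReal_ofReal (by positivity), hA,
          Measure.real, finrank_euclideanSpace, Fintype.card_fin, ← Real.exp_nat_mul]
        congr 2
        push_cast
        ring
      rw [hvol]
      have hexp : Real.exp (-k) * Real.exp (k + 1) = Real.exp 1 := by
        rw [← Real.exp_add]; congr 1; ring
      refine le_of_eq ?_
      calc Real.exp (-k) * A * (4 * Real.exp (k + 1) * V' k * C) * M
          = 4 * (Real.exp (-k) * Real.exp (k + 1)) * C * M * A * V' k := by ring
        _ = _ := by rw [hexp]
  have hlim3 : Tendsto (fun k : ℝ => (∫ x, (Δ (truncRadial V V' k)) x * φ x) +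
      ∫ x, f (V (-Real.log (‖x‖ ^ 2))) *
        Real.smoothTransition (k + 1 - -Real.log (‖x‖ ^ 2)) * φ x) atTop (𝓝 0) := by
    refine squeeze_zero_norm' (a := fun k => 4 * Real.exp 1 * C * M * A * V' k) ?_ ?_
    · filter_upwards [eventually_gt_atTop τ] with k hk using herr k hk
    · simpa using h.tendsto'.const_mul (4 * Real.exp 1 * C * M * A)
  have hlim4 : Tendsto (fun k : ℝ => (∫ x, (Δ (truncRadial V V' k)) x * φ x) +
      ∫ x, f (V (-Real.log (‖x‖ ^ 2))) *
        Real.smoothTransition (k + 1 - -Real.log (‖x‖ ^ 2)) * φ x) atTop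
      (𝓝 ((∫ x, V (-Real.log (‖x‖ ^ 2)) * (Δ φ) x) +
        ∫ x, f (V (-Real.log (‖x‖ ^ 2))) * φ x)) := by
    refine Tendsto.add (hlim1.congr' ?_) hlim2
    filter_upwards [eventually_gt_atTop τ] with k hk using (htrunc k hk).2
  have := tendsto_nhds_unique hlim3 hlim4
  linarith

theorem locallyIntegrableOn_ball {g : Plane → ℝ} {R : ℝ}
    (hg : ∀ r, r < R → IntegrableOn g (Metric.ball 0 r)) :
    LocallyIntegrableOn g (Metric.ball 0 R) := by
  intro x hx
  rw [mem_ball_zero_iff] at hx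
  obtain ⟨r, hxr, hrR⟩ := exists_between hx
  exact ⟨Metric.ball 0 r, mem_nhdsWithin_of_mem_nhds
    (Metric.isOpen_ball.mem_nhds (by rwa [mem_ball_zero_iff])), hg r hrR⟩

theorem IsProfile.isDistributionalSolution (h : IsProfile f τ V V') (hf : Admissible f) :
    IsDistributionalSolution f (Metric.ball 0 (Real.exp (-τ / 2)))
      fun x => V (-Real.log (‖x‖ ^ 2)) where
  locInt := locallyIntegrableOn_ball fun _ hr => h.integrableOn hf hr.le
  locInt_comp := locallyIntegrableOn_ball fun _ hr => h.integrableOn_comp hf hr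
  weak φ hφ hc hs := by
    have h0 : ∀ x, x ∉ Metric.ball (0 : Plane) (Real.exp (-τ / 2)) → φ x = 0 ∧ (Δ φ) x = 0 := by
      intro x hx
      have hx' : x ∉ tsupport φ := fun hc => hx (hs hc)
      refine ⟨image_eq_zero_of_notMem_tsupport hx', ?_⟩
      have : φ =ᶠ[𝓝 x] fun _ => (0 : ℝ) := by
        filter_upwards [(isClosed_tsupport φ).isOpen_compl.mem_nhds hx'] with y hy
        exact image_eq_zero_of_notMem_tsupport hy
      rw [(InnerProductSpace.laplacian_congr_nhds this).eq_of_nhds,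
        InnerProductSpace.laplacian_const]
      rfl
    rw [setIntegral_eq_integral_of_forall_compl_eq_zero fun x hx => by rw [(h0 x hx).2, mul_zero],
      setIntegral_eq_integral_of_forall_compl_eq_zero fun x hx => by rw [(h0 x hx).1, mul_zero]]
    exact h.weak hf hφ hc hs

end Distribution

end SingularSol

/-! ### Assembly of the theorem. -/

theorem theorem2p2 (f : ℝ → ℝ) (B : ℝ)
    (hf1 : SingularSol.CondF1 f) (hf2 : SingularSol.CondF2 f B) (hR : SingularSol.CondR f B)
    (hC1 : ContDiffOn ℝ 1 f (Set.Ici 0))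
    (hpos : ∀ s, 0 < s → 0 < f s)
    (hF : ∀ s, 0 < s → MeasureTheory.IntegrableOn (fun τ => (f τ)⁻¹) (Set.Ioi s))
    (hderiv : ∀ s, 0 < s → 0 < deriv f s) :
    ∃ R : ℝ, 0 < R ∧ ∃ u : SingularSol.Plane → ℝ,
      SingularSol.IsClassicalRadialSolution f R u ∧
      Filter.Tendsto u (nhdsWithin 0 {0}ᶜ) Filter.atTop ∧
      SingularSol.HasSingularAsymptotics f B u ∧
      SingularSol.IsDistributionalSolution f (Metric.ball 0 R) u := by
  have hf : SingularSol.Admissible f := ⟨hC1, hpos, hF, hderiv⟩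
  obtain ⟨C, t₁, U, U', -, hU, hlim, hlim', hasymp⟩ := hf.exists_singular_near hf1 hf2 hR
  obtain ⟨τ, t₂, V, V', -, hVU, hV, hVc, hV0⟩ := hf.exists_extension hU hlim
  -- The two limits at infinity concern only t > t₂, where the extension agrees with the solution
  -- constructed near the origin.
  have hprof : SingularSol.IsProfile f τ V V' :=
    ⟨fun t ht => (hV t ht).1, fun t ht => (hV t ht).2.1, fun t ht => (hV t ht).2.2,
      hlim.congr' ((eventually_gt_atTop t₂).mono fun t ht => ((hVU t ht).1).symm),
      hlim'.congr' ((eventually_gt_atTop t₂).mono fun t ht => ((hVU t ht).2).symm)⟩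
  have hlog : ∀ x : SingularSol.Plane, -Real.log (‖x‖ ^ 2) = SingularSol.logRad x := fun x => by
    rw [SingularSol.logRad_eq, Real.log_pow]; push_cast; ring
  have htop : Tendsto (fun x : SingularSol.Plane => -Real.log (‖x‖ ^ 2)) (𝓝[{0}ᶜ] 0) atTop := by
    have h1 : Tendsto (fun x : SingularSol.Plane => ‖x‖) (𝓝[{0}ᶜ] 0) (𝓝[>] 0) :=
      tendsto_norm_nhdsNE_zero
    have h2 : Tendsto (fun y : ℝ => -2 * Real.log y) (𝓝[>] 0) atTop :=
      Real.tendsto_log_nhdsGT_zero.const_mul_atBot_of_neg (by norm_num)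
    refine (h2.comp h1).congr fun x => ?_
    simp only [Function.comp, Real.log_pow]; push_cast; ring
  refine ⟨Real.exp (-τ / 2), Real.exp_pos _, fun x => V (-Real.log (‖x‖ ^ 2)),
    hprof.isClassicalRadialSolution hf hVc hV0, hprof.tendsto.comp htop, ?_,
    hprof.isDistributionalSolution hf⟩
  -- The construction does not record the sign of C, hence the absolute value.
  refine Asymptotics.IsBigO.of_bound |C| ?_
  filter_upwards [htop.eventually_gt_atTop t₁, htop.eventually_gt_atTop t₂,
    self_mem_nhdsWithin] with x hx1 hx2 hx0
  have hxn : 0 < ‖x‖ := norm_pos_iff.2 hx0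
  rw [(hVU _ hx2).1, hlog x]
  rw [hlog x] at hx1
  have key := hasymp x hxn hx1
  have hrad : SingularSol.supRem f B (SingularSol.logRad x) =
      sSup ((fun y => SingularSol.R₁ f B y + SingularSol.R₂ f B y) ''
        {y : SingularSol.Plane | 0 < ‖y‖ ∧ ‖y‖ ≤ ‖x‖}) := by
    rw [SingularSol.supRem, ← SingularSol.norm_eq_exp_logRad hxn]
  rw [hrad] at key
  rw [Real.norm_eq_abs]
  exact key.trans ((le_abs_self _).trans (abs_mul _ _).le)
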